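/- Consider graphs on a fixed set of $n\ge 1$ vertices whose edges $e$ have non-negative integer weights (weight $1$ in the unweighted case; parallel edges are allowed and are told apart by integer labels). A finite set $S$ of updates is maintained, each being an insertion or a deletion of an edge at a time, with at most one update at each time; initially $S=\emptyset$. A retroactive operation either creates an update, $\mathrm{Insert}(e)$ or $\mathrm{Delete}(e)$, at a time $t$ at which $S$ has no update, or cancels the update of $S$ at time $t$. Let $T$ denote the current size of $S$. If $e$ is inserted at time $t_a$ and its earliest deletion after $t_a$ is at time $t_b$ ($t_b=+\infty$ if there is none), then $(t_a,t_b]$ is a lifespan of $e$; the edge set $E_t$ at time $t$ consists of the edges that have a lifespan containing $t$. A query at a time $t$ (possibly $t=+\infty$, the present) asks for the maximum weighted degree of the graph with edge set $E_t$, i.e. the maximum over all vertices of the sum of the weights of the incident edges of $E_t$. Work on a word RAM with unit-cost word operations and zero-initialised memory. Times, weights and labels are non-negative integers. Let $B\ge n$ be an upper bound on $T$ at all times and on all times, weights and labels that occur, and let the word size be any $w$ with $w\ge c\log_2(B+2)$ for a suitable absolute constant $c$ (so if $T$, the times, the weights and the labels are polynomially bounded in $n$, words of $O(\log n)$ bits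 suffice). Theorem. There exists a fully retroactive data structure for maintaining the maximum (weighted) degree of a graph, with amortized $O(\log^2 T)$ update time and worst-case $O(n\log T)$ query time. Precisely: there are a program, not depending on $n$, $B$ and $w$, and an absolute constant $C$ such that for every online sequence of retroactive operations and queries as above, starting from $S=\emptyset$, 1. every query is answered correctly and takes at most $C\,n\,\lfloor\log_2(T+2)\rfloor$ steps, where $T$ is the size of $S$ at the time of the query; 2. for every $N$, the total number of steps spent on the retroactive operations among the first $N$ requests is at most $C\sum_i \lfloor\log_2(T_i+2)\rfloor^2$, where the sum is over these operations and $T_i$ is the size of $S$ right after the $i$-th request. -/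

import Mathlib

namespace RetroDegree

/-! ### Edge updates, histories and the maximum degree -/

/-- A weighted undirected edge on the vertex set `Fin n`; an unordered pair of distinct endpoints is
written with the smaller one first. The label tells parallel copies of an edge apart (a simple graph
uses one label only; using a new label makes an inserted edge a new edge). -/
structure Edge (n : ℕ) where
  fst : Fin n
  snd : Fin n
  fst_lt_snd : fst < snd
  weight : ℕ
  label : ℕ

/-- An update of the graph. -/
inductive Update (n : ℕ) where
  | insert (e : Edge n)
  | delete (e : Edge n)

/-- The edge that an update is about. -/
def Update.edge {n : ℕ} : Update n → Edge n
  | .insert e => e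
  | .delete e => e

/-- The current set `S` of updates, each with its time. Its cardinality is `T`. -/
abbrev History (n : ℕ) := Finset (ℕ × Update n)

/-- There is an update at time `t`. -/
def History.Used {n : ℕ} (S : History n) (t : ℕ) : Prop := ∃ u, (t, u) ∈ S

/-- `t` lies in the lifespan `(a, b]` of the edge `e` inserted at time `a`, where `b` is the time of
the earliest deletion of `e` after `a`, and `b = ⊤` (the present) if there is none. -/
def History.InLifespan {n : ℕ} (S : History n) (e : Edge n) (a : ℕ) (t : WithTop ℕ) : Prop :=
  (a : WithTop ℕ) < t ∧ ∀ d : ℕ, a < d → (d, Update.delete e) ∈ S → t ≤ (d : WithTop ℕ)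

/-- The edge `e` exists at time `t`. -/
def History.Alive {n : ℕ} (S : History n) (t : WithTop ℕ) (e : Edge n) : Prop :=
  ∃ a : ℕ, (a, Update.insert e) ∈ S ∧ S.InLifespan e a t

open Classical in
/-- The set `E_t` of the edges that exist at time `t`. -/
noncomputable def History.edgesAt {n : ℕ} (S : History n) (t : WithTop ℕ) : Finset (Edge n) :=
  (S.image fun x => x.2.edge).filter fun e => S.Alive t e

open Classical in
/-- The weighted degree of the vertex `v` in the graph at time `t`. -/
noncomputable def History.degree {n : ℕ} (S : History n) (t : WithTop ℕ) (v : Fin n) : ℕ :=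
  ∑ e ∈ (S.edgesAt t).filter (fun e => v = e.fst ∨ v = e.snd), e.weight

/-- The maximum weighted degree of the graph at time `t`. -/
noncomputable def History.maxDegree {n : ℕ} (S : History n) (t : WithTop ℕ) : ℕ :=
  Finset.univ.sup fun v : Fin n => S.degree t v

/-! ### Retroactive operations and queries -/

/-- A request to the data structure: create an update at time `t`, cancel the update at time `t`,
or ask for the maximum degree at time `t`, where `t = ⊤` is the present. -/
inductive Request (n : ℕ) where
  | create (u : Update n) (t : ℕ)
  | cancel (t : ℕ)
  | query (t : WithTop ℕ)

/-- The requests that are retroactive operations, as opposed to queries. -/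
def Request.isOperation {n : ℕ} : Request n → Bool
  | .create _ _ => true
  | .cancel _ => true
  | .query _ => false

open Classical in
/-- The effect of a request on the set of updates. -/
noncomputable def Request.apply {n : ℕ} : Request n → History n → History n
  | .create u t, S => insert (t, u) S
  | .cancel t, S => S.filter fun x => x.1 ≠ t
  | .query _, S => S

/-- An update is created only at a time that has no update, and only an existing update is
cancelled. -/
def Request.Legal {n : ℕ} : Request n → History n → Prop
  | .create _ t, S => ¬ S.Used t
  | .cancel t, S => S.Used t
  | .query _, _ => True

/-- All numbers that occur in the request are at most `B`. -/
def Request.Bounded {n : ℕ} (B : ℕ) : Request n → Prop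
  | .create u t => t ≤ B ∧ u.edge.weight ≤ B ∧ u.edge.label ≤ B
  | .cancel t => t ≤ B
  | .query t => t = ⊤ ∨ t ≤ (B : WithTop ℕ)

/-- The set of updates before the `i`-th request of a sequence that starts with the empty graph. -/
noncomputable def historyBefore {n : ℕ} (req : ℕ → Request n) : ℕ → History n
  | 0 => ∅
  | i + 1 => (req i).apply (historyBefore req i)

/-! ### A word RAM

Registers and memory cells hold words, numbers below `2 ^ w`; addresses are words. Programs are
finite and use fixed registers and constants. Control flow is structured (sequences, conditionals,
loops), which costs no more than a constant factor against jumps. Every constant, register access,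
memory access, arithmetic operation, comparison, assignment and test costs one step. -/

/-- The contents of the registers and of the memory. -/
structure State where
  reg : ℕ → ℕ
  mem : ℕ → ℕ

/-- At the start, all registers and memory cells are zero. -/
def State.init : State := ⟨fun _ => 0, fun _ => 0⟩

/-- Write a register. -/
def State.setReg (s : State) (r x : ℕ) : State := ⟨Function.update s.reg r x, s.mem⟩

/-- Write a memory cell. -/
def State.setMem (s : State) (a x : ℕ) : State := ⟨s.reg, Function.update s.mem a x⟩

/-- Unit-cost operations on words. -/
inductive BinOp where
  | add | sub | mul | div | lt | eq

/-- The operations on numbers, before reduction to a word: subtraction is truncated at zero,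
division is integer division, and a comparison yields `1` or `0`. -/
def BinOp.eval : BinOp → ℕ → ℕ → ℕ
  | .add, x, y => x + y
  | .sub, x, y => x - y
  | .mul, x, y => x * y
  | .div, x, y => x / y
  | .lt, x, y => if x < y then 1 else 0
  | .eq, x, y => if x = y then 1 else 0

inductive Expr where
  | const (k : ℕ)
  | reg (r : ℕ)
  | load (a : Expr)
  | bin (op : BinOp) (x y : Expr)

/-- The value of an expression, with word size `w`; results are reduced modulo `2 ^ w`. -/
def Expr.eval (w : ℕ) (s : State) : Expr → ℕ
  | .const k => k % 2 ^ w
  | .reg r => s.reg r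
  | .load a => s.mem (a.eval w s)
  | .bin op x y => op.eval (x.eval w s) (y.eval w s) % 2 ^ w

/-- The number of steps for the evaluation of an expression: one for each node. -/
def Expr.cost : Expr → ℕ
  | .const _ => 1
  | .reg _ => 1
  | .load a => a.cost + 1
  | .bin _ x y => x.cost + y.cost + 1

inductive Program where
  | skip
  | set (r : ℕ) (x : Expr)
  | store (a x : Expr)
  | seq (p q : Program)
  | ite (b : Expr) (p q : Program)
  | while (b : Expr) (p : Program)

/-- `Exec w p s k s'`: on words of `w` bits, the program `p`, started in the state `s`, halts after
`k` steps in the state `s'`. -/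
inductive Exec (w : ℕ) : Program → State → ℕ → State → Prop
  | skip (s : State) : Exec w .skip s 1 s
  | set (r : ℕ) (x : Expr) (s : State) :
      Exec w (.set r x) s (x.cost + 1) (s.setReg r (x.eval w s))
  | store (a x : Expr) (s : State) :
      Exec w (.store a x) s (a.cost + x.cost + 1) (s.setMem (a.eval w s) (x.eval w s))
  | seq {p q : Program} {s₁ s₂ s₃ : State} {k l : ℕ} :
      Exec w p s₁ k s₂ → Exec w q s₂ l s₃ → Exec w (.seq p q) s₁ (k + l) s₃
  | ite_true {b : Expr} {p q : Program} {s s' : State} {k : ℕ} :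
      b.eval w s ≠ 0 → Exec w p s k s' → Exec w (.ite b p q) s (b.cost + 1 + k) s'
  | ite_false {b : Expr} {p q : Program} {s s' : State} {k : ℕ} :
      b.eval w s = 0 → Exec w q s k s' → Exec w (.ite b p q) s (b.cost + 1 + k) s'
  | while_false {b : Expr} {p : Program} {s : State} :
      b.eval w s = 0 → Exec w (.while b p) s (b.cost + 1) s
  | while_true {b : Expr} {p : Program} {s₁ s₂ s₃ : State} {k l : ℕ} :
      b.eval w s₁ ≠ 0 → Exec w p s₁ k s₂ → Exec w (.while b p) s₂ l s₃ →
      Exec w (.while b p) s₁ (b.cost + 1 + k + l) s₃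

/-! ### The interface -/

/-- Pass a request to the machine: register `0` receives `n`, register `1` the code of the request,
register `2` its time, and registers `3` to `6` the edge. Everything else is kept from the previous
request. -/
def Request.pass {n : ℕ} : Request n → State → State
  | .create (.insert e) t, s =>
      ((((((s.setReg 0 n).setReg 1 0).setReg 2 t).setReg 3 e.fst).setReg 4 e.snd).setReg 5
        e.weight).setReg 6 e.label
  | .create (.delete e) t, s =>
      ((((((s.setReg 0 n).setReg 1 1).setReg 2 t).setReg 3 e.fst).setReg 4 e.snd).setReg 5
        e.weight).setReg 6 e.label
  | .cancel t, s => ((s.setReg 0 n).setReg 1 2).setReg 2 t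
  | .query (some t), s => ((s.setReg 0 n).setReg 1 3).setReg 2 t
  | .query none, s => (s.setReg 0 n).setReg 1 4

/-- The answer of the machine to a query is in register `0` when the program halts. -/
def State.answer (s : State) : ℕ := s.reg 0

/-- `IsRun p w req s k`: the program `p`, on words of `w` bits, is executed once for each request of
the sequence `req`, on the registers and memory that the previous execution has left behind; `s i`
is the state before the `i`-th request and `k i` is the number of steps that this request takes. -/
def IsRun {n : ℕ} (p : Program) (w : ℕ) (req : ℕ → Request n) (s : ℕ → State) (k : ℕ → ℕ) : Prop :=
  s 0 = State.init ∧ ∀ i, Exec w p ((req i).pass (s i)) (k i) (s (i + 1))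

end RetroDegree

namespace RetroDegree

/-! ### Reasoning about programs -/

/-! An update of an edge `e` adds the weight of `e` to the degrees of its endpoints if it is an
insertion, and removes that weight if `e` existed just before. Hence the degree of `v` at a given
time is a difference of two prefix sums over the earlier times: the weights of the insertions at
`v`, minus the weights of the updates at `v` whose edge exists just before (`sum_content`,
`Lists.degree`). Inserting an edge that is present contributes to both sums, deleting an absent one
to neither. With both sets of times in balanced search trees that store subtree sums, a query needs
two prefix sums per vertex, which gives `O(n log T)`.

Whether an edge exists just before an update depends only on the kind of the preceding update of the
same edge. Creating or cancelling an update therefore changes the entries at its own time and at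
most those of the next update of the same edge (`content_change`). A third family of trees, one for
each edge, holds the updates of that edge and supplies the predecessor and the successor. Creation
and cancellation toggle the same entries, so one program serves both. It performs one search and at
most seven toggles (`update_spec`), hence every single operation costs `O(log T)`, which is within
the amortized bound `O(log² T)`.

On the machine, the node for the time `t` in the tree `i` is the record with number `code i t`.
Since `code` is injective, neither an allocator nor a dictionary is needed; since it increases with
`t`, the record number is also the search key. Zero memory represents the empty set of updates. The
trees are AVL trees: `bal_spec` restores the balance at one node, `descend_spec` and `ascend_spec`
walk down and up a path whose nodes are on a stack, `unlink_spec` removes a node. The tree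
operations are summarised in `toggle_spec`, `search_spec` and `sumBefore_spec`. All record numbers
are polynomial in `B`, which determines the word size. The invariant `Valid` is preserved by every
request (`Valid.step`), and iterating this gives the theorem. -/

/-- The program halts within `K` steps in a state that satisfies `Q`. -/
def Runs (w : ℕ) (p : Program) (s : State) (K : ℕ) (Q : State → Prop) : Prop :=
  ∃ k s', Exec w p s k s' ∧ k ≤ K ∧ Q s'

/-- The registers that a program may write. -/
def Program.writes : Program → List ℕ
  | .skip => []
  | .set r _ => [r]
  | .store _ _ => []
  | .seq p q => p.writes ++ q.writes
  | .ite _ p q => p.writes ++ q.writes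
  | .while _ p => p.writes

/-- The program never writes to the memory. -/
def Program.readOnly : Program → Bool
  | .skip => true
  | .set _ _ => true
  | .store _ _ => false
  | .seq p q => p.readOnly && q.readOnly
  | .ite _ p q => p.readOnly && q.readOnly
  | .while _ p => p.readOnly

/-- The program has no loops. -/
def Program.straight : Program → Bool
  | .skip => true
  | .set _ _ => true
  | .store _ _ => true
  | .seq p q => p.straight && q.straight
  | .ite _ p q => p.straight && q.straight
  | .while _ _ => false

/-- An upper bound on the number of steps of a program without loops. -/
def Program.bound : Program → ℕ
  | .skip => 1
  | .set _ x => x.cost + 1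
  | .store a x => a.cost + x.cost + 1
  | .seq p q => p.bound + q.bound
  | .ite b p q => b.cost + 1 + (p.bound + q.bound)
  | .while _ _ => 0

/-- The final state of a program without loops. -/
def Program.sem (w : ℕ) : Program → State → State
  | .skip, s => s
  | .set r x, s => s.setReg r (x.eval w s)
  | .store a x, s => s.setMem (a.eval w s) (x.eval w s)
  | .seq p q, s => q.sem w (p.sem w s)
  | .ite b p q, s => if b.eval w s = 0 then q.sem w s else p.sem w s
  | .while _ _, s => s

/-- Loop-free code always halts, so its verification becomes rewriting with `sem`. Adding the bounds
of both branches of a conditional replaces their maximum; only constants are affected. -/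
theorem Program.exec_sem (w : ℕ) (p : Program) (hp : p.straight = true) (s : State) :
    ∃ k, Exec w p s k (p.sem w s) ∧ k ≤ p.bound := by
  induction p generalizing s with
  | skip => exact ⟨_, .skip s, le_rfl⟩
  | set r x => exact ⟨_, .set r x s, le_rfl⟩
  | store a x => exact ⟨_, .store a x s, le_rfl⟩
  | seq p q ihp ihq =>
    simp only [Program.straight, Bool.and_eq_true] at hp
    obtain ⟨k, hk, hk'⟩ := ihp hp.1 s
    obtain ⟨l, hl, hl'⟩ := ihq hp.2 (p.sem w s)
    exact ⟨_, .seq hk hl, by simp only [Program.bound]; omega⟩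
  | ite b p q ihp ihq =>
    simp only [Program.straight, Bool.and_eq_true] at hp
    by_cases hb : b.eval w s = 0
    · obtain ⟨k, hk, hk'⟩ := ihq hp.2 s
      refine ⟨b.cost + 1 + k, ?_, ?_⟩
      · simp only [Program.sem, hb, if_true]
        exact .ite_false hb hk
      · simp only [Program.bound]; omega
    · obtain ⟨k, hk, hk'⟩ := ihp hp.1 s
      refine ⟨b.cost + 1 + k, ?_, ?_⟩
      · simp only [Program.sem, hb, if_false]
        exact .ite_true hb hk
      · simp only [Program.bound]; omega
  | _ => simp [Program.straight] at hp

/-- A syntactic frame rule: for a concrete program the side condition is settled by `decide`, so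
specifications need not list the registers that survive. -/
theorem Exec.reg_eq {w : ℕ} {p : Program} {s s' : State} {k : ℕ} (h : Exec w p s k s') {r : ℕ}
    (hr : r ∉ p.writes) : s'.reg r = s.reg r := by
  induction h with
  | skip s => rfl
  | set r' x s =>
    simp only [Program.writes, List.mem_singleton] at hr
    simp [State.setReg, Function.update_of_ne hr]
  | store a x s => rfl
  | seq _ _ ih₁ ih₂ =>
    simp only [Program.writes, List.mem_append, not_or] at hr
    rw [ih₂ hr.2, ih₁ hr.1]
  | ite_true _ _ ih =>
    simp only [Program.writes, List.mem_append, not_or] at hr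
    exact ih hr.1
  | ite_false _ _ ih =>
    simp only [Program.writes, List.mem_append, not_or] at hr
    exact ih hr.2
  | while_false _ => rfl
  | while_true _ _ _ ih₁ ih₂ => rw [ih₂ hr, ih₁ hr]

theorem Exec.mem_eq {w : ℕ} {p : Program} {s s' : State} {k : ℕ} (h : Exec w p s k s')
    (hp : p.readOnly = true) : s'.mem = s.mem := by
  induction h with
  | skip s => rfl
  | set r' x s => rfl
  | store a x s => simp [Program.readOnly] at hp
  | seq _ _ ih₁ ih₂ =>
    simp only [Program.readOnly, Bool.and_eq_true] at hp
    rw [ih₂ hp.2, ih₁ hp.1]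
  | ite_true _ _ ih =>
    simp only [Program.readOnly, Bool.and_eq_true] at hp
    exact ih hp.1
  | ite_false _ _ ih =>
    simp only [Program.readOnly, Bool.and_eq_true] at hp
    exact ih hp.2
  | while_false _ => rfl
  | while_true _ _ _ ih₁ ih₂ => rw [ih₂ hp, ih₁ hp]

theorem Program.sem_reg {w : ℕ} {p : Program} (hp : p.straight = true) (s : State) {r : ℕ}
    (hr : r ∉ p.writes) : (p.sem w s).reg r = s.reg r := by
  obtain ⟨k, hk, -⟩ := p.exec_sem w hp s
  exact hk.reg_eq hr

theorem Runs.straight {w : ℕ} {p : Program} {s : State} {K : ℕ} {Q : State → Prop}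
    (hp : p.straight = true) (hK : p.bound ≤ K) (hQ : Q (p.sem w s)) : Runs w p s K Q := by
  obtain ⟨k, hk, hk'⟩ := p.exec_sem w hp s
  exact ⟨k, _, hk, hk'.trans hK, hQ⟩

theorem Runs.frame {w : ℕ} {p : Program} {s : State} {K : ℕ} {Q : State → Prop}
    (h : Runs w p s K Q) :
    Runs w p s K fun s' => Q s' ∧ (∀ r, r ∉ p.writes → s'.reg r = s.reg r) ∧
      (p.readOnly = true → s'.mem = s.mem) := by
  obtain ⟨k, s', hk, hK, hQ⟩ := h
  exact ⟨k, s', hk, hK, hQ, fun _ => hk.reg_eq, hk.mem_eq⟩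

theorem Runs.mono {w : ℕ} {p : Program} {s : State} {K K' : ℕ} {Q Q' : State → Prop}
    (h : Runs w p s K Q) (hK : K ≤ K') (hQ : ∀ s', Q s' → Q' s') : Runs w p s K' Q' := by
  obtain ⟨k, s', hk, hk', h⟩ := h
  exact ⟨k, s', hk, hk'.trans hK, hQ _ h⟩

theorem Runs.seq {w : ℕ} {p q : Program} {s : State} {K L : ℕ} {P Q : State → Prop}
    (hp : Runs w p s K P) (hq : ∀ s', P s' → Runs w q s' L Q) : Runs w (.seq p q) s (K + L) Q := by
  obtain ⟨k, s', hk, hK, hP⟩ := hp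
  obtain ⟨l, s'', hl, hL, hQ⟩ := hq s' hP
  exact ⟨_, s'', .seq hk hl, by omega, hQ⟩

theorem Runs.straight_seq {w : ℕ} {p q : Program} {s : State} {L : ℕ} {Q : State → Prop}
    (hp : p.straight = true) (hq : Runs w q (p.sem w s) L Q) :
    Runs w (.seq p q) s (p.bound + L) Q :=
  Runs.seq (P := fun s' => s' = p.sem w s) (Runs.straight hp le_rfl rfl) (by rintro _ rfl; exact hq)

theorem Runs.ite {w : ℕ} {b : Expr} {p q : Program} {s : State} {K : ℕ} {Q : State → Prop}
    (hp : b.eval w s ≠ 0 → Runs w p s K Q) (hq : b.eval w s = 0 → Runs w q s K Q) :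
    Runs w (.ite b p q) s (b.cost + 1 + K) Q := by
  by_cases hb : b.eval w s = 0
  · obtain ⟨k, s', hk, hK, hQ⟩ := hq hb
    exact ⟨_, s', .ite_false hb hk, by omega, hQ⟩
  · obtain ⟨k, s', hk, hK, hQ⟩ := hp hb
    exact ⟨_, s', .ite_true hb hk, by omega, hQ⟩

/-- A loop whose body decreases the variant `f` takes at most `f s` rounds. -/
theorem Runs.loop {w : ℕ} {b : Expr} {p : Program} {K : ℕ} {α : Type*} (f : α → ℕ)
    (I : α → State → Prop)
    (step : ∀ x s, I x s → b.eval w s ≠ 0 → Runs w p s K fun s' => ∃ y, f y < f x ∧ I y s')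
    (x : α) (s : State) (hI : I x s) :
    Runs w (.while b p) s (f x * (b.cost + 1 + K) + (b.cost + 1))
      fun s' => b.eval w s' = 0 ∧ ∃ y, I y s' := by
  induction hm : f x using Nat.strong_induction_on generalizing x s with
  | _ m ih =>
  subst hm
  by_cases hb : b.eval w s = 0
  · exact ⟨_, s, .while_false hb, by omega, hb, x, hI⟩
  · obtain ⟨k, s', hk, hK, y, hy, hI'⟩ := step x s hI hb
    obtain ⟨l, s'', hl, hL, hQ⟩ := ih (f y) hy y s' hI' rfl
    refine ⟨_, s'', .while_true hb hk hl, ?_, hQ⟩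
    have : (f y + 1) * (b.cost + 1 + K) ≤ f x * (b.cost + 1 + K) :=
      Nat.mul_le_mul_right _ hy
    rw [Nat.add_mul, Nat.one_mul] at this
    omega

/-! ### Addresses -/

/-- The address of the cell `f` of the record `k`; records have 16 cells. -/
def fld (f k : ℕ) : ℕ := 16 * k + f

/-- Different cells of equally numbered records never collide, so unrelated structures share the
numbering. Cells 0 to 4 of record `k` are the left child, right child, height, subtree sum and value
of the node `k`; cell 5 is the stack entry at depth `k`; cell 7 is the root of the tree number `k`;
cells 8 to 12 are the update at time `k`. -/
theorem fld_inj {f g a b : ℕ} (hf : f < 16) (hg : g < 16) : fld f a = fld g b ↔ f = g ∧ a = b := by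
  unfold fld; omega

/-- The record `k` is addressable. -/
def Small (w k : ℕ) : Prop := 16 * k + 16 ≤ 2 ^ w

/-- The address of the cell `f` of the record `x`. -/
def addr (f x : Expr) : Expr := .bin .add (.bin .mul (.const 16) x) f

/-- The contents of the cell `f` of the record `x`. -/
def cell (f : ℕ) (x : Expr) : Expr := .load (addr (.const f) x)

theorem Small.lt {w k : ℕ} (h : Small w k) : k + 15 < 2 ^ w := by
  unfold Small at h; omega

theorem Small.of_le {w k l : ℕ} (h : Small w k) (hl : l ≤ k) : Small w l := by
  unfold Small at *; omega

theorem eval_addr {w : ℕ} {s : State} {f x : Expr} (hx : Small w (x.eval w s)) (hf : f.eval w s < 16) :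
    (addr f x).eval w s = fld (f.eval w s) (x.eval w s) := by
  unfold Small at hx
  simp only [addr, Expr.eval, BinOp.eval]
  rcases Nat.lt_or_ge 16 (2 ^ w) with h | h
  · rw [Nat.mod_eq_of_lt h, Nat.mod_eq_of_lt (a := 16 * _) (by omega), Nat.mod_eq_of_lt (by omega)]
    rfl
  -- With this word size the constant 16 is reduced to 0, but then 0 is the only addressable record
  -- and the product is still right.
  · have h16 : 2 ^ w = 16 := by omega
    have : x.eval w s = 0 := by omega
    rw [this, h16, fld]; omega

theorem eval_const {w k : ℕ} {s : State} (hk : k < 2 ^ w) : (Expr.const k).eval w s = k := by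
  simp [Expr.eval, Nat.mod_eq_of_lt hk]

theorem eval_cell {w f : ℕ} {s : State} {x : Expr} (hx : Small w (x.eval w s)) (hf : f < 16) :
    (cell f x).eval w s = s.mem (fld f (x.eval w s)) := by
  have : (Expr.const f).eval w s = f := eval_const (by have := hx.lt; omega)
  change s.mem ((addr (.const f) x).eval w s) = _
  rw [eval_addr hx (by rwa [this]), this]

theorem eval_reg {w r : ℕ} {s : State} : (Expr.reg r).eval w s = s.reg r := rfl

theorem eval_load {w : ℕ} {s : State} {a : Expr} :
    (Expr.load a).eval w s = s.mem (a.eval w s) := rfl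

theorem eval_lt {w : ℕ} {s : State} {x y : Expr} (hw : 1 < 2 ^ w) :
    (Expr.bin .lt x y).eval w s = if x.eval w s < y.eval w s then 1 else 0 := by
  simp only [Expr.eval, BinOp.eval]
  split_ifs <;> simp [Nat.mod_eq_of_lt hw]

theorem eval_eq {w : ℕ} {s : State} {x y : Expr} (hw : 1 < 2 ^ w) :
    (Expr.bin .eq x y).eval w s = if x.eval w s = y.eval w s then 1 else 0 := by
  simp only [Expr.eval, BinOp.eval]
  split_ifs <;> simp [Nat.mod_eq_of_lt hw]

theorem eval_add {w : ℕ} {s : State} {x y : Expr} (h : x.eval w s + y.eval w s < 2 ^ w) :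
    (Expr.bin .add x y).eval w s = x.eval w s + y.eval w s := by
  simp only [Expr.eval, BinOp.eval, Nat.mod_eq_of_lt h]

theorem eval_mul {w : ℕ} {s : State} {x y : Expr} (h : x.eval w s * y.eval w s < 2 ^ w) :
    (Expr.bin .mul x y).eval w s = x.eval w s * y.eval w s := by
  simp only [Expr.eval, BinOp.eval, Nat.mod_eq_of_lt h]

theorem eval_sub {w : ℕ} {s : State} {x y : Expr} (h : x.eval w s < 2 ^ w) :
    (Expr.bin .sub x y).eval w s = x.eval w s - y.eval w s := by
  simp only [Expr.eval, BinOp.eval]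
  exact Nat.mod_eq_of_lt (by omega)

theorem eval_div {w : ℕ} {s : State} {x y : Expr} (h : x.eval w s < 2 ^ w) :
    (Expr.bin .div x y).eval w s = x.eval w s / y.eval w s := by
  simp only [Expr.eval, BinOp.eval]
  exact Nat.mod_eq_of_lt (lt_of_le_of_lt (Nat.div_le_self _ _) h)

@[simp] theorem State.setReg_mem (s : State) (r x : ℕ) : (s.setReg r x).mem = s.mem := rfl
@[simp] theorem State.setMem_reg (s : State) (a x : ℕ) : (s.setMem a x).reg = s.reg := rfl
@[simp] theorem State.setReg_reg (s : State) (r x q : ℕ) :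
    (s.setReg r x).reg q = if q = r then x else s.reg q := by
  simp [State.setReg, Function.update_apply]
@[simp] theorem State.setMem_mem (s : State) (a x b : ℕ) :
    (s.setMem a x).mem b = if b = a then x else s.mem b := by
  simp [State.setMem, Function.update_apply]

/-! ### AVL trees -/

/-- Binary search trees; the keys are the addresses of the records of the nodes, `0` is the empty
tree. -/
inductive Tree where
  | nil
  | node (l : Tree) (k : ℕ) (r : Tree)

namespace Tree

def root : Tree → ℕ
  | nil => 0
  | node _ k _ => k

def keys : Tree → List ℕ
  | nil => []
  | node l k r => l.keys ++ k :: r.keys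

def height : Tree → ℕ
  | nil => 0
  | node l _ r => max l.height r.height + 1

def AVL : Tree → Prop
  | nil => True
  | node l _ r => l.AVL ∧ r.AVL ∧ l.height ≤ r.height + 1 ∧ r.height ≤ l.height + 1

/-- The node with the child `a` on the side `d` and the child `b` on the other side. -/
def mk (d : ℕ) (a : Tree) (k : ℕ) (b : Tree) : Tree := if d = 0 then node a k b else node b k a

/-- The tree `t` is stored in the memory `m`. -/
def Repr (w : ℕ) (m : ℕ → ℕ) : Tree → Prop
  | nil => True
  | node l k r => k ≠ 0 ∧ Small w k ∧ m (fld 0 k) = l.root ∧ m (fld 1 k) = r.root ∧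
      m (fld 2 k) = max l.height r.height + 1 ∧
      m (fld 3 k) = ((node l k r).keys.map fun x => m (fld 4 x)).sum % 2 ^ w ∧
      l.Repr w m ∧ r.Repr w m

theorem height_le_length (t : Tree) : t.height ≤ t.keys.length := by
  induction t with
  | nil => simp [height]
  | node l k r ihl ihr => simp only [height, keys, List.length_append, List.length_cons]; omega

/-- The square avoids Fibonacci numbers. If the subtree with fewer nodes has `c` of them, then `(2 *
(c + 1)) ^ 2` is at most the square of the total size plus one; and as the heights differ by at most
one, two to the new height is at most four times two to the height of either subtree. -/
theorem AVL.two_pow_height {t : Tree} (h : t.AVL) : 2 ^ t.height ≤ (t.keys.length + 1) ^ 2 := by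
  induction t with
  | nil => simp [height, keys]
  | node l k r ihl ihr =>
    obtain ⟨hl, hr, h₁, h₂⟩ := h
    specialize ihl hl
    specialize ihr hr
    simp only [height, keys, List.length_append, List.length_cons]
    set a := l.keys.length
    set b := r.keys.length
    have key : ∀ i j c d : ℕ, i ≤ j → j ≤ i + 1 → 2 ^ i ≤ (c + 1) ^ 2 → 2 ^ j ≤ (d + 1) ^ 2 →
        2 ^ (j + 1) ≤ (c + d + 2) ^ 2 := by
      intro i j c d hij hji hc hd
      have h₁ : 2 ^ (j + 1) ≤ 2 ^ (i + 2) := Nat.pow_le_pow_right (by norm_num) (by omega)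
      have h₂ : 2 ^ i ≤ 2 ^ j := Nat.pow_le_pow_right (by norm_num) hij
      rcases Nat.le_total c d with h | h
      · have : (2 * (c + 1)) ^ 2 ≤ (c + d + 2) ^ 2 := Nat.pow_le_pow_left (by omega) 2
        have : 2 ^ (i + 2) = 4 * 2 ^ i := by ring
        nlinarith
      · have : (2 * (d + 1)) ^ 2 ≤ (c + d + 2) ^ 2 := Nat.pow_le_pow_left (by omega) 2
        rw [pow_succ]
        nlinarith
    rcases Nat.le_total l.height r.height with h | h
    · rw [max_eq_right h, show a + (b + 1) + 1 = a + b + 2 by ring]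
      exact key _ _ _ _ h h₂ ihl ihr
    · rw [max_eq_left h, show a + (b + 1) + 1 = b + a + 2 by ring]
      exact key _ _ _ _ h h₁ ihr ihl

theorem AVL.height_le_log {t : Tree} (h : t.AVL) {N : ℕ} (hN : t.keys.length ≤ N) :
    t.height ≤ 4 * Nat.log 2 (N + 2) := by
  have h₁ := h.two_pow_height
  have h₂ : t.keys.length + 1 < 2 ^ (Nat.log 2 (N + 2) + 1) :=
    lt_of_le_of_lt (by omega) (Nat.lt_pow_succ_log_self (by norm_num) (N + 2))
  have h₃ : 2 ^ t.height < 2 ^ (2 * (Nat.log 2 (N + 2) + 1)) := by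
    refine lt_of_le_of_lt h₁ ?_
    rw [mul_comm, pow_mul]
    exact Nat.pow_lt_pow_left h₂ (by norm_num)
  have h₄ := (Nat.pow_lt_pow_iff_right (by norm_num)).1 h₃
  -- The height is less than `2 * (log + 1)`; a logarithm of at least 1 turns the additive constant
  -- into the factor 4.
  have h₅ : 1 ≤ Nat.log 2 (N + 2) := Nat.log_pos (by norm_num) (by omega)
  omega

theorem Repr.congr {w : ℕ} {m m' : ℕ → ℕ} {t : Tree} (h : t.Repr w m)
    (hm : ∀ k ∈ t.keys, ∀ f < 5, m' (fld f k) = m (fld f k)) : t.Repr w m' := by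
  induction t with
  | nil => trivial
  | node l k r ihl ihr =>
    obtain ⟨h₁, h₂, h₃, h₄, h₅, h₆, h₇, h₈⟩ := h
    have hk : k ∈ (node l k r).keys := by simp [keys]
    refine ⟨h₁, h₂, ?_, ?_, ?_, ?_, ihl h₇ fun x hx => hm x (by simp [keys, hx]),
      ihr h₈ fun x hx => hm x (by simp [keys, hx])⟩
    · rw [hm k hk 0 (by norm_num), h₃]
    · rw [hm k hk 1 (by norm_num), h₄]
    · rw [hm k hk 2 (by norm_num), h₅]
    · rw [hm k hk 3 (by norm_num), h₆]
      congr 2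
      exact List.map_congr_left fun x hx => (hm x hx 4 (by norm_num)).symm

theorem Repr.small {w : ℕ} {m : ℕ → ℕ} {t : Tree} (h : t.Repr w m) {k : ℕ} (hk : k ∈ t.keys) :
    k ≠ 0 ∧ Small w k := by
  induction t with
  | nil => simp [keys] at hk
  | node l k' r ihl ihr =>
    simp only [keys, List.mem_append, List.mem_cons] at hk
    rcases hk with hk | rfl | hk
    · exact ihl h.2.2.2.2.2.2.1 hk
    · exact ⟨h.1, h.2.1⟩
    · exact ihr h.2.2.2.2.2.2.2 hk

theorem root_mem {t : Tree} (h : t.root ≠ 0) : t.root ∈ t.keys := by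
  cases t with
  | nil => simp [root] at h
  | node l k r => simp [root, keys]

theorem Repr.small_root {w : ℕ} {m : ℕ → ℕ} {t : Tree} (h : t.Repr w m) (h0 : Small w 0) :
    Small w t.root := by
  cases t with
  | nil => exact h0
  | node l k r => exact h.2.1

/-- The cells of the empty tree. -/
def NilOK (m : ℕ → ℕ) : Prop := m (fld 2 0) = 0 ∧ m (fld 3 0) = 0 ∧ m (fld 4 0) = 0

/-- Record 0 is a sentinel for the empty tree: height and sum can be read through a child pointer
without testing for emptiness. -/
theorem Repr.height_eq {w : ℕ} {m : ℕ → ℕ} {t : Tree} (h : t.Repr w m) (h0 : NilOK m) :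
    m (fld 2 t.root) = t.height := by
  cases t with
  | nil => exact h0.1
  | node l k r => exact h.2.2.2.2.1

theorem Repr.sum_eq {w : ℕ} {m : ℕ → ℕ} {t : Tree} (h : t.Repr w m) (h0 : NilOK m) :
    m (fld 3 t.root) = (t.keys.map fun x => m (fld 4 x)).sum % 2 ^ w := by
  cases t with
  | nil => simp [root, keys, h0.2.1]
  | node l k r => exact h.2.2.2.2.2.1

/-- A duplicate-free list of addressable records is short. -/
theorem length_lt {w : ℕ} {l : List ℕ} (hl : l.Nodup) (hs : ∀ k ∈ l, k ≠ 0 ∧ Small w k)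
    (h0 : Small w 0) : Small w l.length := by
  -- There are at most `2 ^ w / 16 - 1` nonzero addressable records. Thus node counts, heights and
  -- stack depths fit into a word without a separate bound on the size of a tree.
  have h : l.toFinset ⊆ Finset.Icc 1 (2 ^ w / 16 - 1) := by
    intro k hk
    have := hs k (by simpa using hk)
    simp only [Finset.mem_Icc]
    unfold Small at this
    omega
  have h' := Finset.card_le_card h
  rw [List.toFinset_card_of_nodup hl, Nat.card_Icc] at h'
  unfold Small at *
  omega

/-- The oriented constructor `mk` allows mirror-image cases of descents, rotations and rebalancing
to be treated at once; the two orientations are separated only for the order of the keys. -/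
theorem keys_mk (d : ℕ) (a : Tree) (k : ℕ) (b : Tree) :
    (mk d a k b).keys = if d = 0 then a.keys ++ k :: b.keys else b.keys ++ k :: a.keys := by
  unfold mk; split_ifs <;> rfl

theorem mem_keys_mk {d : ℕ} {a : Tree} {k : ℕ} {b : Tree} {x : ℕ} :
    x ∈ (mk d a k b).keys ↔ x ∈ a.keys ∨ x = k ∨ x ∈ b.keys := by
  rw [keys_mk]; split_ifs <;> simp <;> tauto

theorem root_mk (d : ℕ) (a : Tree) (k : ℕ) (b : Tree) : (mk d a k b).root = k := by
  unfold mk; split_ifs <;> rfl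

theorem height_mk (d : ℕ) (a : Tree) (k : ℕ) (b : Tree) :
    (mk d a k b).height = max a.height b.height + 1 := by
  unfold mk; split_ifs <;> simp [height, max_comm]

theorem AVL_mk {d : ℕ} {a : Tree} {k : ℕ} {b : Tree} :
    (mk d a k b).AVL ↔ a.AVL ∧ b.AVL ∧ a.height ≤ b.height + 1 ∧ b.height ≤ a.height + 1 := by
  unfold mk; split_ifs <;> simp [AVL] <;> tauto

/-- Every tree but the empty one is a node in both orientations. -/
theorem exists_mk {t : Tree} (h : t.height ≠ 0) (d : ℕ) : ∃ a k b, t = mk d a k b := by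
  cases t with
  | nil => simp [height] at h
  | node l k r =>
    by_cases hd : d = 0
    · exact ⟨l, k, r, by simp [mk, hd]⟩
    · exact ⟨r, k, l, by simp [mk, hd]⟩

theorem Repr.of_mk {w : ℕ} {m : ℕ → ℕ} {d : ℕ} {a : Tree} {k : ℕ} {b : Tree} (hd : d < 2)
    (h : (mk d a k b).Repr w m) : k ≠ 0 ∧ Small w k ∧ m (fld d k) = a.root ∧
      m (fld (1 - d) k) = b.root ∧ a.Repr w m ∧ b.Repr w m := by
  obtain rfl | rfl : d = 0 ∨ d = 1 := by omega
  · simp only [mk, if_true, Repr] at h; tauto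
  · simp only [mk, one_ne_zero, if_false, Repr] at h; tauto

end Tree

/-! ### Repairing a node, rotations and rebalancing -/

/-- The register `r` holds the address of a node with the children `a` on the side `d` and `b`. -/
structure NodeAt (w : ℕ) (m : ℕ → ℕ) (k d : ℕ) (a b : Tree) : Prop where
  ne_zero : k ≠ 0
  small : Small w k
  left : m (fld d k) = a.root
  right : m (fld (1 - d) k) = b.root
  reprl : a.Repr w m
  reprr : b.Repr w m
  notMem : k ∉ a.keys ∧ k ∉ b.keys

/-- `NodeAt` describes a node whose children are in place while its height and sum may be stale, as
is the case between a change of a child and `fix`. -/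
theorem NodeAt.symm {w : ℕ} {m : ℕ → ℕ} {k d : ℕ} {a b : Tree} (hd : d < 2)
    (h : NodeAt w m k d a b) : NodeAt w m k (1 - d) b a :=
  ⟨h.1, h.2, h.4, by rw [show 1 - (1 - d) = d by omega]; exact h.3, h.6, h.5, h.7.symm⟩

/-- Recompute the height and the sum of the node in register `r` from its children. -/
def fix (r : ℕ) : Program :=
  .seq (.store (addr (.const 2) (.reg r))
      (.bin .add (.bin .add (cell 2 (cell 0 (.reg r)))
        (.bin .sub (cell 2 (cell 1 (.reg r))) (cell 2 (cell 0 (.reg r))))) (.const 1)))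
    (.store (addr (.const 3) (.reg r))
      (.bin .add (.bin .add (cell 3 (cell 0 (.reg r))) (cell 3 (cell 1 (.reg r))))
        (cell 4 (.reg r))))

/-- The maximum of the heights is obtained as `l + (r - l)` with truncated subtraction. The sums are
kept modulo `2 ^ w`, with which addition is compatible, so no bound on the stored values is needed.
-/
theorem fix_spec {w : ℕ} {s : State} {r k d : ℕ} {a b : Tree} (hd : d < 2) (h0 : Small w 0)
    (hr : s.reg r = k) (hn : Tree.NilOK s.mem) (h : NodeAt w s.mem k d a b)
    (hh : Small w (max a.height b.height)) :
    ((fix r).sem w s).reg = s.reg ∧ (Tree.mk d a k b).Repr w ((fix r).sem w s).mem ∧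
      ∀ x, x ≠ fld 2 k → x ≠ fld 3 k → ((fix r).sem w s).mem x = s.mem x := by
  have hkl := h.7.1
  have hkr := h.7.2
  have hsa := h.reprl.small_root h0
  have hsb := h.reprr.small_root h0
  have key : ∃ l r : Tree, Tree.mk d a k b = .node l k r ∧ NodeAt w s.mem k 0 l r ∧
      Small w (max l.height r.height) := by
    obtain rfl | rfl : d = 0 ∨ d = 1 := by omega
    · exact ⟨a, b, by simp [Tree.mk], h, hh⟩
    · exact ⟨b, a, by simp [Tree.mk], h.symm hd, by rwa [max_comm]⟩
  obtain ⟨l, r', hmk, h, hh⟩ := key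
  rw [hmk]
  clear hmk hsa hsb hkl hkr
  have hsl := h.reprl.small_root h0
  have hsr := h.reprr.small_root h0
  have h2 := h0.lt
  have hk := h.small
  have hhl := h.reprl.height_eq hn
  have hhr := h.reprr.height_eq hn
  have hul := h.reprl.sum_eq hn
  have hur := h.reprr.sum_eq hn
  have hl0 := h.left
  have hl1 := h.right
  simp only [Nat.sub_zero] at hl1
  have e0 : ∀ s' : State, s'.reg r = k → (∀ f, f = 0 ∨ f = 1 → s'.mem (fld f k) = s.mem (fld f k)) →
      (cell 0 (.reg r)).eval w s' = l.root ∧ (cell 1 (.reg r)).eval w s' = r'.root := by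
    intro s' hr hf
    constructor
    · rw [eval_cell (by rwa [eval_reg, hr]) (by norm_num), eval_reg, hr, hf 0 (by simp), hl0]
    · rw [eval_cell (by rwa [eval_reg, hr]) (by norm_num), eval_reg, hr, hf 1 (by simp), hl1]
  have hle := h.7
  have hkl : l.root ≠ k := fun e => by
    by_cases h' : l.root = 0
    · exact h.1 (by omega)
    · exact hle.1 (e ▸ Tree.root_mem h')
  have hkr : r'.root ≠ k := fun e => by
    by_cases h' : r'.root = 0
    · exact h.1 (by omega)
    · exact hle.2 (e ▸ Tree.root_mem h')
  set s₁ := s.setMem (fld 2 k) (max l.height r'.height + 1) with hs₁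
  have eq₁ : (Program.store (addr (.const 2) (.reg r))
      (.bin .add (.bin .add (cell 2 (cell 0 (.reg r)))
        (.bin .sub (cell 2 (cell 1 (.reg r))) (cell 2 (cell 0 (.reg r))))) (.const 1))).sem w s
      = s₁ := by
    obtain ⟨e1, e2⟩ := e0 s hr (fun _ _ => rfl)
    have c0 : (cell 2 (cell 0 (.reg r))).eval w s = l.height := by
      rw [eval_cell (by rwa [e1]) (by norm_num), e1, hhl]
    have c1 : (cell 2 (cell 1 (.reg r))).eval w s = r'.height := by
      rw [eval_cell (by rwa [e2]) (by norm_num), e2, hhr]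
    have hlt := hh.lt
    simp only [Program.sem]
    rw [eval_addr (by rwa [eval_reg, hr]) (by rw [eval_const (by omega)]; norm_num),
      eval_const (by omega), eval_reg, hr]
    rw [eval_add, eval_add, eval_sub, c0, c1, eval_const (by omega)]
    · rw [hs₁]; congr 1; omega
    · rw [c1]; omega
    · rw [eval_sub, c0, c1]
      · omega
      · rw [c1]; omega
    · rw [eval_add, eval_sub, c0, c1, eval_const (by omega)]
      · omega
      · rw [c1]; omega
      · rw [eval_sub, c0, c1]
        · omega
        · rw [c1]; omega
  have hm₁ : ∀ f x, f < 16 → ¬ (f = 2 ∧ x = k) → s₁.mem (fld f x) = s.mem (fld f x) := by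
    intro f x hf hne
    rw [hs₁, State.setMem_mem, if_neg]
    rwa [fld_inj hf (by norm_num)]
  set S := ((Tree.node l k r').keys.map fun x => s.mem (fld 4 x)).sum % 2 ^ w with hS
  have eq₂ : (Program.store (addr (.const 3) (.reg r))
      (.bin .add (.bin .add (cell 3 (cell 0 (.reg r))) (cell 3 (cell 1 (.reg r))))
        (cell 4 (.reg r)))).sem w s₁ = s₁.setMem (fld 3 k) S := by
    obtain ⟨e1, e2⟩ := e0 s₁ hr (fun f hf => hm₁ f k (by omega) (by omega))
    have c0 : (cell 3 (cell 0 (.reg r))).eval w s₁ = s.mem (fld 3 l.root) := by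
      rw [eval_cell (by rwa [e1]) (by norm_num), e1, hm₁ _ _ (by norm_num) (by norm_num)]
    have c1 : (cell 3 (cell 1 (.reg r))).eval w s₁ = s.mem (fld 3 r'.root) := by
      rw [eval_cell (by rwa [e2]) (by norm_num), e2, hm₁ _ _ (by norm_num) (by norm_num)]
    have c2 : (cell 4 (.reg r)).eval w s₁ = s.mem (fld 4 k) := by
      have hr₁ : s₁.reg r = k := hr
      rw [eval_cell (by rwa [eval_reg, hr₁]) (by norm_num), eval_reg, hr₁,
        hm₁ _ _ (by norm_num) (by norm_num)]
    have hr₁ : s₁.reg r = k := hr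
    simp only [Program.sem]
    rw [eval_addr (by rwa [eval_reg, hr₁]) (by rw [eval_const (by omega)]; norm_num),
      eval_const (by omega), eval_reg, hr₁]
    congr 1
    simp only [Expr.eval, BinOp.eval] at c0 c1 c2 ⊢
    rw [c0, c1, c2, hul, hur, hS]
    simp [Tree.keys, Nat.add_comm, Nat.add_left_comm]
  have eq : (fix r).sem w s = s₁.setMem (fld 3 k) S := by
    rw [fix, Program.sem, eq₁, eq₂]
  rw [eq]
  have hm₂ : ∀ f x, f < 16 → ¬ (f = 2 ∧ x = k) → ¬ (f = 3 ∧ x = k) →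
      (s₁.setMem (fld 3 k) S).mem (fld f x) = s.mem (fld f x) := by
    intro f x hf hne hne'
    rw [State.setMem_mem, if_neg, hm₁ f x hf hne]
    rwa [fld_inj hf (by norm_num)]
  refine ⟨rfl, ⟨h.1, hk, ?_, ?_, ?_, ?_, ?_, ?_⟩, ?_⟩
  · rw [hm₂ _ _ (by norm_num) (by norm_num) (by norm_num), hl0]
  · rw [hm₂ _ _ (by norm_num) (by norm_num) (by norm_num), hl1]
  · rw [State.setMem_mem, if_neg (by rw [fld_inj] <;> norm_num), hs₁]; simp
  · rw [State.setMem_mem, if_pos rfl, hS]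
    congr 2
    exact List.map_congr_left fun x _ =>
      (hm₂ _ _ (by norm_num) (by norm_num) (by norm_num)).symm
  · refine h.reprl.congr fun x hx f hf => hm₂ _ _ (by omega) ?_ ?_ <;>
    · rintro ⟨-, rfl⟩; exact h.7.1 hx
  · refine h.reprr.congr fun x hx f hf => hm₂ _ _ (by omega) ?_ ?_ <;>
    · rintro ⟨-, rfl⟩; exact h.7.2 hx
  · intro x hx hx'
    rw [State.setMem_mem, if_neg hx', hs₁, State.setMem_mem, if_neg hx]

/-- The memories `m` and `m'` differ at most in the cells `0` to `3` of the records in `X`. -/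
def Same (X : List ℕ) (m m' : ℕ → ℕ) : Prop :=
  ∀ f z, f < 16 → (f < 4 → z ∉ X) → m' (fld f z) = m (fld f z)

theorem Same.refl (X : List ℕ) (m : ℕ → ℕ) : Same X m m := fun _ _ _ _ => rfl

theorem Same.trans {X : List ℕ} {m m' m'' : ℕ → ℕ} (h : Same X m m') (h' : Same X m' m'') :
    Same X m m'' := fun f z hf hz => (h' f z hf hz).trans (h f z hf hz)

theorem Same.mono {X Y : List ℕ} {m m' : ℕ → ℕ} (h : Same X m m') (hXY : ∀ x ∈ X, x ∈ Y) :
    Same Y m m' := fun f z hf hz => h f z hf fun h4 hx => hz h4 (hXY z hx)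

theorem Same.nilOK {X : List ℕ} {m m' : ℕ → ℕ} (h : Same X m m') (h0 : 0 ∉ X)
    (hn : Tree.NilOK m) : Tree.NilOK m' :=
  ⟨(h _ _ (by norm_num) fun _ => h0).trans hn.1, (h _ _ (by norm_num) fun _ => h0).trans hn.2.1,
    (h _ _ (by norm_num) fun _ => h0).trans hn.2.2⟩

theorem Same.repr {X : List ℕ} {m m' : ℕ → ℕ} (h : Same X m m') {w : ℕ} {t : Tree}
    (ht : t.Repr w m) (hX : ∀ x ∈ X, x ∉ t.keys) : t.Repr w m' :=
  ht.congr fun k hk f hf => h f k (by omega) fun _ hx => hX k hx hk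

theorem Same.setMem {s : State} {f k v : ℕ} (hf : f < 4) : Same [k] s.mem (s.setMem (fld f k) v).mem := by
  intro g z hg hz
  rw [State.setMem_mem, if_neg]
  rw [fld_inj hg (by omega)]
  rintro ⟨rfl, rfl⟩
  simp at hz
  omega

theorem fix_same {w : ℕ} {s : State} {r k d : ℕ} {a b : Tree} (hd : d < 2) (h0 : Small w 0)
    (hr : s.reg r = k) (hn : Tree.NilOK s.mem) (h : NodeAt w s.mem k d a b)
    (hh : Small w (max a.height b.height)) :
    ((fix r).sem w s).reg = s.reg ∧ (Tree.mk d a k b).Repr w ((fix r).sem w s).mem ∧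
      Same [k] s.mem ((fix r).sem w s).mem := by
  obtain ⟨h₁, h₂, h₃⟩ := fix_spec hd h0 hr hn h hh
  refine ⟨h₁, h₂, fun f z hf hz => h₃ _ ?_ ?_⟩ <;>
  · rw [Ne, fld_inj hf (by norm_num)]
    rintro ⟨rfl, rfl⟩
    simp at hz

/-- Rotate the child on the side in register `rd` of the node in register `ry` above this node, and
leave the address of the child in register `ra`. -/
def rot (ry rd ra : ℕ) : Program :=
  .seq (.set ra (.load (addr (.reg rd) (.reg ry))))
  (.seq (.store (addr (.reg rd) (.reg ry))
    (.load (addr (.bin .sub (.const 1) (.reg rd)) (.reg ra))))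
  (.seq (fix ry)
  (.seq (.store (addr (.bin .sub (.const 1) (.reg rd)) (.reg ra)) (.reg ry))
  (fix ra))))

/-- Only the inner subtree `a₂` gets a new parent. The node that moves down is repaired first,
because the height and the sum of the new root depend on it. No balance is assumed, so the lemma
serves both halves of a double rotation. -/
theorem rot_spec {w : ℕ} {s : State} {ry rd ra k ka d : ℕ} {a₁ a₂ b : Tree} (hd : d < 2)
    (h0 : Small w 0) (hry : s.reg ry = k) (hrd : s.reg rd = d) (hya : ry ≠ ra) (hda : rd ≠ ra)
    (hn : Tree.NilOK s.mem) (h : NodeAt w s.mem k d (.mk d a₁ ka a₂) b)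
    (hnd : (Tree.mk d (.mk d a₁ ka a₂) k b).keys.Nodup) :
    ((rot ry rd ra).sem w s).reg ra = ka ∧
      (∀ r, r ≠ ra → ((rot ry rd ra).sem w s).reg r = s.reg r) ∧
      (Tree.mk d a₁ ka (.mk d a₂ k b)).Repr w ((rot ry rd ra).sem w s).mem ∧
      Same [k, ka] s.mem ((rot ry rd ra).sem w s).mem := by
  have hlen : Small w (Tree.mk d (.mk d a₁ ka a₂) k b).keys.length := by
    refine Tree.length_lt hnd (fun x hx => ?_) h0
    rcases Tree.mem_keys_mk.1 hx with hx | rfl | hx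
    · exact h.reprl.small hx
    · exact ⟨h.1, h.2⟩
    · exact h.reprr.small hx
  have hlen' : (Tree.mk d (.mk d a₁ ka a₂) k b).keys.length =
      a₁.keys.length + a₂.keys.length + b.keys.length + 2 := by
    obtain rfl | rfl : d = 0 ∨ d = 1 := by omega
    all_goals simp [Tree.keys_mk]; omega
  rw [hlen'] at hlen
  have g₁ := a₁.height_le_length
  have g₂ := a₂.height_le_length
  have g₃ := b.height_le_length
  have hdis : (k ∉ a₁.keys ∧ k ∉ a₂.keys ∧ k ∉ b.keys) ∧ (ka ∉ a₁.keys ∧ ka ∉ a₂.keys ∧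
      ka ∉ b.keys) ∧ k ≠ ka := by
    have e₁ := List.nodup_iff_pairwise_ne.1 hnd
    obtain rfl | rfl : d = 0 ∨ d = 1 := by omega
    all_goals
      simp only [Tree.keys_mk, if_true, one_ne_zero, if_false, List.append_assoc, List.cons_append,
        List.nodup_append, List.nodup_cons, List.mem_append, List.mem_cons] at hnd
      grind
  obtain ⟨⟨p₁, p₂, p₃⟩, ⟨q₁, q₂, q₃⟩, hne⟩ := hdis
  obtain ⟨ka0, kas, kal, kar, ra₁, ra₂⟩ := h.reprl.of_mk hd
  have hw := h0.lt
  have hroot := h.left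
  rw [Tree.root_mk] at hroot
  have ev : ∀ t : State, t.reg rd = d → (Expr.bin .sub (.const 1) (.reg rd)).eval w t = 1 - d := by
    intro t ht
    rw [eval_sub, eval_const (by omega), eval_reg, ht]
    rw [eval_const (by omega)]; omega
  -- first load
  set s₁ := s.setReg ra ka with hs₁
  have eq₁ : (Program.set ra (.load (addr (.reg rd) (.reg ry)))).sem w s = s₁ := by
    simp only [Program.sem, Expr.eval]
    rw [eval_addr (by rw [eval_reg, hry]; exact h.2) (by rw [eval_reg, hrd]; omega), eval_reg,
      eval_reg, hry, hrd, hroot]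
  have r₁ : s₁.reg ra = ka ∧ s₁.reg ry = k ∧ s₁.reg rd = d := by
    simp [hs₁, hya, hda, hry, hrd]
  set s₂ := s₁.setMem (fld d k) a₂.root with hs₂
  have eq₂ : (Program.store (addr (.reg rd) (.reg ry))
      (.load (addr (.bin .sub (.const 1) (.reg rd)) (.reg ra)))).sem w s₁ = s₂ := by
    simp only [Program.sem, eval_load]
    rw [eval_addr (by rw [eval_reg, r₁.2.1]; exact h.2) (by rw [eval_reg, r₁.2.2]; omega), eval_reg,
      eval_reg, r₁.2.1, r₁.2.2, eval_addr (by rw [eval_reg, r₁.1]; exact kas)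
        (by rw [ev _ r₁.2.2]; omega), ev _ r₁.2.2, eval_reg, r₁.1, hs₁, State.setReg_mem, kar]
  have m₂ : Same [k] s.mem s₂.mem := Same.setMem (s := s₁) (by omega)
  have n₂ : NodeAt w s₂.mem k d a₂ b := by
    refine ⟨h.1, h.2, by simp [hs₂], ?_, m₂.repr ra₂ (by simpa using p₂),
      m₂.repr h.reprr (by simpa using p₃), p₂, p₃⟩
    rw [hs₂, State.setMem_mem, if_neg (by rw [fld_inj] <;> omega)]
    exact h.right
  have hn₂ := m₂.nilOK (by simpa using h.1.symm) hn
  obtain ⟨f₁, f₂, f₃⟩ := fix_same (s := s₂) (r := ry) hd h0 r₁.2.1 hn₂ n₂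
    (hlen.of_le (by omega))
  set s₃ := (fix ry).sem w s₂ with hs₃
  have r₃ : s₃.reg ra = ka ∧ s₃.reg ry = k ∧ s₃.reg rd = d := by rw [f₁]; exact r₁
  have m₃ := m₂.trans f₃
  set s₄ := s₃.setMem (fld (1 - d) ka) k with hs₄
  have eq₄ : (Program.store (addr (.bin .sub (.const 1) (.reg rd)) (.reg ra)) (.reg ry)).sem w s₃
      = s₄ := by
    simp only [Program.sem]
    rw [eval_addr (by rw [eval_reg, r₃.1]; exact kas)
        (by rw [ev _ r₃.2.2]; omega), ev _ r₃.2.2, eval_reg, r₃.1, eval_reg, r₃.2.1]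
  have m₄ : Same [ka] s₃.mem s₄.mem := Same.setMem (by omega)
  have m₄' : Same [k, ka] s.mem s₄.mem :=
    (m₃.mono (by simp)).trans (m₄.mono (by simp))
  have n₄ : NodeAt w s₄.mem ka d a₁ (.mk d a₂ k b) := by
    refine ⟨ka0, kas, ?_, by simp [hs₄, Tree.root_mk], m₄'.repr ra₁ (by simp [p₁, q₁]),
      m₄.repr f₂ ?_, q₁, ?_⟩
    · rw [hs₄, State.setMem_mem, if_neg (by rw [fld_inj] <;> omega),
        m₃ _ _ (by omega) (by simp [hne.symm]), kal]
    · simp [Tree.mem_keys_mk, q₂, q₃, hne.symm]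
    · simp [Tree.mem_keys_mk, q₂, q₃, hne.symm]
  have hn₄ := m₄'.nilOK (by simp [h.1.symm, ka0.symm]) hn
  obtain ⟨g₁, g₂, g₃⟩ := fix_same (s := s₄) (r := ra) hd h0 r₃.1 hn₄ n₄
    (hlen.of_le (by rw [Tree.height_mk]; omega))
  have eq : (rot ry rd ra).sem w s = (fix ra).sem w s₄ := by
    rw [rot, Program.sem, eq₁, Program.sem, eq₂, Program.sem, Program.sem, eq₄]
  rw [eq, g₁]
  refine ⟨r₃.1, fun r hr => ?_, g₂, m₄'.trans (g₃.mono (by simp))⟩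
  change s₃.reg r = _
  rw [f₁]
  simp [hs₂, hs₁, hr]

/-- Restore the balance at the node in register `16`, whose child in register `17` on the side in
register `18` is the higher one. -/
def balHeavy : Program :=
  .ite (.bin .lt (.bin .add (cell 2 (.load (addr (.reg 19) (.reg 16)))) (.const 1))
      (cell 2 (.reg 17)))
    (.seq
      (.ite (.bin .lt (cell 2 (.load (addr (.reg 18) (.reg 17))))
          (cell 2 (.load (addr (.reg 19) (.reg 17)))))
        (.seq (rot 17 19 28) (.store (addr (.reg 18) (.reg 16)) (.reg 28)))
        .skip)
      (rot 16 18 14))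
    (.seq (fix 16) (.set 14 (.reg 16)))

/-- Restore the balance at the node in register `16`, whose children are balanced; register `14`
receives the root of the result. -/
def bal : Program :=
  .seq (.set 18 (.bin .lt (cell 2 (cell 0 (.reg 16))) (cell 2 (cell 1 (.reg 16)))))
  (.seq (.set 17 (.load (addr (.reg 18) (.reg 16))))
  (.seq (.set 19 (.bin .sub (.const 1) (.reg 18)))
  balHeavy))

theorem mk_other {d : ℕ} (hd : d < 2) (a : Tree) (k : ℕ) (b : Tree) :
    Tree.mk (1 - d) a k b = Tree.mk d b k a := by
  obtain rfl | rfl : d = 0 ∨ d = 1 := by omega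
  all_goals simp [Tree.mk]

theorem eval_cell_load {w : ℕ} {s : State} {rd ry k d : ℕ} {t : Tree} (hd : d < 2)
    (h0 : Small w 0) (hn : Tree.NilOK s.mem) (hry : s.reg ry = k) (hrd : s.reg rd = d)
    (hk : Small w k) (ht : t.Repr w s.mem) (hm : s.mem (fld d k) = t.root) :
    (cell 2 (.load (addr (.reg rd) (.reg ry)))).eval w s = t.height := by
  have : (Expr.load (addr (.reg rd) (.reg ry))).eval w s = t.root := by
    rw [eval_load, eval_addr (by rwa [eval_reg, hry]) (by rw [eval_reg, hrd]; omega), eval_reg,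
      eval_reg, hry, hrd, hm]
  rw [eval_cell (by rw [this]; exact ht.small_root h0) (by norm_num), this, ht.height_eq hn]

/-- The usual AVL cases: if the heavy child is too high, a single rotation suffices unless its inner
subtree is the higher one, and then the child is rotated first. The last three conclusions confine
the new height to `a.height` or `a.height + 1`, and fix it when no rotation was due; this is what
lets the ascent continue with an error of at most one. -/
theorem balHeavy_spec {w : ℕ} {s : State} {k d : ℕ} {a b : Tree} (hd : d < 2) (h0 : Small w 0)
    (hk : s.reg 16 = k) (ha' : s.reg 17 = a.root) (hd' : s.reg 18 = d) (hd'' : s.reg 19 = 1 - d)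
    (hn : Tree.NilOK s.mem) (h : NodeAt w s.mem k d a b)
    (hnd : (Tree.mk d a k b).keys.Nodup) (ha : a.AVL) (hb : b.AVL)
    (hba : b.height ≤ a.height) (hab : a.height ≤ b.height + 2) (hs : Small w (a.height + 1)) :
    ∃ t : Tree, (balHeavy.sem w s).reg 14 = t.root ∧ t.Repr w (balHeavy.sem w s).mem ∧ t.AVL ∧
      t.keys = (Tree.mk d a k b).keys ∧ Same t.keys s.mem (balHeavy.sem w s).mem ∧
      a.height ≤ t.height ∧ t.height ≤ a.height + 1 ∧
      (a.height ≤ b.height + 1 → t.height = a.height + 1) := by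
  have hw := hs.lt
  have c₁ : (cell 2 (.load (addr (.reg 19) (.reg 16)))).eval w s = b.height :=
    eval_cell_load (by omega) h0 hn hk hd'' h.2 h.reprr h.right
  have c₂ : (cell 2 (.reg 17)).eval w s = a.height := by
    rw [eval_cell (by rw [eval_reg, ha']; exact h.reprl.small_root h0) (by norm_num), eval_reg, ha',
      h.reprl.height_eq hn]
  have e1 : (Expr.const 1).eval w s = 1 := eval_const (by omega)
  rw [balHeavy, Program.sem]
  rw [eval_lt (by omega), eval_add (by rw [c₁, e1]; omega), c₁, c₂, e1]
  by_cases hc : b.height + 1 < a.height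
  · rw [if_pos hc, if_neg one_ne_zero]
    obtain ⟨a₁, ka, a₂, rfl⟩ := Tree.exists_mk (t := a) (by omega) d
    rw [Tree.root_mk] at ha'
    obtain ⟨ka0, kas, kal, kar, ra₁, ra₂⟩ := h.reprl.of_mk hd
    have hda := Tree.AVL_mk.1 ha
    rw [Tree.height_mk] at hc hab hba hs hw ⊢
    have c₃ : (cell 2 (.load (addr (.reg 18) (.reg 17)))).eval w s = a₁.height :=
      eval_cell_load hd h0 hn ha' hd' kas ra₁ kal
    have c₄ : (cell 2 (.load (addr (.reg 19) (.reg 17)))).eval w s = a₂.height :=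
      eval_cell_load (by omega) h0 hn ha' hd'' kas ra₂ kar
    rw [Program.sem, Program.sem, eval_lt (by omega), c₃, c₄]
    by_cases hc' : a₁.height < a₂.height
    · rw [if_pos hc', if_neg one_ne_zero]
      -- The inner grandchild is split in the opposite orientation, since the first half of a double
      -- rotation is a rotation towards the other side.
      obtain ⟨p₁, kc, p₂, rfl⟩ := Tree.exists_mk (t := a₂) (by omega) (1 - d)
      have hdc := Tree.AVL_mk.1 hda.2.1
      rw [Tree.height_mk] at hc' hda hs hc hab
      rw [← mk_other hd (Tree.mk (1 - d) p₁ kc p₂) ka a₁] at h hnd ⊢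
      have hdis : (ka ∉ p₁.keys ∧ ka ≠ kc ∧ ka ∉ p₂.keys ∧ ka ∉ a₁.keys) ∧ k ≠ ka ∧ k ≠ kc ∧
          (∀ x, x = ka ∨ x = kc → x ∉ b.keys) ∧ (k ∉ a₁.keys ∧ k ∉ p₁.keys ∧ k ∉ p₂.keys) ∧
          (Tree.mk (1 - d) (.mk (1 - d) p₁ kc p₂) ka a₁).keys.Nodup := by
        obtain rfl | rfl : d = 0 ∨ d = 1 := by omega
        all_goals
          simp only [Tree.keys_mk, if_true, one_ne_zero, if_false, List.append_assoc,
            List.cons_append, List.nodup_append, List.nodup_cons, List.mem_append, List.mem_cons,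
            Nat.sub_zero, Nat.sub_self] at hnd ⊢
          grind
      obtain ⟨⟨u₁, u₂, u₃, u₄⟩, v₁, v₂, v₃, ⟨v₄, v₅, v₆⟩, hnd'⟩ := hdis
      have n₁ : NodeAt w s.mem ka (1 - d) (.mk (1 - d) p₁ kc p₂) a₁ := by
        refine ⟨ka0, kas, kar, ?_, ra₂, ra₁, ?_, u₄⟩
        · rw [show 1 - (1 - d) = d by omega, kal]
        · simp [Tree.mem_keys_mk, u₁, u₂, u₃]
      obtain ⟨r₁, r₂, r₃, r₄⟩ := rot_spec (ra := 28) (by omega) h0 ha' hd'' (by norm_num)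
        (by norm_num) hn n₁ hnd'
      set s₁ := (rot 17 19 28).sem w s with hs₁
      have eq₁ : (Program.seq (rot 17 19 28)
          (.store (addr (.reg 18) (.reg 16)) (.reg 28))).sem w s = s₁.setMem (fld d k) kc := by
        rw [Program.sem, ← hs₁, Program.sem, eval_reg, r₁, eval_addr
          (by rw [eval_reg, r₂ 16 (by norm_num), hk]; exact h.2)
          (by rw [eval_reg, r₂ 18 (by norm_num), hd']; omega), eval_reg, eval_reg,
          r₂ 16 (by norm_num), hk, r₂ 18 (by norm_num), hd']
      rw [eq₁]
      have hkc0 : kc ≠ 0 := (ra₂.small (k := kc) (Tree.mem_keys_mk.2 (by simp))).1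
      have m₁ : Same [k] s₁.mem (s₁.setMem (fld d k) kc).mem := Same.setMem (by omega)
      have m₂ : Same [ka, kc, k] s.mem (s₁.setMem (fld d k) kc).mem :=
        (r₄.mono (by simp)).trans (m₁.mono (by simp))
      set s₂ := s₁.setMem (fld d k) kc with hs₂
      rw [mk_other hd, mk_other hd] at r₃
      have n₂ : NodeAt w s₂.mem k d (.mk d (.mk d a₁ ka p₂) kc p₁) b := by
        refine ⟨h.1, h.2, by simp [hs₂, Tree.root_mk], ?_, m₁.repr r₃ ?_, m₂.repr h.reprr ?_, ?_,
          h.7.2⟩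
        · rw [hs₂, State.setMem_mem, if_neg (by rw [fld_inj] <;> omega),
            r₄ _ _ (by omega) (by simp [v₁, v₂]), h.right]
        · simp [Tree.mem_keys_mk, v₁, v₂, v₄, v₅, v₆]
        · have := h.7.2
          simp [this, v₃]
        · simp [Tree.mem_keys_mk, v₁, v₂, v₄, v₅, v₆]
      have hke : (Tree.mk d (.mk d (.mk d a₁ ka p₂) kc p₁) k b).keys =
          (Tree.mk d (.mk (1 - d) (.mk (1 - d) p₁ kc p₂) ka a₁) k b).keys := by
        obtain rfl | rfl : d = 0 ∨ d = 1 := by omega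
        all_goals simp [Tree.keys_mk]
      obtain ⟨t₁, t₂, t₃, t₄⟩ := rot_spec (s := s₂) (ry := 16) (rd := 18) (ra := 14) hd h0
        (by rw [hs₂, State.setMem_reg, r₂ 16 (by norm_num), hk])
        (by rw [hs₂, State.setMem_reg, r₂ 18 (by norm_num), hd']) (by norm_num) (by norm_num)
        (m₂.nilOK (by simp [ka0.symm, hkc0.symm, h.1.symm]) hn) n₂ (by rw [hke]; exact hnd)
      refine ⟨_, by rw [t₁, Tree.root_mk], t₃, ?_, ?_, m₂.mono ?_ |>.trans (t₄.mono ?_), ?_⟩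
      · simp only [Tree.AVL_mk, Tree.height_mk]
        have := hda.1
        have := hdc.1
        have := hdc.2.1
        refine ⟨⟨?_, ?_, ?_, ?_⟩, ⟨?_, ?_, ?_, ?_⟩, ?_, ?_⟩ <;> first | assumption | omega
      · rw [← hke]
        obtain rfl | rfl : d = 0 ∨ d = 1 := by omega
        all_goals simp [Tree.keys_mk]
      · simp [Tree.mem_keys_mk]
      · simp [Tree.mem_keys_mk]
      · simp only [Tree.height_mk]
        omega
    · rw [if_neg hc', if_pos rfl, Program.sem]
      obtain ⟨t₁, t₂, t₃, t₄⟩ := rot_spec (s := s) (ry := 16) (rd := 18) (ra := 14) hd h0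
        hk hd' (by norm_num) (by norm_num) hn h hnd
      refine ⟨_, by rw [t₁, Tree.root_mk], t₃, ?_, ?_, t₄.mono ?_, ?_⟩
      · simp only [Tree.AVL_mk, Tree.height_mk]
        have := hda.1
        have := hda.2.1
        refine ⟨?_, ⟨?_, ?_, ?_, ?_⟩, ?_, ?_⟩ <;> first | assumption | omega
      · obtain rfl | rfl : d = 0 ∨ d = 1 := by omega
        all_goals simp [Tree.keys_mk]
      · simp [Tree.mem_keys_mk]
      · simp only [Tree.height_mk]
        omega
  · rw [if_neg hc, if_pos rfl]
    obtain ⟨f₁, f₂, f₃⟩ := fix_same (r := 16) hd h0 hk hn h (hs.of_le (by omega))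
    refine ⟨_, ?_, f₂, ?_, rfl, f₃.mono ?_, ?_⟩
    · rw [Tree.root_mk, Program.sem, Program.sem, State.setReg_reg, if_pos rfl, eval_reg, f₁, hk]
    · rw [Tree.AVL_mk]; exact ⟨ha, hb, by omega, by omega⟩
    · simp [Tree.mem_keys_mk]
    · rw [Tree.height_mk]; omega

theorem bal_spec {w : ℕ} {s : State} {k : ℕ} {l r : Tree} (h0 : Small w 0)
    (hk : s.reg 16 = k) (hn : Tree.NilOK s.mem) (h : NodeAt w s.mem k 0 l r)
    (hnd : (Tree.node l k r).keys.Nodup) (hl : l.AVL) (hr : r.AVL)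
    (hlr : l.height ≤ r.height + 2) (hrl : r.height ≤ l.height + 2) :
    ∃ t : Tree, (bal.sem w s).reg 14 = t.root ∧ t.Repr w (bal.sem w s).mem ∧ t.AVL ∧
      t.keys = (Tree.node l k r).keys ∧ Same t.keys s.mem (bal.sem w s).mem ∧
      max l.height r.height ≤ t.height ∧ t.height ≤ max l.height r.height + 1 ∧
      (l.height ≤ r.height + 1 ∧ r.height ≤ l.height + 1 →
        t.height = max l.height r.height + 1) := by
  have hlen : Small w (Tree.node l k r).keys.length := by
    refine Tree.length_lt hnd (fun x hx => ?_) h0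
    simp only [Tree.keys, List.mem_append, List.mem_cons] at hx
    rcases hx with hx | rfl | hx
    · exact h.reprl.small hx
    · exact ⟨h.1, h.2⟩
    · exact h.reprr.small hx
  have hw := h0.lt
  have hgl := l.height_le_length
  have hgr := r.height_le_length
  have hlen' : Small w (l.keys.length + r.keys.length + 1) := hlen.of_le (by
    simp only [Tree.keys, List.length_append, List.length_cons]; omega)
  have hlt := hlen'.lt
  -- the heavy side
  obtain ⟨d, a, b, hd, hdef, hmk, h', hab⟩ : ∃ d a b, d < 2 ∧
      d = (if l.height < r.height then 1 else 0) ∧ Tree.node l k r = Tree.mk d a k b ∧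
      NodeAt w s.mem k d a b ∧ ((a = l ∧ b = r) ∨ (a = r ∧ b = l)) ∧ b.height ≤ a.height := by
    by_cases hh : l.height < r.height
    · exact ⟨1, r, l, by norm_num, by simp [hh], by simp [Tree.mk], h.symm (by norm_num),
        .inr ⟨rfl, rfl⟩, hh.le⟩
    · exact ⟨0, l, r, by norm_num, by simp [hh], by simp [Tree.mk], h, .inl ⟨rfl, rfl⟩, by omega⟩
  rw [hmk] at hnd hlen ⊢
  obtain ⟨hab, hba⟩ := hab
  have ha : a.AVL := by rcases hab with ⟨rfl, rfl⟩ | ⟨rfl, rfl⟩ <;> assumption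
  have hb : b.AVL := by rcases hab with ⟨rfl, rfl⟩ | ⟨rfl, rfl⟩ <;> assumption
  have hab2 : a.height ≤ b.height + 2 := by
    rcases hab with ⟨rfl, rfl⟩ | ⟨rfl, rfl⟩ <;> assumption
  have hmax : max l.height r.height = a.height := by
    rcases hab with ⟨rfl, rfl⟩ | ⟨rfl, rfl⟩ <;> omega
  have hbal : (l.height ≤ r.height + 1 ∧ r.height ≤ l.height + 1) ↔ a.height ≤ b.height + 1 := by
    rcases hab with ⟨rfl, rfl⟩ | ⟨rfl, rfl⟩ <;> omega
  have hga : a.height ≤ l.keys.length + r.keys.length := by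
    rcases hab with ⟨rfl, rfl⟩ | ⟨rfl, rfl⟩ <;> omega
  have hgb : b.height ≤ l.keys.length + r.keys.length := by
    rcases hab with ⟨rfl, rfl⟩ | ⟨rfl, rfl⟩ <;> omega
  rw [hbal, hmax]
  have hsl := h.reprl.small_root h0
  have hsr := h.reprr.small_root h0
  have hl0 := h.left
  have hr0 : s.mem (fld 1 k) = r.root := h.right
  have e0 : (cell 0 (.reg 16)).eval w s = l.root := by
    rw [eval_cell (by rw [eval_reg, hk]; exact h.2) (by norm_num), eval_reg, hk, hl0]
  have e1 : (cell 1 (.reg 16)).eval w s = r.root := by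
    rw [eval_cell (by rw [eval_reg, hk]; exact h.2) (by norm_num), eval_reg, hk, hr0]
  have c0 : (cell 2 (cell 0 (.reg 16))).eval w s = l.height := by
    rw [eval_cell (by rwa [e0]) (by norm_num), e0, h.reprl.height_eq hn]
  have c1 : (cell 2 (cell 1 (.reg 16))).eval w s = r.height := by
    rw [eval_cell (by rwa [e1]) (by norm_num), e1, h.reprr.height_eq hn]
  have eq₁ : (Program.set 18 (.bin .lt (cell 2 (cell 0 (.reg 16)))
      (cell 2 (cell 1 (.reg 16))))).sem w s = s.setReg 18 d := by
    rw [Program.sem, eval_lt (by omega), c0, c1, hdef]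
  have eq₂ : (Program.set 17 (.load (addr (.reg 18) (.reg 16)))).sem w (s.setReg 18 d) =
      (s.setReg 18 d).setReg 17 a.root := by
    rw [Program.sem, eval_load, eval_addr (by simp [eval_reg, hk, h.2])
      (by simp [eval_reg]; omega)]
    simp [eval_reg, hk, h'.left]
  have eq₃ : (Program.set 19 (.bin .sub (.const 1) (.reg 18))).sem w
      ((s.setReg 18 d).setReg 17 a.root) =
      ((s.setReg 18 d).setReg 17 a.root).setReg 19 (1 - d) := by
    rw [Program.sem, eval_sub (by rw [eval_const] <;> omega), eval_const (by omega)]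
    simp [eval_reg]
  rw [bal, Program.sem, eq₁, Program.sem, eq₂, Program.sem, eq₃]
  exact balHeavy_spec hd h0 (by simp [hk]) (by simp) (by simp) (by simp) hn h' hnd ha hb hba hab2
    (hlen'.of_le (by omega))

/-! ### Paths in a tree -/

/-- A step of a path from the root: the side to which the path goes, the node and its other
child. -/
structure Frame where
  side : ℕ
  key : ℕ
  other : Tree

/-- The tree with the path `fs`, given from the bottom to the root, that ends in `t`. -/
def zip : List Frame → Tree → Tree
  | [], t => t
  | f :: fs, t => zip fs (.mk f.side t f.key f.other)

/-- The keys to the left of the path. -/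
def leftKeys : List Frame → List ℕ
  | [] => []
  | f :: fs => if f.side = 0 then leftKeys fs else leftKeys fs ++ f.other.keys ++ [f.key]

/-- The keys to the right of the path. -/
def rightKeys : List Frame → List ℕ
  | [] => []
  | f :: fs => if f.side = 0 then f.key :: f.other.keys ++ rightKeys fs else rightKeys fs

/-- The in-order list is cut at the end of the path. Arguments about order and disjointness along a
path are reduced to these three lists. -/
theorem keys_zip (fs : List Frame) (t : Tree) :
    (zip fs t).keys = leftKeys fs ++ t.keys ++ rightKeys fs := by
  induction fs generalizing t with
  | nil => simp [zip, leftKeys, rightKeys]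
  | cons f fs ih =>
    simp only [zip, ih, leftKeys, rightKeys, Tree.keys_mk]
    split_ifs <;> simp

theorem zip_append (fs gs : List Frame) (t : Tree) : zip (fs ++ gs) t = zip gs (zip fs t) := by
  induction fs generalizing t with
  | nil => rfl
  | cons f fs ih => exact ih _

theorem leftKeys_append (fs gs : List Frame) :
    leftKeys (fs ++ gs) = leftKeys gs ++ leftKeys fs := by
  induction fs with
  | nil => simp [leftKeys]
  | cons f fs ih => simp only [List.cons_append, leftKeys, ih]; split_ifs <;> simp

theorem rightKeys_append (fs gs : List Frame) :
    rightKeys (fs ++ gs) = rightKeys fs ++ rightKeys gs := by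
  induction fs with
  | nil => simp [rightKeys]
  | cons f fs ih => simp only [List.cons_append, rightKeys, ih]; split_ifs <;> simp

/-- The path `fs` can be completed by a tree of height `h` to an AVL tree. -/
def Fits : List Frame → ℕ → Prop
  | [], _ => True
  | f :: fs, h => f.other.AVL ∧ h ≤ f.other.height + 1 ∧ f.other.height ≤ h + 1 ∧
      Fits fs (max h f.other.height + 1)

/-- The rest of the tree sees the subtree at the end of the path only through its height, so that
subtree may be exchanged. -/
theorem AVL_zip {fs : List Frame} {t : Tree} : (zip fs t).AVL ↔ t.AVL ∧ Fits fs t.height := by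
  induction fs generalizing t with
  | nil => simp [zip, Fits]
  | cons f fs ih => simp only [zip, ih, Tree.AVL_mk, Tree.height_mk, Fits]; tauto

/-- The path `fs` is stored in the memory, with its nodes on the stack. -/
def Frames (w : ℕ) (m : ℕ → ℕ) : List Frame → Prop
  | [] => True
  | f :: fs => f.side < 2 ∧ f.key ≠ 0 ∧ Small w f.key ∧ m (fld 5 fs.length) = f.key ∧
      m (fld (1 - f.side) f.key) = f.other.root ∧ f.other.Repr w m ∧ Frames w m fs

theorem mem_zip {fs : List Frame} {t : Tree} {x : ℕ} :
    x ∈ (zip fs t).keys ↔ x ∈ t.keys ∨ ∃ f ∈ fs, x = f.key ∨ x ∈ f.other.keys := by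
  induction fs generalizing t with
  | nil => simp [zip]
  | cons f fs ih =>
    simp only [zip, ih, Tree.mem_keys_mk, List.mem_cons, exists_eq_or_imp, or_assoc]

theorem mem_leftKeys_or {fs : List Frame} {x : ℕ} :
    (x ∈ leftKeys fs ∨ x ∈ rightKeys fs) ↔ ∃ f ∈ fs, x = f.key ∨ x ∈ f.other.keys := by
  have := mem_zip (fs := fs) (t := .nil) (x := x)
  simpa [keys_zip, Tree.keys] using this

theorem disjoint_zip {fs : List Frame} {t : Tree} (h : (zip fs t).keys.Nodup) :
    ∀ f ∈ fs, ∀ z, z = f.key ∨ z ∈ f.other.keys → z ∉ t.keys := by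
  intro f hf z hz hzt
  rw [keys_zip] at h
  simp only [List.nodup_append, List.mem_append] at h
  rcases mem_leftKeys_or.2 ⟨f, hf, hz⟩ with h' | h'
  · exact h.1.2.2 z h' z hzt rfl
  · exact h.2.2 z (.inr hzt) z h' rfl

theorem nodup_of_zip {fs : List Frame} {t : Tree} (h : (zip fs t).keys.Nodup) : t.keys.Nodup := by
  rw [keys_zip] at h
  exact h.of_append_left.of_append_right

/-- `Frames` prescribes neither the child cell in the direction of the path nor the height and sum
of the nodes on it; the ascent rewrites them. -/
theorem Frames.congr {w : ℕ} {m m' : ℕ → ℕ} {fs : List Frame} (h : Frames w m fs)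
    (h5 : ∀ i < fs.length, m' (fld 5 i) = m (fld 5 i))
    (hm : ∀ f ∈ fs, ∀ z, z = f.key ∨ z ∈ f.other.keys → ∀ g < 5, m' (fld g z) = m (fld g z)) :
    Frames w m' fs := by
  induction fs with
  | nil => trivial
  | cons f fs ih =>
    obtain ⟨h₁, h₂, h₃, h₄, h₅, h₆, h₇⟩ := h
    refine ⟨h₁, h₂, h₃, ?_, ?_, ?_, ih h₇ (fun i hi => h5 i ?_) fun g hg => hm g ?_⟩
    · rw [h5 _ (by simp), h₄]
    · rw [hm f (by simp) _ (.inl rfl) _ (by omega), h₅]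
    · exact h₆.congr fun k hk g hg => hm f (by simp) k (.inr hk) g hg
    · simp only [List.length_cons]; omega
    · exact List.mem_cons_of_mem _ hg

theorem Frames.same {w : ℕ} {m m' : ℕ → ℕ} {fs : List Frame} {X : List ℕ} (h : Frames w m fs)
    (hX : Same X m m') (hd : ∀ f ∈ fs, ∀ z, z = f.key ∨ z ∈ f.other.keys → z ∉ X) :
    Frames w m' fs :=
  h.congr (fun i _ => hX _ _ (by norm_num) (by norm_num)) fun f hf z hz g hg =>
    hX _ _ (by omega) fun _ => hd f hf z hz

/-- The path agrees with the search for the key `K`; a node with this key counts as smaller. -/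
def Toward (K : ℕ) (fs : List Frame) : Prop := ∀ f ∈ fs, f.side = if K < f.key then 0 else 1

/-- The stack holds no directions; the ascent recomputes them by comparing keys with register `13`.
Deletion replaces the key in that register, and then the agreement has to be derived anew from the
order of the keys. -/
theorem toward_of_keys {K : ℕ} {fs : List Frame} (hs : ∀ f ∈ fs, f.side < 2)
    (hl : ∀ x ∈ leftKeys fs, x ≤ K) (hr : ∀ x ∈ rightKeys fs, K < x) : Toward K fs := by
  induction fs with
  | nil => simp [Toward]
  | cons f fs ih =>
    have hf := hs f (by simp)
    simp only [leftKeys, rightKeys] at hl hr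
    intro g hg
    rcases List.mem_cons.1 hg with rfl | hg
    · by_cases h0 : g.side = 0
      · rw [h0, if_pos (hr _ (by simp [h0]))]
      · rw [if_neg (not_lt.2 (hl _ (by simp [h0])))]; omega
    · refine ih (fun f hf => hs f (by simp [hf])) (fun x hx => hl x ?_) (fun x hx => hr x ?_) g hg
      · split_ifs <;> simp [hx]
      · split_ifs <;> simp [hx]

theorem Frames.side_lt {w : ℕ} {m : ℕ → ℕ} {fs : List Frame} (h : Frames w m fs) :
    ∀ f ∈ fs, f.side < 2 := by
  induction fs with
  | nil => simp
  | cons f fs ih =>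
    intro g hg
    rcases List.mem_cons.1 hg with rfl | hg
    · exact h.1
    · exact ih h.2.2.2.2.2.2 g hg

/-! ### Descent and ascent -/

/-- Walk from the node in register `14` towards the key in register `13` and push the nodes of the
path on the stack, whose height is in register `15`. -/
def descendBody : Program :=
  .seq (.store (addr (.const 5) (.reg 15)) (.reg 14))
  (.seq (.set 14 (.load (addr (.bin .lt (.reg 14) (.reg 13)) (.reg 14))))
  (.set 15 (.bin .add (.reg 15) (.const 1))))

def descendTest : Expr :=
  .bin .mul (.bin .lt (.const 0) (.reg 14))
    (.bin .add (.bin .lt (.reg 13) (.reg 14)) (.bin .lt (.reg 14) (.reg 13)))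

def descend : Program := .while descendTest descendBody

/-- The machine has no logical connectives: the product of truth values is their conjunction, and
the sum of the two strict comparisons expresses inequality. -/
theorem eval_descendTest {w : ℕ} {s : State} (h0 : Small w 0) :
    descendTest.eval w s ≠ 0 ↔ s.reg 14 ≠ 0 ∧ s.reg 14 ≠ s.reg 13 := by
  have hw := h0.lt
  have h1 : (Expr.bin .lt (.const 0) (.reg 14)).eval w s = if 0 < s.reg 14 then 1 else 0 := by
    rw [eval_lt (by omega), eval_const (by omega), eval_reg]
  have h2 : (Expr.bin .lt (.reg 13) (.reg 14)).eval w s = if s.reg 13 < s.reg 14 then 1 else 0 := by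
    rw [eval_lt (by omega), eval_reg, eval_reg]
  have h3 : (Expr.bin .lt (.reg 14) (.reg 13)).eval w s = if s.reg 14 < s.reg 13 then 1 else 0 := by
    rw [eval_lt (by omega), eval_reg, eval_reg]
  have h4 : (Expr.bin .add (.bin .lt (.reg 13) (.reg 14)) (.bin .lt (.reg 14) (.reg 13))).eval w s =
      if s.reg 14 ≠ s.reg 13 then 1 else 0 := by
    rw [eval_add, h2, h3]
    · split_ifs <;> omega
    · rw [h2, h3]; split_ifs <;> omega
  have h5 : descendTest.eval w s = if s.reg 14 ≠ 0 ∧ s.reg 14 ≠ s.reg 13 then 1 else 0 := by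
    rw [descendTest, eval_mul, h1, h4]
    · split_ifs <;> omega
    · rw [h1, h4]; split_ifs <;> omega
  rw [h5]
  split_ifs with h <;> simp [h]

/-- The height of the remaining subtree is the variant. Pushing writes cells 5 only, which no tree
uses, so the stored trees are undisturbed. The given path `fs` allows a descent to be resumed below
a node, as deletion does. -/
theorem descend_spec {w : ℕ} {s : State} {K : ℕ} {fs : List Frame} {t : Tree} (h0 : Small w 0)
    (hK : s.reg 13 = K) (hx : s.reg 14 = t.root) (hd : s.reg 15 = fs.length)
    (hfs : Frames w s.mem fs) (ht : t.Repr w s.mem) (hs : Small w (fs.length + t.height)) :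
    Runs w descend s (t.height * 32 + 12) fun s' => ∃ gs t', s'.reg 14 = t'.root ∧
      s'.reg 15 = (gs ++ fs).length ∧ zip gs t' = t ∧ Frames w s'.mem (gs ++ fs) ∧
      t'.Repr w s'.mem ∧ (t' = .nil ∨ t'.root = K) ∧ (Toward K gs ∧ ∀ f ∈ gs, f.key ≠ K) ∧
      gs.length + t'.height ≤ t.height ∧
      (∀ f z, f < 16 → f ≠ 5 → s'.mem (fld f z) = s.mem (fld f z)) ∧
      ∀ r, r ∉ descend.writes → s'.reg r = s.reg r := by
  have hw := h0.lt
  have key := Runs.loop (w := w) (b := descendTest) (p := descendBody) (K := 20)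
    (α := List Frame × Tree) (fun x => x.2.height)
    (fun x s' => s'.reg 13 = K ∧ s'.reg 14 = x.2.root ∧
      s'.reg 15 = (x.1 ++ fs).length ∧ zip x.1 x.2 = t ∧ Frames w s'.mem (x.1 ++ fs) ∧
      x.2.Repr w s'.mem ∧ (Toward K x.1 ∧ ∀ f ∈ x.1, f.key ≠ K) ∧ x.1.length + x.2.height ≤ t.height ∧
      (∀ f z, f < 16 → f ≠ 5 → s'.mem (fld f z) = s.mem (fld f z)))
    ?_ ([], t) s ⟨hK, hx, hd, rfl, hfs, ht, by simp [Toward], by simp, fun _ _ _ _ => rfl⟩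
  · refine key.frame.mono (by simp [descendTest, Expr.cost]) ?_
    rintro s' ⟨⟨htest, ⟨gs, t'⟩, h₁, h₂, h₃, h₄, h₅, h₆, h₇, h₈, h₉⟩, hreg, -⟩
    refine ⟨gs, t', h₂, h₃, h₄, h₅, h₆, ?_, h₇, h₈, h₉, hreg⟩
    have := (eval_descendTest h0).not.1 (not_not.2 htest)
    rw [h₁, h₂] at this
    cases t' with
    | nil => exact .inl rfl
    | node l k r => exact .inr (by_contra fun h => this ⟨h₆.1, h⟩)
  · rintro ⟨gs, t'⟩ s₁ ⟨h₁, h₂, h₃, h₄, h₅, h₆, h₇, h₈, h₉⟩ htest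
    obtain ⟨hne, hneK⟩ := (eval_descendTest h0).1 htest
    rw [h₂] at hne
    rw [h₁, h₂] at hneK
    simp only at h₂ h₃ h₄ h₅ h₆ h₇ h₈ h₉ hne hneK ⊢
    cases t' with
    | nil => exact absurd rfl hne
    | node l k r =>
    simp only [Tree.root] at h₂ hne hneK
    simp only [Tree.height] at h₈
    simp only [List.length_append] at h₃
    refine Runs.straight rfl (by decide) ?_
    have hsm : Small w (gs.length + fs.length) := hs.of_le (by omega)
    set s₂ := s₁.setMem (fld 5 (gs.length + fs.length)) k with hs₂
    have eq₁ : (Program.store (addr (.const 5) (.reg 15)) (.reg 14)).sem w s₁ = s₂ := by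
      rw [Program.sem, eval_addr (by rwa [eval_reg, h₃]) (by rw [eval_const] <;> omega),
        eval_const (by omega), eval_reg, eval_reg, h₂, h₃]
    have hm₂ : ∀ f z, f < 16 → f ≠ 5 → s₂.mem (fld f z) = s₁.mem (fld f z) := by
      intro f z hf hf5
      rw [hs₂, State.setMem_mem, if_neg]
      rw [fld_inj hf (by norm_num)]
      tauto
    have hr₂ : (Tree.node l k r).Repr w s₂.mem :=
      h₆.congr fun x _ f hf => hm₂ f x (by omega) (by omega)
    have hf₂ : Frames w s₂.mem (gs ++ fs) := by
      refine h₅.congr (fun i hi => ?_) fun f _ z _ g hg => hm₂ g z (by omega) (by omega)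
      rw [hs₂, State.setMem_mem, if_neg]
      rw [fld_inj (by norm_num) (by norm_num)]
      rw [List.length_append] at hi
      omega
    obtain ⟨d, a, b, hd, hdK, hmk, hab⟩ : ∃ d a b, d < 2 ∧ d = (if k < K then 1 else 0) ∧
        Tree.node l k r = Tree.mk d a k b ∧ a.height ≤ max l.height r.height := by
      by_cases hk : k < K
      · exact ⟨1, r, l, by norm_num, by simp [hk], by simp [Tree.mk], by simp⟩
      · exact ⟨0, l, r, by norm_num, by simp [hk], by simp [Tree.mk], by simp⟩
    rw [hmk] at hr₂
    obtain ⟨u₁, u₂, u₃, u₄, u₅, u₆⟩ := hr₂.of_mk hd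
    -- The truth value of the comparison is itself the number of the child cell to follow.
    have eq₂ : (Program.set 14 (.load (addr (.bin .lt (.reg 14) (.reg 13)) (.reg 14)))).sem w s₂ =
        s₂.setReg 14 a.root := by
      have e : (Expr.bin .lt (.reg 14) (.reg 13)).eval w s₂ = d := by
        rw [eval_lt (by omega), hdK, eval_reg, eval_reg, hs₂, State.setMem_reg, h₁, h₂]
      have e' : s₂.reg 14 = k := h₂
      rw [Program.sem, eval_load, eval_addr (by rw [eval_reg, e']; exact u₂)
        (by rw [e]; omega), e, eval_reg, e', u₃]
    have eq₃ : (Program.set 15 (.bin .add (.reg 15) (.const 1))).sem w (s₂.setReg 14 a.root) =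
        (s₂.setReg 14 a.root).setReg 15 (gs.length + fs.length + 1) := by
      have e : (s₂.setReg 14 a.root).reg 15 = gs.length + fs.length := by simp [hs₂, h₃]
      have := hsm.lt
      rw [Program.sem, eval_add, eval_reg, e, eval_const (by omega)]
      rw [eval_reg, e, eval_const (by omega)]; omega
    rw [descendBody, Program.sem, eq₁, Program.sem, eq₂, eq₃]
    refine ⟨(⟨d, k, b⟩ :: gs, a), ?_, ?_, by simp, ?_, ?_, ?_, u₅, ?_, ?_, ?_⟩
    · simp only [Tree.height]; omega
    · simp [hs₂, h₁]
    · simp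
    · rw [zip, ← hmk, h₄]
    · exact ⟨hd, u₁, u₂, by simp [hs₂], u₄, u₆, hf₂⟩
    · refine ⟨fun f hf => ?_, by simpa using ⟨hneK, h₇.2⟩⟩
      rcases List.mem_cons.1 hf with rfl | hf
      · simp only [hdK]
        split_ifs <;> omega
      · exact h₇.1 f hf
    · simp only [List.length_cons]; omega
    · intro f z hf hf5
      exact (hm₂ f z hf hf5).trans (h₉ f z hf hf5)

/-- Walk back along the path on the stack, put the tree in register `14` in the place of the former
subtree, and restore the balance. -/
def ascendBody : Program :=
  .seq (.set 15 (.bin .sub (.reg 15) (.const 1)))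
  (.seq (.set 16 (cell 5 (.reg 15)))
  (.seq (.store (addr (.bin .sub (.const 1) (.bin .lt (.reg 13) (.reg 16))) (.reg 16)) (.reg 14))
  bal))

def ascend : Program := .while (.reg 15) ascendBody

theorem zip_keys_congr {fs : List Frame} {t t' : Tree} (h : t.keys = t'.keys) :
    (zip fs t).keys = (zip fs t').keys := by rw [keys_zip, keys_zip, h]

/-- Here `h` is the height of the former subtree, for which the path was balanced, and the new
subtree differs from it by at most one. Hence the children of the next node differ by at most two,
`bal` applies, and its height bounds give a tree that again differs by at most one from the former
subtree at that node. -/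
theorem ascend_spec {w : ℕ} {s : State} {K : ℕ} {fs : List Frame} {t : Tree} {h : ℕ}
    (h0 : Small w 0) (hn : Tree.NilOK s.mem)
    (hK : s.reg 13 = K) (hx : s.reg 14 = t.root) (hd : s.reg 15 = fs.length)
    (hfs : Frames w s.mem fs) (ht : t.Repr w s.mem) (hs : Small w fs.length) (hto : Toward K fs)
    (hfit : Fits fs h) (havl : t.AVL) (hth : t.height ≤ h + 1) (hht : h ≤ t.height + 1)
    (hnd : (zip fs t).keys.Nodup) :
    Runs w ascend s (fs.length * (ascendBody.bound + 2) + 2) fun s' => ∃ t' : Tree,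
      s'.reg 14 = t'.root ∧ t'.Repr w s'.mem ∧ t'.AVL ∧ t'.keys = (zip fs t).keys ∧
      Same t'.keys s.mem s'.mem ∧ ∀ r, r ∉ ascend.writes → s'.reg r = s.reg r := by
  have hw := h0.lt
  have key := Runs.loop (w := w) (b := .reg 15) (p := ascendBody) (K := ascendBody.bound)
    (α := List Frame × Tree × ℕ) (fun x => x.1.length)
    (fun x s' => s'.reg 13 = K ∧ s'.reg 14 = x.2.1.root ∧ s'.reg 15 = x.1.length ∧
      Frames w s'.mem x.1 ∧ x.2.1.Repr w s'.mem ∧ Small w x.1.length ∧ Toward K x.1 ∧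
      Fits x.1 x.2.2 ∧ x.2.1.AVL ∧ x.2.1.height ≤ x.2.2 + 1 ∧ x.2.2 ≤ x.2.1.height + 1 ∧
      (zip x.1 x.2.1).keys = (zip fs t).keys ∧ Same (zip fs t).keys s.mem s'.mem ∧
      Tree.NilOK s'.mem)
    ?_ (fs, t, h) s ⟨hK, hx, hd, hfs, ht, hs, hto, hfit, havl, hth, hht, rfl, .refl _ _, hn⟩
  · refine key.frame.mono (by simp only [Expr.cost]; ring_nf; omega) ?_
    rintro s' ⟨⟨htest, ⟨gs, t', h'⟩, u₁, u₂, u₃, u₄, u₅, u₆, u₇, u₈, u₉, u₁₀, u₁₁, u₁₂, u₁₃, u₁₄⟩,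
      hreg, -⟩
    rw [eval_reg, u₃] at htest
    obtain rfl : gs = [] := List.eq_nil_of_length_eq_zero htest
    rw [← u₁₂] at u₁₃ ⊢
    exact ⟨t', u₂, u₅, u₉, rfl, u₁₃, hreg⟩
  · rintro ⟨gs, t', h'⟩ s₁ ⟨u₁, u₂, u₃, u₄, u₅, u₆, u₇, u₈, u₉, u₁₀, u₁₁, u₁₂, u₁₃, u₁₄⟩ htest
    simp only at u₂ u₃ u₄ u₅ u₆ u₇ u₈ u₉ u₁₀ u₁₁ u₁₂ ⊢
    cases gs with
    | nil => rw [eval_reg, u₃] at htest; exact absurd rfl htest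
    | cons f gs =>
    obtain ⟨d, y, b⟩ := f
    obtain ⟨v₁, v₂, v₃, v₄, v₅, v₆, v₇⟩ := u₄
    obtain ⟨f₁, f₂, f₃, f₄⟩ := u₈
    have hdir := u₇ _ (List.mem_cons_self)
    simp only [List.length_cons] at u₃ u₆ v₁ v₂ v₃ v₄ v₅ v₆ f₁ f₂ f₃ f₄ hdir
    have hlt := u₆.lt
    refine Runs.straight rfl le_rfl ?_
    set s₂ := s₁.setReg 15 gs.length with hs₂
    have eq₁ : (Program.set 15 (.bin .sub (.reg 15) (.const 1))).sem w s₁ = s₂ := by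
      rw [Program.sem, eval_sub (by rw [eval_reg]; omega), eval_reg, eval_const (by omega), u₃,
        Nat.add_sub_cancel]
    set s₃ := s₂.setReg 16 y with hs₃
    have eq₂ : (Program.set 16 (cell 5 (.reg 15))).sem w s₂ = s₃ := by
      have e : (Expr.reg 15).eval w s₂ = gs.length := by simp [eval_reg, hs₂]
      rw [Program.sem, eval_cell (by rw [e]; exact u₆.of_le (by omega)) (by norm_num), e, hs₂,
        State.setReg_mem, v₄]
    set s₄ := s₃.setMem (fld d y) t'.root with hs₄
    have eq₃ : (Program.store (addr (.bin .sub (.const 1) (.bin .lt (.reg 13) (.reg 16)))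
        (.reg 16)) (.reg 14)).sem w s₃ = s₄ := by
      have e : (Expr.reg 16).eval w s₃ = y := by simp [eval_reg, hs₃]
      -- Subtracting the comparison from 1 recovers the direction of the path, with the convention
      -- of `Toward` for equal keys.
      have e' : (Expr.bin .sub (.const 1) (.bin .lt (.reg 13) (.reg 16))).eval w s₃ = d := by
        rw [eval_sub (by rw [eval_const] <;> omega), eval_const (by omega), eval_lt (by omega), e,
          eval_reg, hdir, hs₃, hs₂]
        simp only [State.setReg_reg, u₁, Nat.reduceEqDiff, if_false]
        split_ifs <;> rfl
      rw [Program.sem, eval_addr (by rw [e]; exact v₃) (by rw [e']; omega), e, e', eval_reg, hs₄]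
      simp [hs₃, hs₂, u₂]
    have hnd' : (zip gs (.mk d t' y b)).keys.Nodup := by rw [zip] at u₁₂; rwa [u₁₂]
    have hmem : ∀ x ∈ (Tree.mk d t' y b).keys, x ∈ (zip fs t).keys := by
      intro x hx
      rw [← u₁₂, zip]
      exact mem_zip.2 (.inl hx)
    have hdisj := disjoint_zip hnd'
    have hndk : (Tree.mk d t' y b).keys.Nodup := nodup_of_zip hnd'
    have hy : y ∉ t'.keys ∧ y ∉ b.keys := by
      rw [Tree.keys_mk] at hndk
      split_ifs at hndk <;>
      · simp only [List.nodup_append, List.nodup_cons, List.mem_cons] at hndk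
        grind
    have hm₄ : Same [y] s₁.mem s₄.mem := Same.setMem (s := s₃) (by omega)
    have hn₄ : NodeAt w s₄.mem y d t' b := by
      refine ⟨v₂, v₃, by simp [hs₄], ?_, hm₄.repr u₅ (by simpa using hy.1),
        hm₄.repr v₆ (by simpa using hy.2), hy⟩
      rw [hs₄, State.setMem_mem, if_neg (by rw [fld_inj] <;> omega)]
      exact v₅
    obtain ⟨l, r, hlr, hn₅, hh⟩ : ∃ l r, Tree.mk d t' y b = .node l y r ∧
        NodeAt w s₄.mem y 0 l r ∧ ((l = t' ∧ r = b) ∨ (l = b ∧ r = t')) := by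
      obtain rfl | rfl : d = 0 ∨ d = 1 := by omega
      · exact ⟨t', b, by simp [Tree.mk], hn₄, .inl ⟨rfl, rfl⟩⟩
      · exact ⟨b, t', by simp [Tree.mk], hn₄.symm (by norm_num), .inr ⟨rfl, rfl⟩⟩
    have hk₄ : s₄.reg 16 = y := by simp [hs₄, hs₃]
    have havl : l.AVL ∧ r.AVL := by rcases hh with ⟨rfl, rfl⟩ | ⟨rfl, rfl⟩ <;> tauto
    have hht : l.height ≤ r.height + 2 ∧ r.height ≤ l.height + 2 := by
      rcases hh with ⟨rfl, rfl⟩ | ⟨rfl, rfl⟩ <;> omega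
    have hnil₄ := hm₄.nilOK (by simpa using v₂.symm) u₁₄
    obtain ⟨t'', w₁, w₂, w₃, w₄, w₅, w₆, w₇, w₈⟩ := bal_spec h0 hk₄ hnil₄ hn₅ (by rwa [← hlr])
      havl.1 havl.2 hht.1 hht.2
    rw [← hlr] at w₄
    rw [ascendBody, Program.sem, eq₁, Program.sem, eq₂, Program.sem, eq₃]
    have hsame : Same t''.keys s₁.mem (bal.sem w s₄).mem :=
      (hm₄.mono (by simp [w₄, Tree.mem_keys_mk])).trans w₅
    have hreg : (bal.sem w s₄).reg 13 = K ∧ (bal.sem w s₄).reg 15 = gs.length := by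
      rw [Program.sem_reg rfl _ (by decide), Program.sem_reg rfl _ (by decide)]
      simp [hs₄, hs₃, hs₂, u₁]
    -- The new third component is the height that the subtree at `y` had before the change.
    refine ⟨(gs, t'', max h' b.height + 1), by simp, hreg.1, w₁, hreg.2, ?_, w₂, ?_,
      fun f hf => u₇ f (List.mem_cons_of_mem _ hf), f₄, w₃, ?_, ?_, ?_, ?_, ?_⟩
    · exact v₇.same hsame (by rw [w₄]; exact hdisj)
    · exact u₆.of_le (Nat.le_succ _)
    · rcases hh with ⟨rfl, rfl⟩ | ⟨rfl, rfl⟩ <;> dsimp only <;> omega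
    · rcases hh with ⟨rfl, rfl⟩ | ⟨rfl, rfl⟩ <;> dsimp only <;> omega
    · rw [← u₁₂, zip]
      exact zip_keys_congr w₄
    · exact u₁₃.trans (hsame.mono (by rw [w₄]; exact hmem))
    · refine hsame.nilOK ?_ u₁₄
      rw [w₄, Tree.mem_keys_mk]
      exact fun h => by
        rcases h with h | h | h
        · exact (u₅.small h).1 rfl
        · exact v₂ h.symm
        · exact (v₆.small h).1 rfl

/-! ### Insertion and deletion -/

/-- The key of the time `t` in the tree `i`. -/
def code (i t : ℕ) : ℕ := (i + t) * (i + t) + t + 1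

/-- Within one tree the order of the record numbers is the order of the times, so a node needs no
separate key. -/
theorem code_lt_code {i t t' : ℕ} : code i t < code i t' ↔ t < t' := by
  unfold code
  constructor
  · intro h
    by_contra h'
    have : (i + t') * (i + t') ≤ (i + t) * (i + t) := Nat.mul_le_mul (by omega) (by omega)
    omega
  · intro h
    have : (i + t) * (i + t) ≤ (i + t') * (i + t') := Nat.mul_le_mul (by omega) (by omega)
    omega

/-- A pairing function with squares in place of triangular numbers, computable without division: as
`t ≤ i + t`, the value minus one lies between the square of `i + t` and the next square. So it
determines `i + t`, and then `t`. -/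
theorem code_inj {i t i' t' : ℕ} : code i t = code i' t' ↔ i = i' ∧ t = t' := by
  refine ⟨fun h => ?_, by rintro ⟨rfl, rfl⟩; rfl⟩
  unfold code at h
  have key : ∀ a b c d : ℕ, c ≤ a → d ≤ b → a < b → a * a + c < b * b + d := by
    intro a b c d hc hd hab
    have : (a + 1) * (a + 1) ≤ b * b := Nat.mul_le_mul hab hab
    nlinarith
  have h1 : i + t = i' + t' := by
    rcases Nat.lt_trichotomy (i + t) (i' + t') with h' | h' | h'
    · have := key _ _ t t' (by omega) (by omega) h'; omega
    · exact h'
    · have := key _ _ t' t (by omega) (by omega) h'; omega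
  rw [h1] at h
  omega

theorem code_ne_zero (i t : ℕ) : code i t ≠ 0 := by unfold code; omega

/-- The expression for the key of the time `t` in the tree `i`. -/
def codeExpr (i t : Expr) : Expr :=
  .bin .add (.bin .add (.bin .mul (.bin .add i t) (.bin .add i t)) t) (.const 1)

theorem eval_codeExpr {w : ℕ} {s : State} {i t : Expr}
    (h : code (i.eval w s) (t.eval w s) < 2 ^ w) :
    (codeExpr i t).eval w s = code (i.eval w s) (t.eval w s) := by
  unfold code at *
  have h1 : i.eval w s + t.eval w s ≤ (i.eval w s + t.eval w s) * (i.eval w s + t.eval w s) :=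
    Nat.le_mul_self _
  have e₁ : (Expr.bin .add i t).eval w s = i.eval w s + t.eval w s := eval_add (by omega)
  have e₂ : (Expr.bin .mul (.bin .add i t) (.bin .add i t)).eval w s =
      (i.eval w s + t.eval w s) * (i.eval w s + t.eval w s) := by
    rw [eval_mul, e₁]; rw [e₁]; omega
  have e₃ : (Expr.const 1).eval w s = 1 := eval_const (by omega)
  rw [codeExpr, eval_add, eval_add, e₂, e₃]
  · rw [e₂]; omega
  · rw [eval_add, e₂, e₃]
    · omega
    · rw [e₂]; omega

/-- Make a leaf with the key in register `13` and the value in register `12`. -/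
def newLeaf : Program :=
  .seq (.store (addr (.const 0) (.reg 13)) (.const 0))
  (.seq (.store (addr (.const 1) (.reg 13)) (.const 0))
  (.seq (.store (addr (.const 2) (.reg 13)) (.const 1))
  (.seq (.store (addr (.const 3) (.reg 13)) (.reg 12))
  (.seq (.store (addr (.const 4) (.reg 13)) (.reg 12))
  (.set 14 (.reg 13))))))

theorem sem_store {w : ℕ} {s : State} {f k : ℕ} {x a : Expr} (hf : f < 16) (h : a.eval w s = k)
    (hk : Small w k) :
    (Program.store (addr (.const f) a) x).sem w s = s.setMem (fld f k) (x.eval w s) := by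
  have := hk.lt
  rw [Program.sem, eval_addr (by rwa [h]) (by rw [eval_const (by omega)]; omega),
    eval_const (by omega), h]

theorem sem_set_cell {w : ℕ} {s : State} {r f k : ℕ} {a : Expr} (hf : f < 16)
    (h : a.eval w s = k) (hk : Small w k) :
    (Program.set r (cell f a)).sem w s = s.setReg r (s.mem (fld f k)) := by
  rw [Program.sem, eval_cell (by rwa [h]) hf, h]

theorem sem_seq (w : ℕ) (p q : Program) (s : State) :
    (Program.seq p q).sem w s = q.sem w (p.sem w s) := rfl

theorem sem_set (w r : ℕ) (x : Expr) (s : State) :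
    (Program.set r x).sem w s = s.setReg r (x.eval w s) := rfl

theorem newLeaf_spec {w : ℕ} {s : State} {K v : ℕ} (hK : s.reg 13 = K) (hKs : Small w K)
    (hv : s.reg 12 = v) (hvw : v < 2 ^ w) (hK0 : K ≠ 0) :
    (newLeaf.sem w s).reg 14 = K ∧ (newLeaf.sem w s).reg 13 = K ∧
      (∀ r, r ≠ 14 → (newLeaf.sem w s).reg r = s.reg r) ∧
      (Tree.node .nil K .nil).Repr w (newLeaf.sem w s).mem ∧
      (newLeaf.sem w s).mem (fld 4 K) = v ∧
      ∀ f z, f < 16 → (f < 5 → z ≠ K) → (newLeaf.sem w s).mem (fld f z) = s.mem (fld f z) := by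
  have hw := hKs.lt
  have e0 : ∀ s' : State, (Expr.const 0).eval w s' = 0 := fun _ => eval_const (by omega)
  have e1 : ∀ s' : State, (Expr.const 1).eval w s' = 1 := fun _ => eval_const (by omega)
  have eq : newLeaf.sem w s = (((((s.setMem (fld 0 K) 0).setMem (fld 1 K) 0).setMem (fld 2 K)
      1).setMem (fld 3 K) v).setMem (fld 4 K) v).setReg 14 K := by
    simp only [newLeaf, sem_seq]
    rw [sem_store (k := K) (by norm_num) (by exact hK) hKs, sem_store (k := K) (by norm_num) (by exact hK) hKs,
      sem_store (k := K) (by norm_num) (by exact hK) hKs, sem_store (k := K) (by norm_num) (by exact hK) hKs,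
      sem_store (k := K) (by norm_num) (by exact hK) hKs]
    simp only [Program.sem, e0, e1, eval_reg, State.setMem_reg, hK, hv]
  rw [eq]
  have fi : ∀ f g z, f < 5 → g < 16 → (fld g z = fld f K ↔ g = f ∧ z = K) :=
    fun f g z hf hg => fld_inj hg (by omega)
  refine ⟨by simp, by simp [hK], fun r hr => by simp [hr], ⟨hK0, hKs, ?_, ?_, ?_, ?_, trivial,
    trivial⟩, by simp, fun f z hf hz => ?_⟩
  · simp [fi, Tree.root]
  · simp [fi, Tree.root]
  · simp [fi, Tree.height]
  · simp [fi, Tree.keys, Nat.mod_eq_of_lt hvw]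
  · simp only [State.setReg_mem, State.setMem_mem]
    rw [if_neg, if_neg, if_neg, if_neg, if_neg] <;>
    · rw [fi _ _ _ (by norm_num) hf]
      rintro ⟨rfl, rfl⟩
      simp at hz

/-- Remove the node with the key in register `13`, at which the path on the stack ends: replace it
by its left subtree, or by the first node of its right subtree, which becomes the key in register
`13`. Register `14` receives the tree at the new end of the path. -/
def unlink : Program :=
  .ite (cell 1 (.reg 13))
    (.seq (.seq (.set 29 (.reg 15))
      (.seq (.store (addr (.const 5) (.reg 15)) (.reg 13))
      (.seq (.set 14 (cell 1 (.reg 13)))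
      (.set 15 (.bin .add (.reg 15) (.const 1))))))
    (.seq descend
      (.seq (.set 15 (.bin .sub (.reg 15) (.const 1)))
      (.seq (.set 16 (cell 5 (.reg 15)))
      (.seq (.store (addr (.const 5) (.reg 29)) (.reg 16))
      (.seq (.store (addr (.const 0) (.reg 16)) (cell 0 (.reg 13)))
      (.seq (.set 13 (.reg 16))
      (.set 14 (cell 1 (.reg 16))))))))))
    (.set 14 (cell 0 (.reg 13)))

theorem Fits.replace {gs fs : List Frame} {d K K' : ℕ} {l : Tree} {h : ℕ}
    (hf : Fits (gs ++ ⟨d, K, l⟩ :: fs) h) : Fits (gs ++ ⟨d, K', l⟩ :: fs) h := by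
  induction gs generalizing h with
  | nil => exact hf
  | cons g gs ih => exact ⟨hf.1, hf.2.1, hf.2.2.1, ih hf.2.2.2⟩

/-- Putting `K'` in the place of `K` on a stored path requires just two writes, the stack entry and
the left child of `K'`. The right child lies on the path and is filled in by the ascent. -/
theorem Frames.replace {w : ℕ} {m m' : ℕ → ℕ} {gs fs : List Frame} {K K' : ℕ} {l : Tree}
    (hf : Frames w m (gs ++ ⟨1, K, l⟩ :: fs)) (hK : K' ≠ 0) (hKs : Small w K')
    (hst : m' (fld 5 fs.length) = K') (hl : m' (fld 0 K') = l.root)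
    (hm : ∀ f z, f < 16 → ¬ (f = 0 ∧ z = K') → ¬ (f = 5 ∧ z = fs.length) →
      m' (fld f z) = m (fld f z))
    (hd : ∀ f ∈ gs ++ ⟨1, K, l⟩ :: fs, ∀ z, z = f.key ∨ z ∈ f.other.keys → z ≠ K') :
    Frames w m' (gs ++ ⟨1, K', l⟩ :: fs) := by
  induction gs with
  | nil =>
    obtain ⟨h₁, h₂, h₃, h₄, h₅, h₆, h₇⟩ := hf
    refine ⟨h₁, hK, hKs, hst, hl, ?_, ?_⟩
    · exact h₆.congr fun k hk g hg => hm _ _ (by omega)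
        (fun h => hd ⟨1, K, l⟩ (by simp) k (.inr hk) h.2) (by omega)
    · exact h₇.congr (fun i hi => hm _ _ (by norm_num) (by norm_num) (by omega))
        fun f hf z hz g hg => hm _ _ (by omega) (fun h => hd f (by simp [hf]) z hz h.2) (by omega)
  | cons g gs ih =>
    obtain ⟨h₁, h₂, h₃, h₄, h₅, h₆, h₇⟩ := hf
    refine ⟨h₁, h₂, h₃, ?_, ?_, ?_, ih h₇ fun f hf => hd f (by simp at hf ⊢; tauto)⟩
    · rw [hm _ _ (by norm_num) (by norm_num) (by simp; omega)]
      simpa using h₄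
    · rw [hm _ _ (by omega) (fun h => hd g (by simp) g.key (.inl rfl) h.2) (by omega), h₅]
    · exact h₆.congr fun k hk g' hg => hm _ _ (by omega)
        (fun h => hd g (by simp) k (.inr hk) h.2) (by omega)

theorem leftKeys_eq_nil {fs : List Frame} (h : ∀ f ∈ fs, f.side = 0) : leftKeys fs = [] := by
  induction fs with
  | nil => rfl
  | cons f fs ih =>
    rw [leftKeys, if_pos (h f (by simp))]
    exact ih fun g hg => h g (by simp [hg])

/-- Keys are record numbers, so the contents of the successor cannot be copied into the node of `K`;
the successor's node `m` itself must be moved. All keys to the right exceed `K`, so the descent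
towards `K` in the right subtree always turns left and ends below `m`, whose right subtree `b`
closes the gap. Register `29` remembers the stack level of `K`, where `m` is then entered. -/
theorem unlink_spec {w : ℕ} {s : State} {K : ℕ} {fs : List Frame} {l r : Tree} (h0 : Small w 0)
    (hK : s.reg 13 = K) (hd : s.reg 15 = fs.length) (hfs : Frames w s.mem fs)
    (ht : (Tree.node l K r).Repr w s.mem) (havl : (zip fs (.node l K r)).AVL)
    (hs : Small w (fs.length + (Tree.node l K r).height))
    (hsort : (zip fs (.node l K r)).keys.Pairwise (· < ·)) :
    Runs w unlink s ((Tree.node l K r).height * 32 + 100) fun s' => ∃ K' gs t h,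
      s'.reg 13 = K' ∧ s'.reg 14 = t.root ∧ s'.reg 15 = gs.length ∧
      Frames w s'.mem gs ∧ t.Repr w s'.mem ∧ Toward K' gs ∧ Fits gs h ∧ t.AVL ∧
      t.height ≤ h + 1 ∧ h ≤ t.height + 1 ∧
      gs.length ≤ fs.length + (Tree.node l K r).height ∧
      (∃ a b, (zip fs (.node l K r)).keys = a ++ K :: b ∧ (zip gs t).keys = a ++ b) ∧
      ∀ f z, f < 16 → f ≠ 5 → (f < 4 → z ∉ (zip fs (.node l K r)).keys) →
        s'.mem (fld f z) = s.mem (fld f z) := by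
  have hw := h0.lt
  obtain ⟨k0, ks, kl, kr, kh, ksum, rl, rr⟩ := ht
  obtain ⟨⟨al, ar, hlr, hrl⟩, hfit⟩ := AVL_zip.1 havl
  have hkeys := keys_zip fs (.node l K r)
  simp only [Tree.keys] at hkeys
  have htow : Toward K fs := by
    refine toward_of_keys hfs.side_lt (fun x hx => ?_) fun x hx => ?_
    · rw [hkeys] at hsort
      simp only [List.pairwise_append, List.pairwise_cons, List.mem_append, List.mem_cons] at hsort
      exact (hsort.1.2.2 x hx K (by simp)).le
    · rw [hkeys] at hsort
      simp only [List.pairwise_append, List.pairwise_cons, List.mem_append, List.mem_cons] at hsort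
      exact hsort.2.2 K (by simp) x hx
  have c0 : ∀ s' : State, s'.reg 13 = K → (cell 0 (.reg 13)).eval w s' = s'.mem (fld 0 K) :=
    fun s' h => by rw [eval_cell (by rwa [eval_reg, h]) (by norm_num), eval_reg, h]
  have c1 : ∀ s' : State, s'.reg 13 = K → (cell 1 (.reg 13)).eval w s' = s'.mem (fld 1 K) :=
    fun s' h => by rw [eval_cell (by rwa [eval_reg, h]) (by norm_num), eval_reg, h]
  refine (Runs.ite (K := (Tree.node l K r).height * 32 + 90) (fun htest => ?_)
    fun htest => ?_).mono (by simp [cell, addr, Expr.cost]; omega) fun _ h => h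
  · rw [c1 s hK, kr] at htest
    have hndT : (zip fs (.node l K r)).keys.Nodup := hsort.imp fun h => h.ne
    have hndk := nodup_of_zip hndT
    have hKr : ∀ x ∈ r.keys, K < x := by
      intro x hx
      rw [hkeys] at hsort
      simp only [List.pairwise_append, List.pairwise_cons, List.mem_append, List.mem_cons] at hsort
      exact hsort.1.2.1.2.1.1 x hx
    have hlen : Small w (fs.length + 1) := hs.of_le (by simp [Tree.height])
    have hlen' : Small w fs.length := hlen.of_le (by omega)
    have hlt := hlen.lt
    set s₁ := (((s.setReg 29 fs.length).setMem (fld 5 fs.length) K).setReg 14 r.root).setReg 15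
      (fs.length + 1) with hs₁
    have hm₁ : ∀ f z, f < 16 → f ≠ 5 → s₁.mem (fld f z) = s.mem (fld f z) := by
      intro f z hf hf5
      simp only [hs₁, State.setReg_mem, State.setMem_mem]
      rw [if_neg]
      rw [fld_inj hf (by norm_num)]
      tauto
    have eq₁ : (Program.seq (.set 29 (.reg 15)) (.seq (.store (addr (.const 5) (.reg 15)) (.reg 13))
        (.seq (.set 14 (cell 1 (.reg 13))) (.set 15 (.bin .add (.reg 15) (.const 1)))))).sem w s =
        s₁ := by
      rw [sem_seq, sem_set, eval_reg, hd, sem_seq, sem_store (k := fs.length)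
        (by norm_num) (by simp [eval_reg, hd]) hlen', eval_reg, State.setReg_reg,
        if_neg (by norm_num), hK, sem_seq, sem_set_cell (k := K) (by norm_num)
        (by simp [eval_reg, hK]) ks, sem_set, eval_add, eval_const (by omega), hs₁]
      · simp [eval_reg, hd, fld_inj, kr]
      · rw [eval_const (by omega)]
        simp [eval_reg, hd]
        omega
    have hr0 : r ≠ .nil := by rintro rfl; exact htest rfl
    have hf₁ : Frames w s₁.mem (⟨1, K, l⟩ :: fs) := by
      refine ⟨by norm_num, k0, ks, by simp [hs₁], ?_, ?_, ?_⟩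
      · exact (hm₁ _ _ (by norm_num) (by norm_num)).trans kl
      · exact rl.congr fun x _ f hf => hm₁ f x (by omega) (by omega)
      · refine hfs.congr (fun i hi => ?_) fun f _ z _ g hg => hm₁ g z (by omega) (by omega)
        simp only [hs₁, State.setReg_mem, State.setMem_mem]
        rw [if_neg]
        rw [fld_inj (by norm_num) (by norm_num)]
        omega
    refine (Runs.straight_seq rfl (Runs.seq (descend_spec (s := _) (K := K) (t := r)
      (fs := ⟨1, K, l⟩ :: fs) h0 ?_ ?_ ?_ ?_ ?_ ?_) (L := 50) ?_)).mono ?_ fun _ h => h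
    · rw [eq₁]; simp [hs₁, hK]
    · rw [eq₁]; simp [hs₁]
    · rw [eq₁]; simp [hs₁]
    · rw [eq₁]; exact hf₁
    · rw [eq₁]; exact rr.congr fun x _ f hf => hm₁ f x (by omega) (by omega)
    · refine hs.of_le ?_
      simp only [List.length_cons, Tree.height]
      omega
    rotate_left
    · have : (Program.seq (.set 29 (.reg 15)) (.seq (.store (addr (.const 5) (.reg 15)) (.reg 13))
        (.seq (.set 14 (cell 1 (.reg 13))) (.set 15 (.bin .add (.reg 15) (.const 1)))))).bound
        ≤ 28 := by decide
      simp only [Tree.height]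
      omega
    rw [eq₁]
    rintro s₂ ⟨gs, t', u₁, u₂, u₃, u₄, u₅, u₆, u₇, u₈, u₉, u₁₀⟩
    -- `K` does not occur in its own right subtree, so the descent ends at an empty tree.
    obtain rfl : t' = .nil := by
      rcases u₆ with h | h
      · exact h
      · refine absurd (hKr K ?_) (lt_irrefl K)
        rw [← u₃, mem_zip]
        exact .inl (h ▸ Tree.root_mem (by rw [h]; exact k0))
    cases gs with
    | nil => exact absurd u₃.symm hr0
    | cons g gs =>
    obtain ⟨d, m, b⟩ := g
    -- Every turn of this descent goes to the left; hence there are no keys to the left of its path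
    -- and `m` is the first key of the right subtree.
    have hgk : ∀ f ∈ (⟨d, m, b⟩ :: gs : List Frame), f.side = 0 := by
      intro f hf
      rw [u₇.1 f hf, if_pos]
      refine hKr _ ?_
      rw [← u₃, mem_zip]
      exact .inr ⟨f, hf, .inl rfl⟩
    obtain rfl : d = 0 := hgk ⟨d, m, b⟩ (by simp)
    obtain ⟨v₁, v₂, v₃, v₄, v₅, v₆, v₇⟩ := u₄
    simp only [Nat.sub_zero] at v₁ v₂ v₃ v₄ v₅ v₆ v₇
    have hleft : leftKeys gs = [] := leftKeys_eq_nil fun f hf => hgk f (by simp [hf])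
    have hwhole : zip fs (.node l K r) = zip (gs ++ ⟨1, K, l⟩ :: fs) (.mk 0 .nil m b) := by
      rw [zip_append, zip]
      simp only
      rw [← u₃, zip]
      simp [Tree.mk]
    set S := (zip fs (.node l K r)).keys with hS
    have hSeq : S = (leftKeys fs ++ l.keys) ++ K :: (m :: (b.keys ++ rightKeys gs ++ rightKeys fs))
        := by
      rw [hS, hwhole, keys_zip, leftKeys_append, rightKeys_append, hleft]
      simp [leftKeys, rightKeys, Tree.keys_mk, Tree.keys]
    have hneweq : (zip (gs ++ ⟨1, m, l⟩ :: fs) b).keys =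
        (leftKeys fs ++ l.keys) ++ (m :: (b.keys ++ rightKeys gs ++ rightKeys fs)) := by
      rw [keys_zip, leftKeys_append, rightKeys_append, hleft]
      simp [leftKeys, rightKeys]
    have hnewsort : (zip (gs ++ ⟨1, m, l⟩ :: fs) b).keys.Pairwise (· < ·) := by
      rw [hneweq]
      rw [hSeq] at hsort
      exact hsort.sublist (List.Sublist.append_left (List.sublist_cons_self _ _) _)
    have hdis := disjoint_zip (fs := gs ++ ⟨1, K, l⟩ :: fs) (t := .mk 0 .nil m b) (by
      rw [← hwhole]; exact hndT)
    have hne : ∀ f ∈ gs ++ ⟨1, K, l⟩ :: fs, ∀ z, z = f.key ∨ z ∈ f.other.keys → z ≠ m := by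
      rintro f hf z hz rfl
      exact hdis f hf z hz (Tree.mem_keys_mk.2 (.inr (.inl rfl)))
    rw [hwhole] at havl
    obtain ⟨a₁, a₂⟩ := AVL_zip.1 havl
    have hb := Tree.AVL_mk.1 a₁
    rw [Tree.height_mk] at a₂
    simp only [Tree.height, List.length_cons] at u₈
    -- the last block
    have hr₂ : s₂.reg 13 = K ∧ s₂.reg 29 = fs.length := by
      rw [u₁₀ 13 (by decide), u₁₀ 29 (by decide)]
      simp [hs₁, hK]
    set L := (gs ++ ⟨1, K, l⟩ :: fs).length with hL
    have hLs : Small w (L + 1) := by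
      refine hs.of_le ?_
      simp only [hL, List.length_append, List.length_cons, Tree.height]
      omega
    have hLlt := hLs.lt
    set s₃ := (((((s₂.setReg 15 L).setReg 16 m).setMem (fld 5 fs.length) m).setMem (fld 0 m)
      l.root).setReg 13 m).setReg 14 b.root with hs₃
    have eq₃ : (Program.seq (.set 15 (.bin .sub (.reg 15) (.const 1)))
        (.seq (.set 16 (cell 5 (.reg 15))) (.seq (.store (addr (.const 5) (.reg 29)) (.reg 16))
        (.seq (.store (addr (.const 0) (.reg 16)) (cell 0 (.reg 13)))
        (.seq (.set 13 (.reg 16)) (.set 14 (cell 1 (.reg 16)))))))).sem w s₂ = s₃ := by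
      have u₂' : s₂.reg 15 = L + 1 := u₂
      have v₄' : s₂.mem (fld 5 L) = m := v₄
      have h1 : s₂.mem (fld 0 K) = l.root := by
        rw [u₉ _ _ (by norm_num) (by norm_num), hm₁ _ _ (by norm_num) (by norm_num), kl]
      rw [sem_seq, sem_set, eval_sub (by rw [eval_reg]; omega), eval_const (by omega), eval_reg,
        u₂', Nat.add_sub_cancel, sem_seq, sem_set_cell (k := L) (by norm_num) (by simp [eval_reg])
        (hLs.of_le (by omega)), State.setReg_mem, v₄', sem_seq, sem_store (k := fs.length)
        (by norm_num) (by simp [eval_reg, hr₂]) hlen', sem_seq, sem_store (k := m) (by norm_num)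
        (by simp [eval_reg]) v₃, eval_cell (by simpa [eval_reg, hr₂] using ks) (by norm_num),
        sem_seq, sem_set w 13, sem_set_cell (k := m) (by norm_num) (by simp [eval_reg]) v₃, hs₃]
      simp [eval_reg, fld_inj, h1, v₅, hr₂]
    refine Runs.straight rfl (by decide) ?_
    rw [eq₃]
    have hm₃ : ∀ f z, f < 16 → ¬ (f = 0 ∧ z = m) → ¬ (f = 5 ∧ z = fs.length) →
        s₃.mem (fld f z) = s₂.mem (fld f z) := by
      intro f z hf h₁ h₂
      simp only [hs₃, State.setReg_mem, State.setMem_mem]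
      rw [if_neg (by rwa [fld_inj hf (by norm_num)]), if_neg (by rwa [fld_inj hf (by norm_num)])]
    refine ⟨m, gs ++ ⟨1, m, l⟩ :: fs, b, _, by simp [hs₃], by simp [hs₃], by simp [hs₃, hL], ?_, ?_,
      ?_, a₂.replace, hb.2.1, ?_, ?_, ?_, ⟨_, _, hSeq, hneweq⟩, ?_⟩
    · exact v₇.replace v₂ v₃ (by simp [hs₃, fld_inj]) (by simp [hs₃]) hm₃ hne
    · have hmb : m ∉ b.keys := by
        have := nodup_of_zip (fs := gs ++ ⟨1, K, l⟩ :: fs) (t := .mk 0 .nil m b) (by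
          rw [← hwhole]; exact hndT)
        rw [Tree.keys_mk] at this
        simp [Tree.keys] at this
        exact this.1
      exact v₆.congr fun x hx f hf => hm₃ _ _ (by omega) (by rintro ⟨-, rfl⟩; exact hmb hx)
        (by omega)
    -- The new search key `m` lies on the path itself, at a node where the path goes right. This is
    -- why `Toward` counts an equal key as smaller.
    · rw [hneweq] at hnewsort
      simp only [List.pairwise_append, List.pairwise_cons] at hnewsort
      refine toward_of_keys ?_ (fun x hx => ?_) fun x hx => ?_
      · intro f hf
        simp only [List.mem_append, List.mem_cons] at hf
        rcases hf with hf | rfl | hf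
        · exact v₇.side_lt f (by simp [hf])
        · simp
        · exact v₇.side_lt f (by simp [hf])
      · rw [leftKeys_append, hleft] at hx
        simp only [leftKeys, one_ne_zero, if_false, List.append_nil] at hx
        rcases List.mem_append.1 hx with hx | hx
        · exact (hnewsort.2.2 x hx m (by simp)).le
        · simp at hx; omega
      · rw [rightKeys_append] at hx
        simp only [rightKeys, one_ne_zero, if_false] at hx
        refine hnewsort.2.1.1 x ?_
        simp only [List.mem_append] at hx ⊢
        tauto
    · omega
    · simp [Tree.height]
    · simp only [List.length_append, List.length_cons, Tree.height]
      omega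
    · intro f z hf hf5 hz
      rw [hm₃ f z hf ?_ (by omega), u₉ f z hf hf5, hm₁ f z hf hf5]
      rintro ⟨rfl, rfl⟩
      exact hz (by norm_num) (by rw [hSeq]; simp)
  -- Without a right subtree the left one takes the place of the node, and the path is unchanged.
  · rw [c1 s hK, kr] at htest
    have hr : r = .nil := by
      cases r with
      | nil => rfl
      | node _ _ _ => exact absurd htest rr.1
    subst hr
    refine Runs.straight rfl ((show _ ≤ 90 by decide).trans (by omega)) ?_
    rw [Program.sem, c0 s hK, kl]
    simp only [Tree.height] at *
    refine ⟨K, fs, l, _, by simp [hK], by simp, by simp [hd], hfs, rl, htow, hfit, al, ?_, ?_, ?_,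
      ⟨leftKeys fs ++ l.keys, rightKeys fs, ?_, ?_⟩, fun _ _ _ _ _ => rfl⟩
    · omega
    · omega
    · omega
    · rw [hkeys]; simp [Tree.keys]
    · rw [keys_zip]

/-- A converse of `toward_of_keys`: an unsuccessful search ends exactly in the gap of the in-order
list where `K` belongs. -/
theorem keys_of_toward {K : ℕ} {fs : List Frame} (hto : Toward K fs)
    (hne : ∀ f ∈ fs, f.key ≠ K)
    (hs : (leftKeys fs ++ rightKeys fs).Pairwise (· < ·)) :
    (∀ x ∈ leftKeys fs, x < K) ∧ ∀ x ∈ rightKeys fs, K < x := by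
  induction fs with
  | nil => simp [leftKeys, rightKeys]
  | cons f fs ih =>
    have hf := hto f (by simp)
    have hto' : Toward K fs := fun g hg => hto g (by simp [hg])
    have hne' : ∀ g ∈ fs, g.key ≠ K := fun g hg => hne g (by simp [hg])
    have hfK := hne f (by simp)
    by_cases h : K < f.key
    · rw [if_pos h] at hf
      simp only [leftKeys, rightKeys, hf, if_true] at hs ⊢
      have hs' := ih hto' hne' (hs.sublist ((List.Sublist.refl _).append
        (List.sublist_append_right _ _)))
      refine ⟨hs'.1, fun x hx => ?_⟩
      simp only [List.pairwise_append, List.pairwise_cons, List.cons_append, List.mem_append,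
        List.mem_cons] at hs hx
      rcases hx with rfl | hx | hx
      · exact h
      · exact h.trans (hs.2.1.1 x (.inl hx))
      · exact h.trans (hs.2.1.1 x (.inr hx))
    · rw [if_neg h] at hf
      simp only [leftKeys, rightKeys, hf, one_ne_zero, if_false] at hs ⊢
      have hs' := ih hto' hne' (hs.sublist (List.Sublist.append (by
        rw [List.append_assoc]; exact List.sublist_append_left _ _) (List.Sublist.refl _)))
      refine ⟨fun x hx => ?_, hs'.2⟩
      simp only [List.pairwise_append, List.mem_append, List.mem_singleton] at hs hx
      rcases hx with hx | rfl
      · exact (hs.1.2.2 x hx _ rfl).trans_le (not_lt.1 h)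
      · omega

/-- Remove the time in register `11` from the tree in register `10` if it is there; otherwise insert
it with the value in register `12`. -/
def toggle : Program :=
  .seq (.seq (.set 13 (codeExpr (.reg 10) (.reg 11)))
    (.seq (.set 14 (cell 7 (.reg 10))) (.set 15 (.const 0))))
  (.seq descend
  (.seq (.ite (.reg 14) unlink newLeaf)
  (.seq ascend
  (.store (addr (.const 7) (.reg 10)) (.reg 14)))))

/-- The descent ends at a node precisely when the key is present; then `unlink`, otherwise
`newLeaf`, produces a path and a subtree of nearly the former height, and `ascend` finishes both
cases. The final clause is the frame condition needed to keep the other trees and the records of the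
updates; the stack cells are left out of it. -/
theorem toggle_tree {w : ℕ} {s : State} {i t v : ℕ} {T : Tree} (h0 : Small w 0)
    (hi : s.reg 10 = i) (hti : s.reg 11 = t) (hv : s.reg 12 = v) (hvw : v < 2 ^ w)
    (his : Small w i) (hKs : Small w (code i t)) (hn : Tree.NilOK s.mem) (hT : T.Repr w s.mem)
    (hroot : s.mem (fld 7 i) = T.root) (havl : T.AVL) (hsort : T.keys.Pairwise (· < ·)) :
    Runs w toggle s ((T.height + 1) * 2000) fun s' => ∃ T' : Tree, T'.Repr w s'.mem ∧
      s'.mem (fld 7 i) = T'.root ∧ T'.AVL ∧ T'.keys.Pairwise (· < ·) ∧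
      (∀ x, x ∈ T'.keys ↔
        if code i t ∈ T.keys then x ∈ T.keys ∧ x ≠ code i t else x ∈ T.keys ∨ x = code i t) ∧
      (code i t ∉ T.keys → s'.mem (fld 4 (code i t)) = v) ∧
      ∀ f z, f < 16 → f ≠ 5 → (f < 4 → z ∉ T.keys ∧ z ≠ code i t) →
        (f = 4 → code i t ∈ T.keys ∨ z ≠ code i t) → (f = 7 → z ≠ i) →
        s'.mem (fld f z) = s.mem (fld f z) := by
  have hw := h0.lt
  have hK0 := code_ne_zero i t
  have hc : (codeExpr (.reg 10) (.reg 11)).eval w s = code i t := by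
    rw [eval_codeExpr, eval_reg, eval_reg, hi, hti]
    rw [eval_reg, eval_reg, hi, hti]
    exact lt_of_le_of_lt (by omega) hKs.lt
  set K := code i t
  have hnd : T.keys.Nodup := hsort.imp fun h => h.ne
  have hlen : Small w T.keys.length := Tree.length_lt hnd (fun x hx => hT.small hx) h0
  have hheight := T.height_le_length
  set s₁ := ((s.setReg 13 K).setReg 14 T.root).setReg 15 0 with hs₁
  have eq₁ : (Program.seq (.set 13 (codeExpr (.reg 10) (.reg 11)))
      (.seq (.set 14 (cell 7 (.reg 10))) (.set 15 (.const 0)))).sem w s = s₁ := by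
    rw [sem_seq, sem_set, hc, sem_seq, sem_set_cell (k := i) (by norm_num) (by simp [eval_reg, hi])
      his, State.setReg_mem, hroot, sem_set, eval_const (by omega)]
  have hb : ascendBody.bound ≤ 700 := by decide
  have hb₂ : ascendBody.bound + 2 ≤ 702 := by decide
  clear hb
  have hb' : newLeaf.bound ≤ 90 := by decide
  refine (Runs.straight_seq rfl (L := (T.height + 1) * 1950) ?_).mono (by
    have : (Program.seq (.set 13 (codeExpr (.reg 10) (.reg 11)))
      (.seq (.set 14 (cell 7 (.reg 10))) (.set 15 (.const 0)))).bound ≤ 50 := by decide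
    omega) fun _ h => h
  rw [eq₁]
  refine (Runs.seq (descend_spec (s := s₁) (K := K) (fs := []) (t := T) h0 (by simp [hs₁]) (by simp [hs₁])
    (by simp [hs₁]) trivial hT (hlen.of_le (by simpa using hheight)))
    (L := (T.height + 1) * 1900) ?_).mono (by omega) fun _ h => h
  rintro s₂ ⟨fs, T₀, u₁, u₂, u₃, u₄, u₅, u₆, u₇, u₈, u₉, u₁₀⟩
  rw [List.append_nil] at u₂ u₄
  have hr₂ : s₂.reg 13 = K ∧ s₂.reg 10 = i ∧ s₂.reg 12 = v := by
    rw [u₁₀ 13 (by decide), u₁₀ 10 (by decide), u₁₀ 12 (by decide)]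
    simp [hs₁, hi, hv]
  have hkeys : T.keys = leftKeys fs ++ T₀.keys ++ rightKeys fs := by rw [← u₃, keys_zip]
  -- the base of the recursion
  have hbase : Runs w (.ite (.reg 14) unlink newLeaf) s₂ ((T.height + 1) * 200) fun s' =>
      ∃ K' gs t₁ h, s'.reg 13 = K' ∧ s'.reg 14 = t₁.root ∧ s'.reg 15 = gs.length ∧
        Frames w s'.mem gs ∧ t₁.Repr w s'.mem ∧ Toward K' gs ∧ Fits gs h ∧ t₁.AVL ∧
        t₁.height ≤ h + 1 ∧ h ≤ t₁.height + 1 ∧ gs.length ≤ T.height ∧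
        (zip gs t₁).keys.Pairwise (· < ·) ∧ (∀ x, x ∈ (zip gs t₁).keys ↔
          if K ∈ T.keys then x ∈ T.keys ∧ x ≠ K else x ∈ T.keys ∨ x = K) ∧
        (K ∉ T.keys → s'.mem (fld 4 K) = v) ∧
        ∀ f z, f < 16 → f ≠ 5 → (f < 4 → z ∉ T.keys ∧ z ≠ K) →
          (f = 4 → K ∈ T.keys ∨ z ≠ K) → s'.mem (fld f z) = s.mem (fld f z) := by
    refine (Runs.ite (K := T.height * 32 + 100) (fun htest => ?_) fun htest => ?_).mono
      (by simp only [Expr.cost]; omega) fun _ h => h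
    · rw [eval_reg, u₁] at htest
      cases T₀ with
      | nil => exact absurd rfl htest
      | node l k r =>
      have hk : k = K := by
        rcases u₆ with h | h
        · exact absurd h (by simp)
        · exact h
      subst hk
      have hKT : K ∈ T.keys := by rw [hkeys]; simp [Tree.keys]
      refine (unlink_spec h0 hr₂.1 u₂ u₄ u₅ (by rwa [u₃]) (hlen.of_le (by omega))
        (by rwa [u₃])).mono (by omega) ?_
      rintro s₃ ⟨K', gs, t₁, h, v₁, v₂, v₃, v₄, v₅, v₆, v₇, v₈, v₉, v₁₀, v₁₁, ⟨a, b, ha, hb⟩, v₁₂⟩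
      rw [u₃] at ha v₁₂
      refine ⟨K', gs, t₁, h, v₁, v₂, v₃, v₄, v₅, v₆, v₇, v₈, v₉, v₁₀, by omega, ?_, fun x => ?_,
        fun h => absurd hKT h, fun f z hf hf5 hz _ => ?_⟩
      · rw [hb]
        rw [ha] at hsort
        exact hsort.sublist (List.Sublist.append_left (List.sublist_cons_self _ _) _)
      · rw [if_pos hKT, hb, ha]
        rw [ha] at hnd
        simp only [List.nodup_append, List.nodup_cons, List.mem_append, List.mem_cons] at hnd ⊢
        grind
      · rw [v₁₂ f z hf hf5 fun h4 => (hz h4).1, u₉ f z hf hf5, hs₁]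
        rfl
    · rw [eval_reg, u₁] at htest
      obtain rfl : T₀ = .nil := by
        cases T₀ with
        | nil => rfl
        | node l k r => exact absurd htest u₅.1
      simp only [Tree.keys, List.append_nil] at hkeys
      obtain ⟨hl, hr⟩ := keys_of_toward u₇.1 u₇.2 (by rw [← hkeys]; exact hsort)
      have hKT : K ∉ T.keys := by
        rw [hkeys, List.mem_append]
        exact fun h => h.elim (fun h => (hl K h).ne rfl) fun h => (hr K h).ne rfl
      refine Runs.straight rfl (by omega) ?_
      obtain ⟨v₁, v₂, v₃, v₄, v₅, v₆⟩ := newLeaf_spec hr₂.1 hKs hr₂.2.2 hvw hK0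
      have hKT' := hKT
      rw [hkeys, List.mem_append, not_or] at hKT
      rw [hkeys, List.pairwise_append] at hsort
      have hfit := (AVL_zip.1 (show (zip fs .nil).AVL by rwa [u₃])).2
      have hfs : ∀ f ∈ fs, ∀ z, z = f.key ∨ z ∈ f.other.keys → z ≠ K := by
        rintro f hf z hz rfl
        rcases mem_leftKeys_or.2 ⟨f, hf, hz⟩ with h | h
        · exact hKT.1 h
        · exact hKT.2 h
      -- The former subtree is empty, of height 0; the new leaf is higher by one.
      refine ⟨K, fs, .node .nil K .nil, 0, v₂, v₁, ?_, ?_, v₄, u₇.1, hfit, ?_, ?_, ?_, ?_, ?_, fun x => ?_,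
        fun _ => v₅, fun f z hf hf5 hz hz' => ?_⟩
      · rw [v₃ 15 (by norm_num), u₂]
      · exact u₄.congr (fun i _ => v₆ _ _ (by norm_num) (by norm_num)) fun f hf z hz g hg =>
          v₆ _ _ (by omega) fun _ => hfs f hf z hz
      · simp [Tree.AVL, Tree.height]
      · simp [Tree.height]
      · simp [Tree.height]
      · omega
      · rw [keys_zip]
        simp only [Tree.keys, List.nil_append, List.pairwise_append, List.pairwise_cons,
          List.mem_cons, List.append_assoc, List.cons_append]
        grind
      · rw [if_neg hKT', hkeys, keys_zip]
        simp [Tree.keys]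
        tauto
      · rw [v₆ f z hf fun h5 => ?_, u₉ f z hf hf5, hs₁]
        · rfl
        · rcases Nat.lt_or_ge f 4 with h | h
          · exact (hz h).2
          · rcases hz' (by omega) with h' | h'
            · rw [hkeys, List.mem_append] at h'; tauto
            · exact h'
  have hK10 : ∀ p : Program, 10 ∉ p.writes → ∀ {s : State} {N : ℕ} {Q : State → Prop},
      Runs w p s N Q → Runs w p s N fun s' => Q s' ∧ s'.reg 10 = s.reg 10 :=
    fun p hp _ _ _ h => h.frame.mono le_rfl fun _ h => ⟨h.1, h.2.1 10 hp⟩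
  refine (Runs.seq (hK10 _ (by decide) hbase) (L := (T.height + 1) * 1700) ?_).mono (by omega)
    fun _ h => h
  rintro s₃ ⟨⟨K', gs, t₁, h, v₁, v₂, v₃, v₄, v₅, v₆, v₇, v₈, v₉, v₁₀, v₁₁, v₁₂, v₁₃, v₁₄, v₁₅⟩, hr₃⟩
  have hn₃ : Tree.NilOK s₃.mem := by
    have h0T : 0 ∉ T.keys := fun h => (hT.small h).1 rfl
    refine ⟨?_, ?_, ?_⟩
    · rw [v₁₅ 2 0 (by norm_num) (by norm_num) (fun _ => ⟨h0T, hK0.symm⟩) (by norm_num), hn.1]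
    · rw [v₁₅ 3 0 (by norm_num) (by norm_num) (fun _ => ⟨h0T, hK0.symm⟩) (by norm_num), hn.2.1]
    · rw [v₁₅ 4 0 (by norm_num) (by norm_num) (by norm_num) (fun _ => .inr hK0.symm), hn.2.2]
  have hnd₃ : (zip gs t₁).keys.Nodup := v₁₂.imp fun h => h.ne
  refine (Runs.seq (ascend_spec h0 hn₃ v₁ v₂ v₃ v₄ v₅ (hlen.of_le (by omega)) v₆ v₇ v₈ v₉ v₁₀ hnd₃)
    (L := 20) ?_).mono ?_ fun _ h => h
  · rintro s₄ ⟨T', x₁, x₂, x₃, x₄, x₅, x₆⟩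
    have hr₄ : s₄.reg 10 = i := by rw [x₆ 10 (by decide), hr₃, hr₂.2.1]
    refine Runs.straight rfl (by decide) ?_
    rw [sem_store (k := i) (by norm_num) (by rw [eval_reg, hr₄]) his, eval_reg, x₁]
    have hm : ∀ f z, f < 16 → (f = 7 → z ≠ i) →
        (s₄.setMem (fld 7 i) T'.root).mem (fld f z) = s₄.mem (fld f z) := by
      intro f z hf hz
      rw [State.setMem_mem, if_neg]
      rw [fld_inj hf (by norm_num)]
      tauto
    refine ⟨T', x₂.congr fun k _ f hf => hm f k (by omega) (by omega), by simp, x₃,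
      by rwa [x₄], by rwa [x₄], fun hKT => ?_, fun f z hf hf5 hz hz' hz'' => ?_⟩
    · rw [hm _ _ (by norm_num) (by norm_num), x₅ _ _ (by norm_num) (by norm_num), v₁₄ hKT]
    · rw [hm f z hf hz'', x₅ f z hf fun h4 => ?_, v₁₅ f z hf hf5 hz hz']
      obtain ⟨h1, h2⟩ := hz h4
      rw [x₄, v₁₃]
      split_ifs
      · exact fun h => h1 h.1
      · exact fun h => h.elim h1 h2
  · have : gs.length * (ascendBody.bound + 2) ≤ T.height * 702 :=
      Nat.mul_le_mul v₁₁ hb₂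
    omega

/-! ### Families of search trees -/

/-- The memory holds a search tree for every `i`; it contains the times `t` with `G i t ≠ none`,
with the values that `G` gives. -/
structure Holds (w : ℕ) (m : ℕ → ℕ) (G : ℕ → ℕ → Option ℕ) : Prop where
  nil : Tree.NilOK m
  tree : ∀ i, ∃ T : Tree, T.Repr w m ∧ m (fld 7 i) = T.root ∧ T.AVL ∧
    T.keys.Pairwise (· < ·) ∧ ∀ k, k ∈ T.keys ↔ ∃ t, G i t ≠ none ∧ k = code i t
  val : ∀ i t v, G i t = some v → m (fld 4 (code i t)) = v

/-- Remove `t` from the tree `i` or insert it with the value `v`. -/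
def flip (G : ℕ → ℕ → Option ℕ) (i t v : ℕ) : ℕ → ℕ → Option ℕ := fun i' t' =>
  if i' = i ∧ t' = t then (if G i t = none then some v else none) else G i' t'

theorem Holds.congr {w : ℕ} {m m' : ℕ → ℕ} {G : ℕ → ℕ → Option ℕ} (h : Holds w m G)
    (hm : ∀ f z, f < 8 → m' (fld f z) = m (fld f z)) : Holds w m' G := by
  refine ⟨⟨?_, ?_, ?_⟩, fun i => ?_, fun i t v hv => ?_⟩
  · rw [hm _ _ (by norm_num), h.nil.1]
  · rw [hm _ _ (by norm_num), h.nil.2.1]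
  · rw [hm _ _ (by norm_num), h.nil.2.2]
  · obtain ⟨T, h₁, h₂, h₃⟩ := h.tree i
    exact ⟨T, h₁.congr fun k _ f hf => hm f k (by omega), by rw [hm _ _ (by norm_num), h₂], h₃⟩
  · rw [hm _ _ (by norm_num), h.val i t v hv]

/-- A tree has at most one node for each time, so a single finite set `F` of times bounds the
heights of all trees together. -/
theorem height_le_log_card {T : Tree} {G : ℕ → ℕ → Option ℕ} {i : ℕ} (hT : T.AVL)
    (hs : T.keys.Pairwise (· < ·)) (hk : ∀ k, k ∈ T.keys ↔ ∃ t, G i t ≠ none ∧ k = code i t)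
    {F : Finset ℕ} (hF : ∀ t, G i t ≠ none → t ∈ F) : T.height ≤ 4 * Nat.log 2 (F.card + 2) := by
  refine hT.height_le_log ?_
  rw [← List.toFinset_card_of_nodup (hs.imp fun h => h.ne)]
  refine (Finset.card_le_card (t := F.image (code i)) fun k hk' => ?_).trans Finset.card_image_le
  obtain ⟨t, ht, rfl⟩ := (hk k).1 (by simpa using hk')
  exact Finset.mem_image_of_mem _ (hF t ht)

/-- The trees with other numbers survive because, by injectivity of `code`, they have no record in
common with the tree `i`. -/
theorem toggle_spec {w : ℕ} {s : State} {G : ℕ → ℕ → Option ℕ} {i t v : ℕ} {F : Finset ℕ}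
    (h : Holds w s.mem G) (hi : s.reg 10 = i) (ht : s.reg 11 = t) (hv : s.reg 12 = v)
    (hvw : v < 2 ^ w) (his : Small w i) (hKs : Small w (code i t))
    (hF : ∀ t', G i t' ≠ none → t' ∈ F) :
    Runs w toggle s (10000 * Nat.log 2 (F.card + 2)) fun s' => Holds w s'.mem (flip G i t v) ∧
      (∀ f z, 8 ≤ f → f < 16 → s'.mem (fld f z) = s.mem (fld f z)) ∧
      ∀ r, r ∉ toggle.writes → s'.reg r = s.reg r := by
  have h0 : Small w 0 := his.of_le (by omega)
  obtain ⟨T, hT, hroot, havl, hsort, hkeys⟩ := h.tree i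
  have hh := height_le_log_card havl hsort hkeys hF
  have hlog : 1 ≤ Nat.log 2 (F.card + 2) := Nat.log_pos (by norm_num) (by omega)
  refine (toggle_tree h0 hi ht hv hvw his hKs h.nil hT hroot havl hsort).frame.mono (by omega) ?_
  rintro s' ⟨⟨T', u₁, u₂, u₃, u₄, u₅, u₆, u₇⟩, hreg, -⟩
  have hcode : code i t ∈ T.keys ↔ G i t ≠ none := by
    rw [hkeys]
    constructor
    · rintro ⟨t', ht', he⟩
      rw [(code_inj.1 he).2]
      exact ht'
    · exact fun h => ⟨t, h, rfl⟩
  have hother : ∀ i' t', i' ≠ i → code i' t' ∉ T.keys ∧ code i' t' ≠ code i t := by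
    intro i' t' hne
    constructor
    · rw [hkeys]
      rintro ⟨t'', -, he⟩
      exact hne (code_inj.1 he).1
    · exact fun he => hne (code_inj.1 he).1
  refine ⟨⟨?_, fun i' => ?_, fun i' t' v' hv' => ?_⟩, fun f z h8 hf => u₇ f z hf (by omega)
    (by omega) (by omega) (by omega), hreg⟩
  · have h0T : 0 ∉ T.keys := fun h => (hT.small h).1 rfl
    have hK0 := (code_ne_zero i t).symm
    refine ⟨?_, ?_, ?_⟩
    · rw [u₇ 2 0 (by norm_num) (by norm_num) (fun _ => ⟨h0T, hK0⟩) (by norm_num) (by norm_num),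
        h.nil.1]
    · rw [u₇ 3 0 (by norm_num) (by norm_num) (fun _ => ⟨h0T, hK0⟩) (by norm_num) (by norm_num),
        h.nil.2.1]
    · rw [u₇ 4 0 (by norm_num) (by norm_num) (by norm_num) (fun _ => .inr hK0) (by norm_num),
        h.nil.2.2]
  · by_cases hii : i' = i
    · subst hii
      refine ⟨T', u₁, u₂, u₃, u₄, fun k => ?_⟩
      rw [u₅]
      simp only [hcode, hkeys, flip]
      constructor
      · intro hk
        split_ifs at hk with hG
        · obtain ⟨⟨t', ht', rfl⟩, hne⟩ := hk
          refine ⟨t', ?_, rfl⟩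
          rw [if_neg]
          · exact ht'
          · rintro ⟨-, rfl⟩; exact hne rfl
        · rcases hk with ⟨t', ht', rfl⟩ | rfl
          · refine ⟨t', ?_, rfl⟩
            rw [if_neg]
            · exact ht'
            · rintro ⟨-, rfl⟩; exact hG ht'
          · exact ⟨t, by simpa using hG, rfl⟩
      · rintro ⟨t', ht', rfl⟩
        by_cases htt : t' = t
        · subst htt
          have : G i' t' = none := by by_contra hG; simp [hG] at ht'
          rw [if_neg (by simpa using this)]
          exact .inr rfl
        · rw [if_neg (by tauto)] at ht'
          split_ifs
          · exact ⟨⟨t', ht', rfl⟩, fun he => htt (code_inj.1 he).2⟩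
          · exact .inl ⟨t', ht', rfl⟩
    · obtain ⟨T₁, v₁, v₂, v₃, v₄, v₅⟩ := h.tree i'
      refine ⟨T₁, v₁.congr fun k hk f hf => ?_, ?_, v₃, v₄, fun k => ?_⟩
      · obtain ⟨t', -, rfl⟩ := (v₅ k).1 hk
        have := hother i' t' hii
        exact u₇ f _ (by omega) (by omega) (fun _ => this) (fun _ => .inr this.2) (by omega)
      · rw [u₇ 7 i' (by norm_num) (by norm_num) (by norm_num) (by norm_num) fun _ => hii, v₂]
      · simp only [flip, hii, false_and, if_false, v₅]
  · unfold flip at hv'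
    split_ifs at hv' with h₁ h₂
    · obtain ⟨rfl, rfl⟩ := h₁
      rw [u₆ (by rw [hcode]; simpa using h₂)]
      simpa using hv'
    · rw [u₇ 4 _ (by norm_num) (by norm_num) (by norm_num) (fun _ => ?_) (by norm_num),
        h.val _ _ _ hv']
      by_cases hii : i' = i
      · exact .inr fun he => h₁ ⟨hii, (code_inj.1 he).2⟩
      · exact .inr (hother i' t' hii).2

/-! ### Searching -/

/-- Search the tree in register `14` for the last key on the side `f` at which the test holds, and
leave it in register `r`. -/
def searchLoop (test : Expr) (r f : ℕ) : Program :=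
  .while (.reg 14) (.ite test (.seq (.set r (.reg 14)) (.set 14 (cell f (.reg 14))))
    (.set 14 (cell (1 - f) (.reg 14))))

theorem sorted_mk {f : ℕ} {a : Tree} {k : ℕ} {b : Tree} (hf : f < 2)
    (h : (Tree.mk f a k b).keys.Pairwise (· < ·)) :
    a.keys.Pairwise (· < ·) ∧ b.keys.Pairwise (· < ·) ∧
      (∀ x ∈ a.keys, if f = 1 then k < x else x < k) ∧
      ∀ x ∈ b.keys, if f = 1 then x < k else k < x := by
  obtain rfl | rfl : f = 0 ∨ f = 1 := by omega
  all_goals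
    simp only [Tree.keys_mk, List.pairwise_append, List.pairwise_cons, List.mem_cons, if_true,
      one_ne_zero, zero_ne_one, if_false] at h ⊢
    grind

/-- With `f = 1` the predicate is closed downwards and its largest key is sought; with `f = 0` it is
closed upwards and its least key is sought. The result 0 means failure, as no node has the number 0.
-/
theorem searchLoop_spec {w : ℕ} {s : State} {test : Expr} {r f K : ℕ} {T : Tree} {P : ℕ → Prop}
    (h0 : Small w 0) (hf : f < 2) (hr : r ≠ 13 ∧ r ≠ 14) (hT : T.Repr w s.mem)
    (hK : s.reg 13 = K) (hx : s.reg 14 = T.root) (hsort : T.keys.Pairwise (· < ·))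
    (htest : ∀ s' : State, s'.reg 13 = K → (test.eval w s' ≠ 0 ↔ P (s'.reg 14)))
    (hP : ∀ x y, P x → (if f = 1 then y < x else x < y) → P y) (hr0 : s.reg r = 0) :
    Runs w (searchLoop test r f) s (T.height * (test.cost + 30) + 2) fun s' =>
      ((s'.reg r = 0 ∧ ∀ k ∈ T.keys, ¬ P k) ∨ (s'.reg r ∈ T.keys ∧ P (s'.reg r) ∧
        ∀ k ∈ T.keys, P k → k ≠ s'.reg r → if f = 1 then k < s'.reg r else s'.reg r < k)) ∧
      s'.mem = s.mem ∧ ∀ q, q ∉ [r, 14] → s'.reg q = s.reg q := by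
  -- The invariant says that an answer for the remaining subtree, with register `r` as the default
  -- if no key there satisfies `P`, is an answer for the whole tree.
  have key := Runs.loop (w := w) (b := .reg 14)
    (p := .ite test (.seq (.set r (.reg 14)) (.set 14 (cell f (.reg 14))))
      (.set 14 (cell (1 - f) (.reg 14)))) (K := test.cost + 27)
    (α := Tree) (fun x => x.height)
    (fun x s' => s'.reg 14 = x.root ∧ s'.mem = s.mem ∧ s'.reg 13 = K ∧ x.Repr w s.mem ∧
      x.keys.Pairwise (· < ·) ∧
      ∀ p, ((p = s'.reg r ∧ ∀ k ∈ x.keys, ¬ P k) ∨ (p ∈ x.keys ∧ P p ∧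
        ∀ k ∈ x.keys, P k → k ≠ p → if f = 1 then k < p else p < k)) →
        ((p = 0 ∧ ∀ k ∈ T.keys, ¬ P k) ∨ (p ∈ T.keys ∧ P p ∧
        ∀ k ∈ T.keys, P k → k ≠ p → if f = 1 then k < p else p < k)))
    ?_ T s ⟨hx, rfl, hK, hT, hsort, by rw [hr0]; exact fun _ h => h⟩
  · refine key.frame.mono (by simp only [Expr.cost]; ring_nf; omega) ?_
    rintro s' ⟨⟨htest', x, u₁, u₂, u₃, u₄, u₅, u₆⟩, hreg, -⟩
    have : x = .nil := by
      cases x with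
      | nil => rfl
      | node l k r => exact absurd (u₁.symm.trans htest') u₄.1
    subst this
    refine ⟨u₆ _ (.inl ⟨rfl, by simp [Tree.keys]⟩), u₂, fun q hq => hreg q ?_⟩
    simpa [Program.writes, not_or] using hq
  · rintro x s₁ ⟨u₁, u₂, u₃, u₄, u₅, u₆⟩ hne
    rw [eval_reg, u₁] at hne
    obtain ⟨a, k, b, rfl⟩ := Tree.exists_mk (t := x) (by
      cases x with
      | nil => exact absurd rfl hne
      | node l k r => simp [Tree.height]) f
    rw [Tree.root_mk] at u₁
    obtain ⟨k0, ks, kl, kr, ra, rb⟩ := u₄.of_mk hf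
    obtain ⟨sa, sb, hak, hbk⟩ := sorted_mk hf u₅
    have hc := htest s₁ u₃
    rw [u₁] at hc
    refine Runs.straight rfl ?_ ?_
    · simp only [Program.bound, cell, addr, Expr.cost]; omega
    rw [Program.sem]
    by_cases hPk : P k
    · rw [if_neg (hc.2 hPk), sem_seq, sem_set w r, eval_reg, u₁, sem_set_cell (k := k) (by omega)
        (by simp [eval_reg, hr.2.symm, u₁]) ks, State.setReg_mem, u₂, kl]
      refine ⟨a, by rw [Tree.height_mk]; omega, by simp, u₂, by simp [hr.1.symm, u₃], ra, sa,
        fun p hp => u₆ p (.inr ?_)⟩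
      simp only [State.setReg_reg, if_neg hr.2, if_true] at hp
      simp only [Tree.mem_keys_mk]
      obtain rfl | rfl : f = 0 ∨ f = 1 := by omega
      all_goals
        simp only [zero_ne_one, if_true, if_false] at hak hbk hp ⊢
        rcases hp with ⟨rfl, h⟩ | ⟨h₁, h₂, h₃⟩
        · grind
        · grind
    · rw [if_pos (not_not.1 (hc.not.2 hPk)), sem_set_cell (k := k) (by omega)
        (by simp [eval_reg, u₁]) ks, u₂, kr]
      refine ⟨b, by rw [Tree.height_mk]; omega, by simp, u₂, by simp [u₃], rb, sb,
        fun p hp => u₆ p ?_⟩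
      simp only [State.setReg_reg, if_neg hr.2] at hp
      simp only [Tree.mem_keys_mk]
      have hPa : ∀ x ∈ a.keys, ¬ P x := fun x hx h => hPk (hP x k h (hak x hx))
      rcases hp with ⟨rfl, h⟩ | ⟨h₁, h₂, h₃⟩
      · left; grind
      · right; grind

/-- Find the times in the tree in register `10` before and after the time in register `11`; their
nodes are left in the registers `23` and `24`. -/
def search : Program :=
  .seq (.seq (.set 13 (codeExpr (.reg 10) (.reg 11)))
    (.seq (.set 14 (cell 7 (.reg 10))) (.set 23 (.const 0))))
  (.seq (searchLoop (.bin .lt (.reg 14) (.reg 13)) 23 1)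
  (.seq (.seq (.set 14 (cell 7 (.reg 10))) (.set 24 (.const 0)))
  (searchLoop (.bin .lt (.reg 13) (.reg 14)) 24 0)))

theorem search_spec {w : ℕ} {s : State} {G : ℕ → ℕ → Option ℕ} {i t : ℕ} {F : Finset ℕ}
    (h : Holds w s.mem G) (hi : s.reg 10 = i) (ht : s.reg 11 = t)
    (his : Small w i) (hKs : Small w (code i t)) (hF : ∀ t', G i t' ≠ none → t' ∈ F) :
    Runs w search s (500 * Nat.log 2 (F.card + 2)) fun s' =>
      ((s'.reg 23 = 0 ∧ ∀ t' < t, G i t' = none) ∨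
        ∃ p < t, s'.reg 23 = code i p ∧ G i p ≠ none ∧ ∀ t', p < t' → t' < t → G i t' = none) ∧
      ((s'.reg 24 = 0 ∧ ∀ t', t < t' → G i t' = none) ∨
        ∃ q, t < q ∧ s'.reg 24 = code i q ∧ G i q ≠ none ∧
          ∀ t', t < t' → t' < q → G i t' = none) ∧
      s'.mem = s.mem ∧ ∀ r, r ∉ search.writes → s'.reg r = s.reg r := by
  have h0 : Small w 0 := his.of_le (by omega)
  have hw := h0.lt
  obtain ⟨T, hT, hroot, havl, hsort, hkeys⟩ := h.tree i
  have hh := height_le_log_card havl hsort hkeys hF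
  have hlog : 1 ≤ Nat.log 2 (F.card + 2) := Nat.log_pos (by norm_num) (by omega)
  have hc : (codeExpr (.reg 10) (.reg 11)).eval w s = code i t := by
    rw [eval_codeExpr, eval_reg, eval_reg, hi, ht]
    rw [eval_reg, eval_reg, hi, ht]
    exact lt_of_le_of_lt (by omega) hKs.lt
  have key : Runs w search s (500 * Nat.log 2 (F.card + 2)) fun s' =>
      ((s'.reg 23 = 0 ∧ ∀ k ∈ T.keys, ¬ k < code i t) ∨ (s'.reg 23 ∈ T.keys ∧
        s'.reg 23 < code i t ∧ ∀ k ∈ T.keys, k < code i t → k ≠ s'.reg 23 → k < s'.reg 23)) ∧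
      ((s'.reg 24 = 0 ∧ ∀ k ∈ T.keys, ¬ code i t < k) ∨ (s'.reg 24 ∈ T.keys ∧
        code i t < s'.reg 24 ∧ ∀ k ∈ T.keys, code i t < k → k ≠ s'.reg 24 → s'.reg 24 < k)) := by
    set s₁ := ((s.setReg 13 (code i t)).setReg 14 T.root).setReg 23 0 with hs₁
    have eq₁ : (Program.seq (.set 13 (codeExpr (.reg 10) (.reg 11)))
        (.seq (.set 14 (cell 7 (.reg 10))) (.set 23 (.const 0)))).sem w s = s₁ := by
      rw [sem_seq, sem_set, hc, sem_seq, sem_set_cell (k := i) (by norm_num)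
        (by simp [eval_reg, hi]) his, State.setReg_mem, hroot, sem_set, eval_const (by omega)]
    have hb : (Program.seq (.set 13 (codeExpr (.reg 10) (.reg 11)))
        (.seq (.set 14 (cell 7 (.reg 10))) (.set 23 (.const 0)))).bound ≤ 50 := by decide
    have hb' : (Program.seq (.set 14 (cell 7 (.reg 10))) (.set 24 (.const 0))).bound ≤ 50 := by
      decide
    refine (Runs.straight_seq rfl (L := 350 * Nat.log 2 (F.card + 2)) ?_).mono (by omega)
      fun _ h => h
    rw [eq₁]
    refine (Runs.seq (searchLoop_spec (s := s₁) (K := code i t) (P := fun x => x < code i t)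
      h0 (by norm_num) (by norm_num) hT (by simp [hs₁]) (by simp [hs₁]) hsort
      (fun s' hs' => ?_) (fun x y hx hxy => ?_) (by simp [hs₁]))
      (L := 50 + (T.height * 33 + 2)) ?_).mono ?_ fun _ h => h
    · rw [eval_lt (by omega), eval_reg, eval_reg, hs']
      simp
    · simp only [if_true] at hxy
      exact hxy.trans hx
    · rintro s₂ ⟨u₁, u₂, u₃⟩
      set s₃ := (s₂.setReg 14 T.root).setReg 24 0 with hs₃
      have eq₃ : (Program.seq (.set 14 (cell 7 (.reg 10))) (.set 24 (.const 0))).sem w s₂ = s₃ := by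
        rw [sem_seq, sem_set_cell (k := i) (by norm_num)
          (by rw [eval_reg, u₃ 10 (by decide)]; simp [hs₁, hi]) his, u₂, sem_set,
          eval_const (by omega)]
        have : s₁.mem (fld 7 i) = T.root := hroot
        rw [this]
      refine (Runs.straight_seq rfl (L := T.height * 33 + 2) ?_).mono (by omega) fun _ h => h
      rw [eq₃]
      refine (searchLoop_spec (s := s₃) (K := code i t) (P := fun x => code i t < x)
        h0 (by norm_num) (by norm_num) (by change T.Repr w s₂.mem; rw [u₂]; exact hT)
        (by simp only [hs₃, State.setReg_reg]; norm_num; rw [u₃ 13 (by decide)]; simp [hs₁])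
        (by simp [hs₃]) hsort
        (fun s' hs' => ?_) (fun x y hx hxy => ?_) (by simp [hs₃])).mono ?_ ?_
      · rw [eval_lt (by omega), eval_reg, eval_reg, hs']
        simp
      · simp only [zero_ne_one, if_false] at hxy
        exact hx.trans hxy
      · simp [Expr.cost]
      · rintro s₄ ⟨v₁, v₂, v₃⟩
        refine ⟨?_, by simpa using v₁⟩
        have : s₄.reg 23 = s₂.reg 23 := by rw [v₃ 23 (by decide)]; simp [hs₃]
        rw [this]
        simpa using u₁
    · simp only [Expr.cost]
      omega
  refine key.frame.mono le_rfl ?_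
  rintro s' ⟨⟨h₁, h₂⟩, hreg, hmem⟩
  have hnone : ∀ t', code i t' ∉ T.keys → G i t' = none := by
    intro t' h'
    by_contra hG
    exact h' ((hkeys _).2 ⟨t', hG, rfl⟩)
  refine ⟨?_, ?_, hmem rfl, hreg⟩
  · rcases h₁ with ⟨e, h₁⟩ | ⟨h₁, h₁', h₁''⟩
    · exact .inl ⟨e, fun t' ht' => hnone t' fun hk => h₁ _ hk (code_lt_code.2 ht')⟩
    · obtain ⟨p, hp, he⟩ := (hkeys _).1 h₁
      rw [he, code_lt_code] at h₁'
      refine .inr ⟨p, h₁', he, hp, fun t' h3 h4 => hnone t' fun hk => ?_⟩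
      have := h₁'' _ hk (code_lt_code.2 h4) (by rw [he, Ne, code_inj]; omega)
      rw [he, code_lt_code] at this
      omega
  · rcases h₂ with ⟨e, h₁⟩ | ⟨h₁, h₁', h₁''⟩
    · exact .inl ⟨e, fun t' ht' => hnone t' fun hk => h₁ _ hk (code_lt_code.2 ht')⟩
    · obtain ⟨p, hp, he⟩ := (hkeys _).1 h₁
      rw [he, code_lt_code] at h₁'
      refine .inr ⟨p, h₁', he, hp, fun t' h3 h4 => hnone t' fun hk => ?_⟩
      have := h₁'' _ hk (code_lt_code.2 h3) (by rw [he, Ne, code_inj]; omega)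
      rw [he, code_lt_code] at this
      omega

/-! ### Prefix sums -/

/-- Go on from the node in register `14`, which is counted together with its left subtree if its key
is small. -/
def sumBody : Program :=
  .ite (.bin .add (.bin .lt (.reg 14) (.reg 13)) (.bin .eq (.reg 1) (.const 4)))
    (.seq (.set 26 (.bin .add (.bin .add (.reg 26) (cell 3 (cell 0 (.reg 14)))) (cell 4 (.reg 14))))
      (.set 14 (cell 1 (.reg 14))))
    (.set 14 (cell 0 (.reg 14)))

/-- Add up the values of the tree in register `10` at the times before the time in register `11`, or
at all times if register `1` contains the code `4`; the result is left in register `26`. -/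
def sumBefore : Program :=
  .seq (.seq (.set 13 (codeExpr (.reg 10) (.reg 11)))
    (.seq (.set 14 (cell 7 (.reg 10))) (.set 26 (.const 0))))
  (.while (.reg 14) sumBody)

/-- The keys of the tree are the codes of its times, so a sum over selected nodes becomes a sum over
times; absent times contribute the default value 0. -/
theorem sum_keys {T : Tree} {m : ℕ → ℕ} {G : ℕ → ℕ → Option ℕ} {i M : ℕ}
    (hs : T.keys.Pairwise (· < ·)) (hk : ∀ k, k ∈ T.keys ↔ ∃ t, G i t ≠ none ∧ k = code i t)
    (hv : ∀ i t v, G i t = some v → m (fld 4 (code i t)) = v) {p : ℕ → Bool}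
    (hp : ∀ t, G i t ≠ none → (p (code i t) = true ↔ t < M)) :
    ((T.keys.filter p).map fun k => m (fld 4 k)).sum =
      ∑ t ∈ Finset.range M, (G i t).getD 0 := by
  have hnd : (T.keys.filter p).Nodup := (hs.imp fun h => h.ne).filter p
  rw [← List.sum_toFinset _ hnd]
  have : (T.keys.filter p).toFinset =
      ((Finset.range M).filter fun t => G i t ≠ none).image (code i) := by
    ext k
    simp only [List.mem_toFinset, List.mem_filter, hk, Finset.mem_image, Finset.mem_filter,
      Finset.mem_range]
    constructor
    · rintro ⟨⟨t, ht, rfl⟩, h⟩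
      exact ⟨t, ⟨(hp t ht).1 h, ht⟩, rfl⟩
    · rintro ⟨t, ⟨h, ht⟩, rfl⟩
      exact ⟨⟨t, ht, rfl⟩, (hp t ht).2 h⟩
  rw [this, Finset.sum_image fun a _ b _ h => (code_inj.1 h).2, Finset.sum_filter]
  refine Finset.sum_congr rfl fun t _ => ?_
  cases h : G i t with
  | none => simp
  | some v => simp [hv i t v h]

/-- The hypothesis on `M` covers both kinds of queries: for a finite time the comparison of codes
decides, for the present every node is counted and `M` lies beyond all times. The invariant is that
register `26` plus the counted part of the remaining subtree is constant modulo `2 ^ w`. -/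
theorem sumBefore_spec {w : ℕ} {s : State} {G : ℕ → ℕ → Option ℕ} {i M : ℕ} {F : Finset ℕ}
    (h : Holds w s.mem G) (hi : s.reg 10 = i) (his : Small w i)
    (hF : ∀ t', G i t' ≠ none → t' ∈ F)
    (hM : ∀ t', G i t' ≠ none →
      (code i t' < (codeExpr (.reg 10) (.reg 11)).eval w s ∨ s.reg 1 = 4 ↔ t' < M)) :
    Runs w sumBefore s (500 * Nat.log 2 (F.card + 2)) fun s' =>
      s'.reg 26 = (∑ t ∈ Finset.range M, (G i t).getD 0) % 2 ^ w ∧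
      s'.mem = s.mem ∧ ∀ r, r ∉ sumBefore.writes → s'.reg r = s.reg r := by
  have h0 : Small w 0 := his.of_le (by omega)
  have hw := h0.lt
  obtain ⟨T, hT, hroot, havl, hsort, hkeys⟩ := h.tree i
  have hh := height_le_log_card havl hsort hkeys hF
  have hlog : 1 ≤ Nat.log 2 (F.card + 2) := Nat.log_pos (by norm_num) (by omega)
  set K := (codeExpr (.reg 10) (.reg 11)).eval w s with hK
  set c := s.reg 1 with hc
  set p : ℕ → Bool := fun k => decide (k < K ∨ c = 4) with hp
  set S : Tree → ℕ := fun x => ((x.keys.filter p).map fun k => s.mem (fld 4 k)).sum with hS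
  have hsum : S T = ∑ t ∈ Finset.range M, (G i t).getD 0 :=
    sum_keys hsort hkeys h.val fun t ht => by rw [hp, decide_eq_true_iff]; exact hM t ht
  set s₁ := ((s.setReg 13 K).setReg 14 T.root).setReg 26 0 with hs₁
  have eq₁ : (Program.seq (.set 13 (codeExpr (.reg 10) (.reg 11)))
      (.seq (.set 14 (cell 7 (.reg 10))) (.set 26 (.const 0)))).sem w s = s₁ := by
    rw [sem_seq, sem_set, ← hK, sem_seq, sem_set_cell (k := i) (by norm_num)
      (by simp [eval_reg, hi]) his, State.setReg_mem, hroot, sem_set, eval_const (by omega)]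
  have hb : (Program.seq (.set 13 (codeExpr (.reg 10) (.reg 11)))
      (.seq (.set 14 (cell 7 (.reg 10))) (.set 26 (.const 0)))).bound ≤ 50 := by decide
  have key := Runs.loop (w := w) (b := .reg 14) (p := sumBody) (K := 60)
    (α := Tree) (fun x => x.height)
    (fun x s' => s'.reg 14 = x.root ∧ s'.mem = s.mem ∧ s'.reg 13 = K ∧ s'.reg 1 = c ∧
      x.Repr w s.mem ∧ x.keys.Pairwise (· < ·) ∧ s'.reg 26 < 2 ^ w ∧
      (s'.reg 26 + S x) % 2 ^ w = S T % 2 ^ w)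
    ?_ T s₁ ⟨by simp [hs₁], rfl, by simp [hs₁], by simp [hs₁, hc], hT, hsort,
      by simp [hs₁], by simp [hs₁]⟩
  · refine ((Runs.straight_seq rfl (by rw [eq₁]; exact key)).mono ?_ fun _ h => h).frame.mono
      le_rfl ?_
    · simp only [Expr.cost]
      omega
    rintro s' ⟨⟨htest', x, u₁, u₂, u₃, u₄, u₅, u₆, u₇, u₈⟩, hreg, hmem⟩
    have : x = .nil := by
      cases x with
      | nil => rfl
      | node l k r => exact absurd (u₁.symm.trans htest') u₅.1
    subst this
    refine ⟨?_, hmem rfl, hreg⟩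
    rw [← hsum, ← u₈, Nat.mod_eq_of_lt] <;> simpa [hS, Tree.keys]
  · rintro x s₂ ⟨u₁, u₂, u₃, u₄, u₅, u₆, u₇, u₈⟩ hne
    rw [eval_reg, u₁] at hne
    cases x with
    | nil => exact absurd rfl hne
    | node l k r =>
    obtain ⟨v₁, v₂, v₃, v₄, v₅, v₆, v₇, v₈⟩ := u₅
    simp only [Tree.keys, List.pairwise_append, List.pairwise_cons, List.mem_cons] at u₆
    simp only [Tree.root] at u₁
    refine Runs.straight rfl (by decide) ?_
    have ht : (Expr.bin .add (.bin .lt (.reg 14) (.reg 13))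
        (.bin .eq (.reg 1) (.const 4))).eval w s₂ =
        (if k < K then 1 else 0) + if c = 4 then 1 else 0 := by
      have e₁ : (Expr.bin .lt (.reg 14) (.reg 13)).eval w s₂ = if k < K then 1 else 0 := by
        rw [eval_lt (by omega), eval_reg, eval_reg, u₁, u₃]
      have e₂ : (Expr.bin .eq (.reg 1) (.const 4)).eval w s₂ = if c = 4 then 1 else 0 := by
        rw [eval_eq (by omega), eval_reg, eval_const (by omega), u₄]
      rw [eval_add, e₁, e₂]
      rw [e₁, e₂]
      split_ifs <;> omega
    have hSn : S (.node l k r) = S l + (if p k then s.mem (fld 4 k) else 0) + S r := by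
      simp only [hS, Tree.keys, List.filter_append, List.filter_cons]
      split_ifs <;> simp [add_assoc]
    rw [sumBody, Program.sem, ht]
    by_cases hpk : k < K ∨ c = 4
    · rw [if_neg (by rcases hpk with h | h <;> simp [h])]
      -- If the key `k` is counted then so are all smaller ones, so the stored sum of the left
      -- subtree is used as a whole.
      have hSl : S l = (l.keys.map fun k => s.mem (fld 4 k)).sum := by
        simp only [hS]
        rw [List.filter_eq_self.2]
        intro x hx
        have := u₆.2.2 x hx k (by simp)
        simp only [hp, decide_eq_true_iff]
        rcases hpk with h | h
        · exact .inl (by omega)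
        · exact .inr h
      have e₀ : (cell 0 (.reg 14)).eval w s₂ = l.root := by
        rw [eval_cell (by rwa [eval_reg, u₁]) (by norm_num), eval_reg, u₁, u₂, v₃]
      have e₁ : (cell 3 (cell 0 (.reg 14))).eval w s₂ = S l % 2 ^ w := by
        rw [eval_cell (by rw [e₀]; exact v₇.small_root h0) (by norm_num), e₀, u₂,
          v₇.sum_eq h.nil, hSl]
      have e₂ : (cell 4 (.reg 14)).eval w s₂ = s.mem (fld 4 k) := by
        rw [eval_cell (by rwa [eval_reg, u₁]) (by norm_num), eval_reg, u₁, u₂]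
      have e₃ : (Expr.bin .add (.bin .add (.reg 26) (cell 3 (cell 0 (.reg 14))))
          (cell 4 (.reg 14))).eval w s₂ = (s₂.reg 26 + S l + s.mem (fld 4 k)) % 2 ^ w := by
        rw [Expr.eval, Expr.eval, e₁, e₂]
        simp [BinOp.eval, eval_reg]
      rw [sem_seq, sem_set w 26, e₃, sem_set_cell (k := k) (by norm_num)
        (by simp [eval_reg, u₁]) v₂, State.setReg_mem, u₂, v₄]
      refine ⟨r, by simp only [Tree.height]; omega, by simp, by simp [u₂], by simp [u₃],
        by simp [u₄], v₈, u₆.2.1.2, ?_, ?_⟩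
      · simp only [State.setReg_reg]
        norm_num
        exact Nat.mod_lt _ (by omega)
      · rw [← u₈, hSn, if_pos (by simpa [hp] using hpk)]
        simp [add_assoc]
    · rw [if_pos (by
        rw [not_or] at hpk
        rw [if_neg hpk.1, if_neg hpk.2]), sem_set_cell (k := k) (by norm_num)
        (by simp [eval_reg, u₁]) v₂, u₂, v₃]
      have hSr : S r = 0 := by
        simp only [hS]
        rw [List.filter_eq_nil_iff.2]
        · rfl
        intro x hx
        have := u₆.2.1.1 x hx
        simp only [hp, decide_eq_true_iff]
        rintro (h | h)
        · exact hpk (.inl (by omega))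
        · exact hpk (.inr h)
      refine ⟨l, by simp only [Tree.height]; omega, by simp, by simp [u₂], by simp [u₃],
        by simp [u₄], v₇, u₆.1, by simpa using u₇, ?_⟩
      rw [← u₈, hSn, if_neg (by simpa [hp] using hpk), hSr]
      simp

/-! ### The contents of the trees -/

theorem Edge.ext' {n : ℕ} {e e' : Edge n} (h₁ : (e.fst : ℕ) = e'.fst) (h₂ : (e.snd : ℕ) = e'.snd)
    (h₃ : e.weight = e'.weight) (h₄ : e.label = e'.label) : e = e' := by
  cases e; cases e'
  simp_all [Fin.ext_iff]

/-- The number of the tree of an edge. -/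
def Edge.tree {n : ℕ} (e : Edge n) : ℕ := 3 * code (code e.fst e.snd) (code e.weight e.label) + 2

/-- Numbers congruent to 2 modulo 3 are reserved for edges, which keeps these trees apart from the
trees `3 * v` and `3 * v + 1` of the vertices. -/
theorem Edge.tree_inj {n : ℕ} {e e' : Edge n} : e.tree = e'.tree ↔ e = e' := by
  refine ⟨fun h => ?_, by rintro rfl; rfl⟩
  have h' : code (code e.fst e.snd) (code e.weight e.label) =
      code (code e'.fst e'.snd) (code e'.weight e'.label) := by
    unfold Edge.tree at h; omega
  simp only [code_inj] at h'
  exact Edge.ext' h'.1.1 h'.1.2 h'.2.1 h'.2.2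

/-- `1` for an insertion, `0` for a deletion. -/
def Update.kind {n : ℕ} : Update n → ℕ
  | .insert _ => 1
  | .delete _ => 0

theorem Update.kind_lt {n : ℕ} (u : Update n) : u.kind < 2 := by cases u <;> simp [Update.kind]

/-- The edge `e` exists at time `t`, for updates given as a function of time. -/
def AliveAt {n : ℕ} (H : ℕ → Option (Update n)) (e : Edge n) : ℕ → Prop
  | 0 => False
  | t + 1 => (∃ u, H t = some u ∧ u.edge = e ∧ u.kind = 1) ∨
      ((∀ u, H t = some u → u.edge ≠ e) ∧ AliveAt H e t)

section
variable {n : ℕ} {H H' : ℕ → Option (Update n)} {e : Edge n} {u : Update n} {t p : ℕ}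

theorem aliveAt_succ_of_edge (h : H t = some u) (he : u.edge = e) :
    AliveAt H e (t + 1) ↔ u.kind = 1 := by
  simp only [AliveAt, h, Option.some.injEq]
  grind

theorem aliveAt_succ_of_ne (h : ∀ u, H t = some u → u.edge ≠ e) :
    AliveAt H e (t + 1) ↔ AliveAt H e t := by
  simp only [AliveAt]
  grind

theorem aliveAt_congr_from (hpt : p ≤ t) (hp : AliveAt H e p ↔ AliveAt H' e p)
    (h : ∀ τ, p ≤ τ → τ < t → ∀ u : Update n, u.edge = e → (H τ = some u ↔ H' τ = some u)) :
    AliveAt H e t ↔ AliveAt H' e t := by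
  induction t, hpt using Nat.le_induction with
  | base => exact hp
  | succ t hpt ih =>
    have ih := ih fun τ h₁ h₂ => h τ h₁ (by omega)
    have h' := h t hpt (by omega)
    simp only [AliveAt, ih]
    grind

theorem aliveAt_congr
    (h : ∀ τ < t, ∀ u : Update n, u.edge = e → (H τ = some u ↔ H' τ = some u)) :
    AliveAt H e t ↔ AliveAt H' e t :=
  aliveAt_congr_from (Nat.zero_le t) Iff.rfl fun τ _ => h τ

theorem aliveAt_const (hpt : p ≤ t)
    (h : ∀ τ, p ≤ τ → τ < t → ∀ u, H τ = some u → u.edge ≠ e) :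
    AliveAt H e t ↔ AliveAt H e p := by
  induction t, hpt using Nat.le_induction with
  | base => rfl
  | succ t hpt ih =>
    rw [aliveAt_succ_of_ne (h t hpt (by omega))]
    exact ih fun τ h₁ h₂ => h τ h₁ (by omega)

/-- This is how the data structure learns whether an edge exists: it looks up the kind of the
predecessor in the tree of the edge. -/
theorem aliveAt_of_last (hpt : p < t) (hp : H p = some u) (he : u.edge = e)
    (h : ∀ τ, p < τ → τ < t → ∀ u, H τ = some u → u.edge ≠ e) :
    AliveAt H e t ↔ u.kind = 1 := by
  rw [aliveAt_const (p := p + 1) hpt fun τ h₁ h₂ => h τ h₁ h₂, aliveAt_succ_of_edge hp he]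

theorem not_aliveAt (h : ∀ τ < t, ∀ u, H τ = some u → u.edge ≠ e) : ¬ AliveAt H e t := by
  rw [aliveAt_const (Nat.zero_le t) fun τ _ => h τ]
  exact id

open Classical in
/-- The value for the update `u` at time `t` in the tree `i`, where `a` says whether the edge exists
just before. -/
noncomputable def entry (u : Update n) (t : ℕ) (a : Prop) (i : ℕ) : Option ℕ :=
  if i = u.edge.tree then some (2 * t + u.kind)
  else if u.kind = 1 ∧ (i = 3 * u.edge.fst ∨ i = 3 * u.edge.snd) then some u.edge.weight
  else if a ∧ (i = 3 * u.edge.fst + 1 ∨ i = 3 * u.edge.snd + 1) then some u.edge.weight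
  else none

/-- The values in the trees: the tree `3 v` contains the insertions of edges at the vertex `v`, the
tree `3 v + 1` the updates of edges at `v` that exist just before, both with the weights; the tree
of an edge contains its updates. -/
noncomputable def content (H : ℕ → Option (Update n)) (i t : ℕ) : Option ℕ :=
  (H t).bind fun u => entry u t (AliveAt H u.edge t) i

theorem content_none (h : H t = none) (i : ℕ) : content H i t = none := by simp [content, h]

theorem content_tree (e : Edge n) (t : ℕ) :
    (content H e.tree t ≠ none ↔ ∃ u, H t = some u ∧ u.edge = e) ∧
      ∀ u, H t = some u → u.edge = e → content H e.tree t = some (2 * t + u.kind) := by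
  have h1 : ∀ u, H t = some u → u.edge = e → content H e.tree t = some (2 * t + u.kind) := by
    rintro u hu rfl
    simp [content, hu, entry]
  refine ⟨⟨fun h => ?_, ?_⟩, h1⟩
  · cases hu : H t with
    | none => exact absurd (content_none hu _) h
    | some u =>
      refine ⟨u, rfl, ?_⟩
      by_contra hne
      refine h ?_
      simp only [content, hu, Option.bind_some, entry]
      rw [if_neg (by rw [Edge.tree_inj]; exact fun h => hne h.symm), if_neg, if_neg]
      · rintro ⟨-, h | h⟩ <;> · unfold Edge.tree at h; omega
      · rintro ⟨-, h | h⟩ <;> · unfold Edge.tree at h; omega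
  · rintro ⟨u, hu, he⟩
    rw [h1 u hu he]
    simp

open Classical in
theorem content_add (v : Fin n) (h : H t = some u) :
    content H (3 * v) t = (if u.kind = 1 ∧ (v = u.edge.fst ∨ v = u.edge.snd) then
      some u.edge.weight else none) ∧
    content H (3 * v + 1) t = (if AliveAt H u.edge t ∧ (v = u.edge.fst ∨ v = u.edge.snd) then
      some u.edge.weight else none) := by
  have e₁ : (3 * (v : ℕ) = 3 * u.edge.fst ∨ 3 * (v : ℕ) = 3 * u.edge.snd) ↔
      (v = u.edge.fst ∨ v = u.edge.snd) := by
    simp only [Fin.ext_iff]; omega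
  have e₂ : (3 * (v : ℕ) + 1 = 3 * u.edge.fst + 1 ∨ 3 * (v : ℕ) + 1 = 3 * u.edge.snd + 1) ↔
      (v = u.edge.fst ∨ v = u.edge.snd) := by
    simp only [Fin.ext_iff]; omega
  simp only [content, h, Option.bind_some, entry]
  constructor
  · rw [if_neg (by unfold Edge.tree; omega)]
    simp only [e₁]
    split_ifs with h₁ h₂
    · rfl
    · omega
    · rfl
  · rw [if_neg (by unfold Edge.tree; omega), if_neg (by omega)]
    simp only [e₂]

open Classical in
/-- The weighted degree is the difference of the sums over the two trees of a vertex. -/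
theorem sum_content (U : Finset (Edge n)) (hU : ∀ t u, H t = some u → u.edge ∈ U) (v : Fin n)
    (M : ℕ) :
    ∑ t ∈ Finset.range M, (content H (3 * v) t).getD 0 =
      ∑ t ∈ Finset.range M, (content H (3 * v + 1) t).getD 0 +
        ∑ e ∈ U, if AliveAt H e M ∧ (v = e.fst ∨ v = e.snd) then e.weight else 0 := by
  induction M with
  | zero => simp [AliveAt]
  | succ t ih =>
    rw [Finset.sum_range_succ, Finset.sum_range_succ, ih]
    cases hu : H t with
    | none =>
      simp only [content_none hu, Option.getD_none, add_zero]
      congr 1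
      refine Finset.sum_congr rfl fun e _ => ?_
      rw [aliveAt_succ_of_ne (by simp [hu])]
    | some u =>
      have hmem := hU t u hu
      rw [(content_add v hu).1, (content_add v hu).2, ← Finset.add_sum_erase U _ hmem,
        ← Finset.add_sum_erase U (fun e => if AliveAt H e (t + 1) ∧ _ then e.weight else 0) hmem]
      have hrest : ∑ e ∈ U.erase u.edge,
          (if AliveAt H e (t + 1) ∧ (v = e.fst ∨ v = e.snd) then e.weight else 0) =
          ∑ e ∈ U.erase u.edge,
          (if AliveAt H e t ∧ (v = e.fst ∨ v = e.snd) then e.weight else 0) := by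
        refine Finset.sum_congr rfl fun e he => ?_
        rw [aliveAt_succ_of_ne]
        intro u' hu'
        rw [hu] at hu'
        cases hu'
        exact (Finset.ne_of_mem_erase he).symm
      -- The sums telescope. The update at `t` adds the weight once if it is an insertion and
      -- subtracts it once if the edge existed before, which is exactly the change in the
      -- contribution of its own edge.
      rw [hrest, aliveAt_succ_of_edge hu rfl]
      by_cases h₁ : v = u.edge.fst ∨ v = u.edge.snd <;> by_cases h₂ : u.kind = 1 <;>
        by_cases h₃ : AliveAt H u.edge t <;> simp [h₁, h₂, h₃] <;> omega

/-- The function `H` lists the updates in `S`. -/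
def Lists (H : ℕ → Option (Update n)) (S : History n) : Prop := ∀ t u, H t = some u ↔ (t, u) ∈ S

/-- A lifespan is open on the left and closed on the right, so only updates strictly before `t`
matter: an insertion is needed that no deletion follows before `t`. Going back over the times, the
last update of `e` decides, which is the recursion of `AliveAt`. -/
theorem Lists.alive {S : History n} (h : Lists H S) (e : Edge n) (t : ℕ) :
    S.Alive (t : WithTop ℕ) e ↔ AliveAt H e t := by
  have key : ∀ t : ℕ, S.Alive (t : WithTop ℕ) e ↔ ∃ a < t, H a = some (.insert e) ∧
      ∀ d, a < d → d < t → H d ≠ some (.delete e) := by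
    intro t
    simp only [History.Alive, History.InLifespan, ← h _ _, Nat.cast_lt, Nat.cast_le]
    constructor
    · rintro ⟨a, h₁, h₂, h₃⟩
      exact ⟨a, h₂, h₁, fun d h₄ h₅ h₆ => absurd (h₃ d h₄ h₆) (by omega)⟩
    · rintro ⟨a, h₁, h₂, h₃⟩
      exact ⟨a, h₂, h₁, fun d h₄ h₅ => not_lt.1 fun h₆ => h₃ d h₄ h₆ h₅⟩
  rw [key]
  induction t with
  | zero => simp [AliveAt]
  | succ t ih =>
    simp only [AliveAt, ← ih]
    constructor
    · rintro ⟨a, h₁, h₂, h₃⟩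
      rcases Nat.lt_succ_iff_lt_or_eq.1 h₁ with h₁ | rfl
      · by_cases hu : ∃ u, H t = some u ∧ u.edge = e
        · obtain ⟨u, hu, rfl⟩ := hu
          left
          refine ⟨u, hu, rfl, ?_⟩
          cases u with
          | insert e => rfl
          | delete e => exact absurd hu (h₃ t h₁ (by omega))
        · exact .inr ⟨fun u h₄ h₅ => hu ⟨u, h₄, h₅⟩, a, h₁, h₂, fun d h₄ h₅ => h₃ d h₄ (by omega)⟩
      · exact .inl ⟨_, h₂, rfl, rfl⟩
    · rintro (⟨u, hu, rfl, hk⟩ | ⟨hu, a, h₁, h₂, h₃⟩)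
      · cases u with
        | insert e => exact ⟨t, by omega, hu, fun d h₄ h₅ => by omega⟩
        | delete e => simp [Update.kind] at hk
      · refine ⟨a, by omega, h₂, fun d h₄ h₅ h₆ => ?_⟩
        rcases Nat.lt_succ_iff_lt_or_eq.1 h₅ with h₅ | rfl
        · exact h₃ d h₄ h₅ h₆
        · exact hu _ h₆ rfl

/-- The present looks like any time beyond all updates. -/
theorem Lists.alive_top {S : History n} (h : Lists H S) (e : Edge n) {M : ℕ}
    (hM : ∀ x ∈ S, x.1 < M) : S.Alive ⊤ e ↔ AliveAt H e M := by
  rw [← h.alive]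
  simp only [History.Alive, History.InLifespan, Nat.cast_lt, Nat.cast_le, top_le_iff,
    WithTop.natCast_ne_top, imp_false]
  constructor
  · rintro ⟨a, h₁, -, h₃⟩
    exact ⟨a, h₁, hM _ h₁, fun d h₄ h₅ => absurd h₅ (h₃ d h₄)⟩
  · rintro ⟨a, h₁, -, h₃⟩
    refine ⟨a, h₁, WithTop.coe_lt_top a, fun d h₄ h₅ => ?_⟩
    have := h₃ d h₄ h₅
    have := hM _ h₅
    simp only at this
    omega

/-- The degree at the time that corresponds to `M`. -/
theorem Lists.degree {S : History n} (h : Lists H S) {τ : WithTop ℕ} {M : ℕ}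
    (hM : ∀ e, S.Alive τ e ↔ AliveAt H e M) (v : Fin n) :
    S.degree τ v = ∑ t ∈ Finset.range M, (content H (3 * v) t).getD 0 -
      ∑ t ∈ Finset.range M, (content H (3 * v + 1) t).getD 0 := by
  classical
  rw [sum_content (S.image fun x => x.2.edge) (fun t u hu =>
    Finset.mem_image.2 ⟨(t, u), (h t u).1 hu, rfl⟩) v M, Nat.add_sub_cancel_left,
    History.degree, History.edgesAt, Finset.filter_filter, Finset.sum_filter]
  refine Finset.sum_congr (by congr) fun e _ => ?_
  rw [hM]

/-! ### The change of the contents by an update -/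

/-- Change the tree number `c` of both endpoints of `e` at time `t`. -/
def flip2 (G : ℕ → ℕ → Option ℕ) (e : Edge n) (c t : ℕ) : ℕ → ℕ → Option ℕ :=
  flip (flip G (3 * e.fst + c) t e.weight) (3 * e.snd + c) t e.weight

/-- The endpoints of an edge are distinct, so the second flip does not undo the first. -/
theorem flip2_apply (G : ℕ → ℕ → Option ℕ) (e : Edge n) (c t i τ : ℕ) :
    flip2 G e c t i τ = if (i = 3 * e.fst + c ∨ i = 3 * e.snd + c) ∧ τ = t then
      (if G i t = none then some e.weight else none) else G i τ := by
  have := e.fst_lt_snd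
  rw [Fin.lt_def] at this
  simp only [flip2, flip]
  grind

open Classical in
/-- The change of the contents when an update `u` at time `t` is created or cancelled, where `q` is
the time of the next update of the edge if there is one. -/
noncomputable def change (G : ℕ → ℕ → Option ℕ) (u : Update n) (t : ℕ) (a : Prop)
    (q : Option ℕ) : ℕ → ℕ → Option ℕ :=
  let G₁ := flip G u.edge.tree t (2 * t + u.kind)
  let G₂ := if u.kind = 1 then flip2 G₁ u.edge 0 t else G₁
  let G₃ := if a then flip2 G₂ u.edge 1 t else G₂
  match q with
  | none => G₃
  | some q => if (a ↔ u.kind = 1) then G₃ else flip2 G₃ u.edge 1 q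

/-- `q` is the time of the first update of `e` after `t`. -/
def IsNext (H : ℕ → Option (Update n)) (e : Edge n) (t : ℕ) : Option ℕ → Prop
  | none => ∀ τ, t < τ → ∀ u, H τ = some u → u.edge ≠ e
  | some q => t < q ∧ (∃ u, H q = some u ∧ u.edge = e) ∧
      ∀ τ, t < τ → τ < q → ∀ u, H τ = some u → u.edge ≠ e

-- All the flips hit different places: the three families of trees are separated modulo 3, and the
-- trees `3 * v + 1` are flipped at the two distinct times `t` and `q`.
open Classical in
theorem change_apply {G : ℕ → ℕ → Option ℕ} {a : Prop} {q : Option ℕ} (hq : q ≠ some t)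
    (i τ : ℕ) : change G u t a q i τ =
      if τ = t ∧ i = u.edge.tree then (if G i τ = none then some (2 * t + u.kind) else none)
      else if (τ = t ∧ u.kind = 1 ∧ (i = 3 * u.edge.fst ∨ i = 3 * u.edge.snd)) ∨
          (τ = t ∧ a ∧ (i = 3 * u.edge.fst + 1 ∨ i = 3 * u.edge.snd + 1)) ∨
          (q = some τ ∧ ¬ (a ↔ u.kind = 1) ∧ (i = 3 * u.edge.fst + 1 ∨ i = 3 * u.edge.snd + 1)) then
        (if G i τ = none then some u.edge.weight else none)
      else G i τ := by
  have htree : ∃ k, u.edge.tree = 3 * k + 2 := ⟨_, rfl⟩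
  have hne : (u.edge.fst : ℕ) ≠ u.edge.snd := by
    have := u.edge.fst_lt_snd
    rw [Fin.lt_def] at this
    omega
  unfold change
  generalize u.edge.tree = T at *
  obtain ⟨k, rfl⟩ := htree
  cases q with
  | none =>
    by_cases ha : a <;> by_cases hk : u.kind = 1 <;>
      simp only [ha, hk, if_true, if_false, iff_self, iff_true, iff_false, not_true, not_false_iff] <;>
      simp only [flip2_apply, flip] <;> grind
  | some q =>
    by_cases ha : a <;> by_cases hk : u.kind = 1 <;>
      simp only [ha, hk, if_true, if_false, iff_self, iff_true, iff_false, not_true, not_false_iff] <;>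
      simp only [flip2_apply, flip] <;> grind

/-- The combinatorial heart. The update `u` influences the existence of its own edge only, and only
up to the next update `q` of this edge, which overrides it. Apart from the entries at `t`, just the
presence of `q` in the trees `3 * v + 1` can change, and it does so exactly when `u` changes the
existence of the edge. Since entries are toggled, the same change leads from `H'` back to `H`. -/
theorem content_change {q : Option ℕ} (h₀ : H t = none) (h₁ : H' t = some u)
    (hne : ∀ τ, τ ≠ t → H' τ = H τ) (hq : IsNext H u.edge t q) :
    content H' = change (content H) u t (AliveAt H u.edge t) q ∧
      content H = change (content H') u t (AliveAt H u.edge t) q := by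
  have hqt : q ≠ some t := by rintro rfl; exact lt_irrefl t hq.1
  have hat : AliveAt H' u.edge t ↔ AliveAt H u.edge t :=
    aliveAt_congr fun τ hτ u' _ => by rw [hne τ hτ.ne]
  -- Every update other than `u` and `q` finds its edge in the same state: another edge is not
  -- affected, and after `q` the influence of `u` is over.
  have hrest : ∀ τ u', τ ≠ t → H τ = some u' → q ≠ some τ ∨ u'.edge ≠ u.edge →
      (AliveAt H' u'.edge τ ↔ AliveAt H u'.edge τ) := by
    intro τ u' hτ hu' h
    by_cases he : u'.edge = u.edge
    · rcases Nat.lt_or_ge τ t with hlt | hge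
      · exact aliveAt_congr fun σ hσ u'' _ => by rw [hne σ (by omega)]
      · cases q with
        | none => exact absurd he (hq τ (by omega) u' hu')
        | some q =>
          obtain ⟨hq₁, ⟨u'', hu'', he''⟩, hq₂⟩ := hq
          have hqτ : q < τ := by
            rcases Nat.lt_trichotomy q τ with h' | rfl | h'
            · exact h'
            · exact absurd he (h.resolve_left fun h => h rfl)
            · exact absurd he (hq₂ τ (by omega) h' u' hu')
          refine aliveAt_congr_from (p := q + 1) hqτ ?_ fun σ h₁ h₂ u'' _ => by
            rw [hne σ (by omega)]
          rw [he, aliveAt_succ_of_edge hu'' he'', aliveAt_succ_of_edge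
            (by rw [hne q (by omega)]; exact hu'') he'']
    · refine aliveAt_congr fun σ _ u'' he'' => ?_
      by_cases hσ : σ = t
      · subst hσ
        rw [h₀, h₁]
        simp only [Option.some.injEq, reduceCtorEq, iff_false]
        rintro rfl
        exact he he''.symm
      · rw [hne σ hσ]
  -- Just before `q`, the state of the edge is the one before `t` if `u` is absent, and is decided
  -- by the kind of `u` if it is present.
  have hnext : ∀ τ, q = some τ → ∃ u', H τ = some u' ∧ u'.edge = u.edge ∧
      (AliveAt H u.edge τ ↔ AliveAt H u.edge t) ∧ (AliveAt H' u.edge τ ↔ u.kind = 1) := by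
    rintro τ rfl
    obtain ⟨hq₁, ⟨u', hu', he'⟩, hq₂⟩ := hq
    refine ⟨u', hu', he', aliveAt_const hq₁.le fun σ h₂ h₃ u'' hu'' => ?_,
      aliveAt_of_last hq₁ h₁ rfl fun σ h₂ h₃ u'' hu'' => ?_⟩
    · rcases h₂.eq_or_lt with rfl | h₂
      · simp [h₀] at hu''
      · exact hq₂ σ h₂ h₃ u'' hu''
    · rw [hne σ (by omega)] at hu''
      exact hq₂ σ h₂ h₃ u'' hu''
  generalize AliveAt H u.edge t = a at *
  have htr : ∃ k, u.edge.tree = 3 * k + 2 := ⟨_, rfl⟩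
  obtain ⟨k, hk⟩ := htr
  constructor <;> funext i τ <;> rw [change_apply hqt]
  · by_cases hτ : τ = t
    · subst hτ
      simp only [content, h₀, h₁, Option.bind_some, Option.bind_none, hat, entry]
      grind
    · by_cases hqτ : q = some τ
      · obtain ⟨u', v₁, v₂, v₃, v₄⟩ := hnext τ hqτ
        simp only [content, hne τ hτ, v₁, Option.bind_some, entry]
        rw [v₂, v₃, v₄]
        clear hnext hrest hat hq hne v₃ v₄ v₂
        by_cases ha : a <;> by_cases hk' : u.kind = 1 <;> simp only [ha, hk', hτ, hqτ] <;> grind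
      · rw [if_neg (by tauto), if_neg (by tauto)]
        cases hu : H τ with
        | none => simp [content, hne τ hτ, hu]
        | some u' =>
          simp only [content, hne τ hτ, hu, Option.bind_some, hrest τ u' hτ hu (.inl hqτ)]
  · by_cases hτ : τ = t
    · subst hτ
      simp only [content, h₀, h₁, Option.bind_some, Option.bind_none, hat, entry]
      grind
    · by_cases hqτ : q = some τ
      · obtain ⟨u', v₁, v₂, v₃, v₄⟩ := hnext τ hqτ
        simp only [content, hne τ hτ, v₁, Option.bind_some, entry]
        rw [v₂, v₃, v₄]
        clear hnext hrest hat hq hne v₃ v₄ v₂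
        by_cases ha : a <;> by_cases hk' : u.kind = 1 <;> simp only [ha, hk', hτ, hqτ] <;> grind
      · rw [if_neg (by tauto), if_neg (by tauto)]
        cases hu : H τ with
        | none => simp [content, hne τ hτ, hu]
        | some u' =>
          simp only [content, hne τ hτ, hu, Option.bind_some, hrest τ u' hτ hu (.inl hqτ)]

end

/-! ### Operations -/

/-- The value is at most `4 * A ^ (2 * k) + A ^ k + 1`, hence at most `8 * A ^ (2 * k)`, and `8 ≤ A
^ 3`. -/
theorem code_le {A k x y : ℕ} (hA : 2 ≤ A) (hx : x ≤ A ^ k) (hy : y ≤ A ^ k) :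
    code x y ≤ A ^ (2 * k + 3) := by
  have h1 : 1 ≤ A ^ k := Nat.one_le_pow _ _ (by omega)
  have h2 : (x + y) * (x + y) ≤ (2 * A ^ k) * (2 * A ^ k) := Nat.mul_le_mul (by omega) (by omega)
  have h3 : 2 ^ 3 ≤ A ^ 3 := Nat.pow_le_pow_left hA 3
  have h4 : A ^ (2 * k + 3) = A ^ k * A ^ k * A ^ 3 := by ring
  have h5 : A ^ k * 1 ≤ A ^ k * A ^ k := Nat.mul_le_mul_left _ h1
  have h6 : A ^ k * A ^ k * 2 ^ 3 ≤ A ^ k * A ^ k * A ^ 3 := Nat.mul_le_mul_left _ h3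
  rw [h4]
  unfold code
  nlinarith

/-- The word size is large enough for numbers up to `B`. -/
def Large (B w : ℕ) : Prop := (B + 2) ^ 40 ≤ 2 ^ w

/-- By `code_le` the exponent 16 becomes 35; the remaining factor `(B + 2) ^ 5 ≥ 32` makes room for
the 16 cells of a record. This is the origin of the exponent 40. -/
theorem Large.small_code {B w i t : ℕ} (h : Large B w) (hi : i ≤ (B + 2) ^ 16)
    (ht : t ≤ (B + 2) ^ 16) : Small w (code i t) := by
  have h1 := code_le (A := B + 2) (by omega) hi ht
  have h2 : 2 ^ 5 ≤ (B + 2) ^ 5 := Nat.pow_le_pow_left (by omega) 5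
  have h3 : (B + 2) ^ 40 = (B + 2) ^ 35 * (B + 2) ^ 5 := by ring
  have h4 : 1 ≤ (B + 2) ^ 35 := Nat.one_le_pow _ _ (by omega)
  have h5 : (B + 2) ^ 35 * 2 ^ 5 ≤ (B + 2) ^ 35 * (B + 2) ^ 5 := Nat.mul_le_mul_left _ h2
  unfold Large at h
  unfold Small
  norm_num at h1
  omega

theorem Large.small {B w i : ℕ} (h : Large B w) (hi : i ≤ (B + 2) ^ 16) : Small w i := by
  refine (h.small_code hi (Nat.zero_le _) : Small w (code i 0)).of_le ?_
  unfold code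
  nlinarith

theorem le_pow16 {B x : ℕ} (hx : x ≤ 4 * (B + 2)) : x ≤ (B + 2) ^ 16 := by
  have h2 : 2 ^ 2 ≤ (B + 2) ^ 2 := Nat.pow_le_pow_left (by omega) 2
  have h3 : (B + 2) ^ 3 ≤ (B + 2) ^ 16 := Nat.pow_le_pow_right (by omega) (by norm_num)
  have h4 : (B + 2) ^ 3 = (B + 2) ^ 2 * (B + 2) := by ring
  nlinarith

section
variable {n : ℕ}

/-- The numbers of the update are at most `B`. -/
def Update.Le (B : ℕ) (u : Update n) : Prop := u.edge.weight ≤ B ∧ u.edge.label ≤ B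

/-- The exponents come from iterating `k ↦ 2 * k + 3`, which takes 1 to 5 and 5 to 13; the factor 3
and the summand 2 of the tree number cost three more. -/
theorem tree_le {B : ℕ} (hn : n ≤ B) {u : Update n} (hu : u.Le B) :
    code u.edge.fst u.edge.snd ≤ (B + 2) ^ 5 ∧ code u.edge.weight u.edge.label ≤ (B + 2) ^ 5 ∧
      code (code u.edge.fst u.edge.snd) (code u.edge.weight u.edge.label) ≤ (B + 2) ^ 13 ∧
      u.edge.tree ≤ (B + 2) ^ 16 := by
  have h1 := u.edge.fst.isLt
  have h2 := u.edge.snd.isLt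
  have h3 : code u.edge.fst u.edge.snd ≤ (B + 2) ^ 5 :=
    code_le (k := 1) (by omega) (by rw [pow_one]; omega) (by rw [pow_one]; omega)
  have h4 : code u.edge.weight u.edge.label ≤ (B + 2) ^ 5 := by
    have := hu.1
    have := hu.2
    exact code_le (k := 1) (by omega) (by rw [pow_one]; omega) (by rw [pow_one]; omega)
  have h5 := code_le (A := B + 2) (by omega) h3 h4
  norm_num at h5
  have h6 : 2 ^ 3 ≤ (B + 2) ^ 3 := Nat.pow_le_pow_left (by omega) 3
  have h7 : 1 ≤ (B + 2) ^ 13 := Nat.one_le_pow _ _ (by omega)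
  have h8 : (B + 2) ^ 16 = (B + 2) ^ 13 * (B + 2) ^ 3 := by ring
  have h9 : (B + 2) ^ 13 * 2 ^ 3 ≤ (B + 2) ^ 13 * (B + 2) ^ 3 := Nat.mul_le_mul_left _ h6
  refine ⟨h3, h4, h5, ?_⟩
  unfold Edge.tree
  omega

/-- Prepare the arguments of `toggle` for the tree number `c` of the vertex in register `v` and the
time in register `t`. -/
def vertexArgs (c v t : ℕ) : Program :=
  .seq (.set 10 (.bin .add (.bin .mul (.const 3) (.reg v)) (.const c)))
    (.seq (.set 11 (.reg t)) (.set 12 (.reg 5)))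

/-- Change the tree number `c` of both endpoints at the time in register `t`. -/
def toggleBoth (c t : ℕ) : Program :=
  .seq (vertexArgs c 3 t) (.seq toggle (.seq (vertexArgs c 4 t) toggle))

theorem vertexArgs_sem {w c v t x τ y : ℕ} {s : State} (hw : 3 * x + c + 3 < 2 ^ w)
    (hv : s.reg v = x) (ht : s.reg t = τ) (h5 : s.reg 5 = y) (ht' : t ≠ 10 ∧ t ≠ 11) :
    (vertexArgs c v t).sem w s = ((s.setReg 10 (3 * x + c)).setReg 11 τ).setReg 12 y := by
  have e₁ : (Expr.bin .mul (.const 3) (.reg v)).eval w s = 3 * x := by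
    rw [eval_mul, eval_const (by omega), eval_reg, hv]
    rw [eval_const (by omega), eval_reg, hv]; omega
  have e₂ : (Expr.const c).eval w s = c := eval_const (by omega)
  rw [vertexArgs, sem_seq, sem_set, eval_add (by rw [e₁, e₂]; omega), e₁, e₂, sem_seq, sem_set,
    sem_set, eval_reg, eval_reg]
  simp [ht, ht'.1, h5]

theorem toggleBoth_spec {B w c t τ : ℕ} {s : State} {G : ℕ → ℕ → Option ℕ} {e : Edge n}
    {F : Finset ℕ} (hB : Large B w) (hn : n ≤ B) (hc : c ≤ 1)
    (ht : t ≠ 10 ∧ t ≠ 11 ∧ t ≠ 12 ∧ t ∉ toggle.writes) (h : Holds w s.mem G)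
    (h3 : s.reg 3 = e.fst) (h4 : s.reg 4 = e.snd) (h5 : s.reg 5 = e.weight) (hwt : e.weight ≤ B)
    (hτ : s.reg t = τ) (hτB : τ ≤ B) (hF : ∀ i t', G i t' ≠ none → t' ∈ F) (hτF : τ ∈ F) :
    Runs w (toggleBoth c t) s (20100 * Nat.log 2 (F.card + 2)) fun s' =>
      Holds w s'.mem (flip2 G e c τ) ∧ (∀ i t', flip2 G e c τ i t' ≠ none → t' ∈ F) ∧
      (∀ f z, 8 ≤ f → f < 16 → s'.mem (fld f z) = s.mem (fld f z)) ∧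
      ∀ r, r ∉ [10, 11, 12] ++ toggle.writes → s'.reg r = s.reg r := by
  have hlog : 1 ≤ Nat.log 2 (F.card + 2) := Nat.log_pos (by norm_num) (by omega)
  have h1 := e.fst.isLt
  have h2 := e.snd.isLt
  have hB4 := (hB.small (le_pow16 (B := B) (x := 4 * (B + 2)) le_rfl)).lt
  have hflip : ∀ G : ℕ → ℕ → Option ℕ, (∀ i t', G i t' ≠ none → t' ∈ F) → ∀ i v i' t',
      flip G i τ v i' t' ≠ none → t' ∈ F := by
    intro G hG i v i' t' h
    by_cases ht : t' = τ
    · exact ht ▸ hτF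
    · refine hG i' t' ?_
      simpa [flip, ht] using h
  have hb : ∀ v, (vertexArgs c v t).bound ≤ 15 := fun v => by simp [vertexArgs, Program.bound, Expr.cost]
  have hid : ∀ v < n, 3 * v + c ≤ (B + 2) ^ 16 := fun v hv => le_pow16 (by omega)
  have hτ16 : τ ≤ (B + 2) ^ 16 := le_pow16 (by omega)
  refine (Runs.straight_seq (by simp [vertexArgs, Program.straight])
    (L := 20050 * Nat.log 2 (F.card + 2)) ?_).mono (by have := hb 3; omega) fun _ h => h
  rw [vertexArgs_sem (by omega) h3 hτ h5 ⟨ht.1, ht.2.1⟩]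
  refine (Runs.seq (toggle_spec (i := 3 * e.fst + c) (t := τ) (v := e.weight) (F := F) (by simpa using h)
    (by simp) (by simp) (by simp) (by omega) (hB.small (hid _ h1))
    (hB.small_code (hid _ h1) hτ16) (hF _)) (L := 10020 * Nat.log 2 (F.card + 2)) ?_).mono
    (by omega) fun _ h => h
  rintro s₁ ⟨u₁, u₂, u₃⟩
  refine (Runs.straight_seq (by simp [vertexArgs, Program.straight])
    (L := 10000 * Nat.log 2 (F.card + 2)) ?_).mono (by have := hb 4; omega) fun _ h => h
  rw [vertexArgs_sem (x := e.snd) (τ := τ) (y := e.weight) (by omega)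
    (by rw [u₃ 4 (by decide)]; simp [h4])
    (by rw [u₃ t ht.2.2.2]; simp [ht.1, ht.2.1, ht.2.2.1, hτ])
    (by rw [u₃ 5 (by decide)]; simp [h5]) ⟨ht.1, ht.2.1⟩]
  refine (toggle_spec (i := 3 * e.snd + c) (t := τ) (v := e.weight) (F := F) (by simpa using u₁)
    (by simp) (by simp) (by simp) (by omega) (hB.small (hid _ h2))
    (hB.small_code (hid _ h2) hτ16) (hflip _ hF _ _ _)).mono le_rfl ?_
  rintro s₂ ⟨v₁, v₂, v₃⟩
  refine ⟨v₁, hflip _ (hflip _ hF _ _) _ _, fun f z hf hf' => ?_, fun r hr => ?_⟩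
  · rw [v₂ f z hf hf']
    simp only [State.setReg_mem]
    rw [u₂ f z hf hf']
    rfl
  · simp only [List.mem_append, List.mem_cons, not_or] at hr
    rw [v₃ r hr.2]
    simp only [State.setReg_reg, hr, if_false]
    rw [u₃ r hr.2]
    simp only [State.setReg_reg, hr, if_false]

/-- Decide which trees are to be changed: register `20` tells whether the edge exists just before
the update, and register `21` whether its next update, at the time in register `22`, is affected. -/
def decideChanges : Program :=
  .seq (.set 20 (.bin .sub (cell 4 (.reg 23))
    (.bin .mul (.const 2) (.bin .div (cell 4 (.reg 23)) (.const 2)))))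
  (.seq (.set 22 (.bin .div (cell 4 (.reg 24)) (.const 2)))
  (.set 21 (.bin .mul (.bin .lt (.const 0) (.reg 24))
    (.bin .add (.bin .lt (.reg 20) (.reg 7)) (.bin .lt (.reg 7) (.reg 20))))))

/-- Values in the tree of an edge are twice the time plus the kind: the parity of the predecessor's
value tells whether the edge exists, and half the successor's value is the time of the next update.
-/
theorem decideChanges_sem {w k x y p q : ℕ} {s : State} (h0 : Small w 0) (h7 : s.reg 7 = k)
    (h23 : s.reg 23 = p) (h24 : s.reg 24 = q) (hp : Small w p) (hq : Small w q)
    (hx : s.mem (fld 4 p) = x) (hy : s.mem (fld 4 q) = y) (hxw : x < 2 ^ w) (hyw : y < 2 ^ w) :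
    decideChanges.sem w s = ((s.setReg 20 (x % 2)).setReg 22 (y / 2)).setReg 21
      (if q ≠ 0 ∧ x % 2 ≠ k then 1 else 0) := by
  have hw := h0.lt
  have c1 : (cell 4 (.reg 23)).eval w s = x := by
    rw [eval_cell (by rwa [eval_reg, h23]) (by norm_num), eval_reg, h23, hx]
  have c2 : (Expr.const 2).eval w s = 2 := eval_const (by omega)
  have c3 : (Expr.bin .div (cell 4 (.reg 23)) (.const 2)).eval w s = x / 2 := by
    rw [eval_div (by rwa [c1]), c1, c2]
  have c4 : (Expr.bin .mul (.const 2) (.bin .div (cell 4 (.reg 23)) (.const 2))).eval w s =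
      2 * (x / 2) := by
    rw [eval_mul (by rw [c2, c3]; omega), c2, c3]
  have c5 : (Expr.bin .sub (cell 4 (.reg 23))
    (.bin .mul (.const 2) (.bin .div (cell 4 (.reg 23)) (.const 2)))).eval w s = x % 2 := by
    rw [eval_sub (by rwa [c1]), c1, c4]; omega
  set s₁ := s.setReg 20 (x % 2) with hs₁
  have d1 : (cell 4 (.reg 24)).eval w s₁ = y := by
    rw [eval_cell (by simpa [eval_reg, hs₁, h24] using hq) (by norm_num)]
    simp [eval_reg, hs₁, h24, hy]
  have d2 : (Expr.bin .div (cell 4 (.reg 24)) (.const 2)).eval w s₁ = y / 2 := by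
    rw [eval_div (by rwa [d1]), d1, eval_const (by omega)]
  set s₂ := s₁.setReg 22 (y / 2) with hs₂
  have e1 : (Expr.bin .lt (.const 0) (.reg 24)).eval w s₂ = if 0 < q then 1 else 0 := by
    rw [eval_lt (by omega), eval_const (by omega)]
    simp [eval_reg, hs₂, hs₁, h24]
  have e2 : (Expr.bin .lt (.reg 20) (.reg 7)).eval w s₂ = if x % 2 < k then 1 else 0 := by
    rw [eval_lt (by omega)]
    simp [eval_reg, hs₂, hs₁, h7]
  have e3 : (Expr.bin .lt (.reg 7) (.reg 20)).eval w s₂ = if k < x % 2 then 1 else 0 := by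
    rw [eval_lt (by omega)]
    simp [eval_reg, hs₂, hs₁, h7]
  have e4 : (Expr.bin .add (.bin .lt (.reg 20) (.reg 7)) (.bin .lt (.reg 7) (.reg 20))).eval w s₂ =
      if x % 2 ≠ k then 1 else 0 := by
    rw [eval_add, e2, e3]
    · split_ifs <;> omega
    · rw [e2, e3]; split_ifs <;> omega
  have e5 : (Expr.bin .mul (.bin .lt (.const 0) (.reg 24)) (.bin .add (.bin .lt (.reg 20) (.reg 7))
      (.bin .lt (.reg 7) (.reg 20)))).eval w s₂ = if q ≠ 0 ∧ x % 2 ≠ k then 1 else 0 := by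
    rw [eval_mul, e1, e4]
    · split_ifs <;> omega
    · rw [e1, e4]; split_ifs <;> omega
  rw [decideChanges, sem_seq, sem_set w 20, c5, ← hs₁, sem_seq, sem_set w 22, d2, ← hs₂,
    sem_set w 21, e5]

/-- Create or cancel the update at the time in register `2`, whose edge is in the registers `3` to
`6` and whose kind is in register `7`. -/
def update : Program :=
  .seq search (.seq decideChanges (.seq toggle
  (.seq (.ite (.reg 7) (toggleBoth 0 2) .skip)
  (.seq (.ite (.reg 20) (toggleBoth 1 2) .skip)
  (.ite (.reg 21) (toggleBoth 1 22) .skip)))))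

-- One search and at most seven toggles: one in the tree of the edge, and three times the two
-- endpoints. The set `F` contains the used times and `t`, so it bounds the trees at all
-- intermediate stages as well.
set_option maxHeartbeats 400000 in
theorem update_spec {B w t : ℕ} {s : State} {H : ℕ → Option (Update n)} {u : Update n}
    {F : Finset ℕ} (hB : Large B w) (hn : n ≤ B) (h : Holds w s.mem (content H))
    (hH : ∀ t u, H t = some u → t ≤ B) (htB : t ≤ B)
    (hu : u.Le B) (hF : ∀ t', H t' ≠ none → t' ∈ F) (htF : t ∈ F)
    (h2 : s.reg 2 = t) (h3 : s.reg 3 = u.edge.fst) (h4 : s.reg 4 = u.edge.snd)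
    (h5 : s.reg 5 = u.edge.weight) (h7 : s.reg 7 = u.kind) (h10 : s.reg 10 = u.edge.tree)
    (h11 : s.reg 11 = t) (h12 : s.reg 12 = 2 * t + u.kind) :
    Runs w update s (100000 * Nat.log 2 (F.card + 2)) fun s' => ∃ q, IsNext H u.edge t q ∧
      Holds w s'.mem (change (content H) u t (AliveAt H u.edge t) q) ∧
      ∀ f z, 8 ≤ f → f < 16 → s'.mem (fld f z) = s.mem (fld f z) := by
  classical
  have hlog : 1 ≤ Nat.log 2 (F.card + 2) := Nat.log_pos (by norm_num) (by omega)
  have hB4 := (hB.small (le_pow16 (B := B) (x := 4 * (B + 2)) le_rfl)).lt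
  have h0 : Small w 0 := hB.small (Nat.zero_le _)
  have ht16 : ∀ t ≤ B, t ≤ (B + 2) ^ 16 := fun t ht => le_pow16 (by omega)
  have htree := (tree_le hn hu).2.2.2
  have hts := hB.small htree
  have hcF : ∀ i t', content H i t' ≠ none → t' ∈ F := fun i t' h' =>
    hF t' fun hn => h' (content_none hn i)
  have hk := u.kind_lt
  refine (Runs.seq (search_spec h h10 h11 hts (hB.small_code htree (ht16 t htB)) (hcF _))
    (L := 99000 * Nat.log 2 (F.card + 2)) ?_).mono (by omega) fun _ h => h
  rintro s₁ ⟨u₁, u₂, u₃, u₄⟩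
  have hreg : ∀ r, r ∉ search.writes → s₁.reg r = s.reg r := u₄
  have hct : ∀ τ, content H u.edge.tree τ = none ↔ ∀ u', H τ = some u' → u'.edge ≠ u.edge := by
    intro τ
    have := (content_tree (H := H) (t := τ) u.edge).1
    constructor
    · intro h' u' hu' he
      exact this.2 ⟨u', hu', he⟩ h'
    · intro h'
      by_contra hne
      obtain ⟨u', hu', he⟩ := this.1 hne
      exact h' u' hu' he
  -- the previous update
  obtain ⟨p, x, hp, hps, hx, hxw, hxa⟩ : ∃ p x, s₁.reg 23 = p ∧ Small w p ∧
      s₁.mem (fld 4 p) = x ∧ x < 2 ^ w ∧ (x % 2 = if AliveAt H u.edge t then 1 else 0) := by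
    rcases u₁ with ⟨e, u₁⟩ | ⟨p, hpt, e, hp, u₁⟩
    · refine ⟨0, 0, e, h0, by rw [u₃]; exact h.nil.2.2, by omega, ?_⟩
      rw [if_neg]
      exact not_aliveAt fun τ hτ => (hct τ).1 (u₁ τ hτ)
    · obtain ⟨u', hu', he'⟩ := (content_tree (H := H) (t := p) u.edge).1.1 hp
      have hv := (content_tree (H := H) (t := p) u.edge).2 u' hu' he'
      have hk' := u'.kind_lt
      have hpB := hH p u' hu'
      refine ⟨_, 2 * p + u'.kind, e, hB.small_code htree (ht16 p (hH p u' hu')), ?_, by omega, ?_⟩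
      · rw [u₃, h.val _ _ _ hv]
      · have := aliveAt_of_last hpt hu' he' fun τ h₁ h₂ => (hct τ).1 (u₁ τ h₁ h₂)
        rw [this]
        split_ifs <;> omega
  -- the next update
  obtain ⟨q, y, qo, hq, hqs, hy, hyw, hnext, hqo⟩ : ∃ q y qo, s₁.reg 24 = q ∧ Small w q ∧
      s₁.mem (fld 4 q) = y ∧ y < 2 ^ w ∧ IsNext H u.edge t qo ∧
      ((q = 0 ∧ qo = none) ∨ (q ≠ 0 ∧ qo = some (y / 2) ∧ y / 2 ≤ B ∧ y / 2 ∈ F)) := by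
    rcases u₂ with ⟨e, u₂⟩ | ⟨q, hqt, e, hq, u₂⟩
    · exact ⟨0, 0, none, e, h0, by rw [u₃]; exact h.nil.2.2, by omega,
        fun τ hτ => (hct τ).1 (u₂ τ hτ), .inl ⟨rfl, rfl⟩⟩
    · obtain ⟨u', hu', he'⟩ := (content_tree (H := H) (t := q) u.edge).1.1 hq
      have hv := (content_tree (H := H) (t := q) u.edge).2 u' hu' he'
      have hk' := u'.kind_lt
      have hqB := hH q u' hu'
      have hdiv : (2 * q + u'.kind) / 2 = q := by omega
      refine ⟨_, 2 * q + u'.kind, some q, e, hB.small_code htree (ht16 q (hH q u' hu')), ?_,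
        by omega, ⟨hqt, ⟨u', hu', he'⟩, fun τ h₁ h₂ => (hct τ).1 (u₂ τ h₁ h₂)⟩,
        .inr ⟨code_ne_zero _ _, by rw [hdiv], by omega, ?_⟩⟩
      · rw [u₃, h.val _ _ _ hv]
      · rw [hdiv]
        exact hF q (by simp [hu'])
  set a := AliveAt H u.edge t
  refine (Runs.straight_seq rfl (L := 98000 * Nat.log 2 (F.card + 2)) ?_).mono (by
    have : decideChanges.bound ≤ 100 := by decide
    omega) fun _ h => h
  have s₁7 : s₁.reg 7 = u.kind := by rw [hreg 7 (by decide), h7]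
  rw [decideChanges_sem h0 s₁7 hp hq hps hqs hx hy hxw hyw]
  set z := (if q ≠ 0 ∧ x % 2 ≠ u.kind then 1 else 0) with hz
  set s₂ := ((s₁.setReg 20 (x % 2)).setReg 22 (y / 2)).setReg 21 z with hs₂
  have r₂ : s₂.reg 10 = u.edge.tree ∧ s₂.reg 11 = t ∧ s₂.reg 12 = 2 * t + u.kind ∧ s₂.reg 2 = t ∧
      s₂.reg 3 = u.edge.fst ∧ s₂.reg 4 = u.edge.snd ∧ s₂.reg 5 = u.edge.weight ∧
      s₂.reg 7 = u.kind ∧ s₂.reg 20 = x % 2 ∧ s₂.reg 21 = z ∧ s₂.reg 22 = y / 2 := by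
    simp only [hs₂, State.setReg_reg]
    norm_num
    rw [hreg 10 (by decide), hreg 11 (by decide), hreg 12 (by decide), hreg 2 (by decide),
      hreg 3 (by decide), hreg 4 (by decide), hreg 5 (by decide)]
    exact ⟨h10, h11, h12, h2, h3, h4, h5, s₁7⟩
  obtain ⟨g₁, g₂, g₃, g⟩ := r₂
  have hm₂ : s₂.mem = s.mem := u₃
  refine (Runs.seq (toggle_spec (G := content H) (F := F) (by rwa [hm₂]) g₁ g₂ g₃ (by omega) hts
    (hB.small_code htree (ht16 t htB)) (hcF _)) (L := 80000 * Nat.log 2 (F.card + 2)) ?_).mono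
    (by omega) fun _ h => h
  rintro s₃ ⟨v₁, v₂, v₃⟩
  set G₁ := flip (content H) u.edge.tree t (2 * t + u.kind) with hG₁
  have hF₁ : ∀ i t', G₁ i t' ≠ none → t' ∈ F := by
    intro i t' h'
    by_cases ht : t' = t
    · exact ht ▸ htF
    · refine hcF i t' ?_
      simpa [hG₁, flip, ht] using h'
  -- a conditional change
  have step : ∀ (r c tr τ : ℕ) (b : Prop) [Decidable b] (G : ℕ → ℕ → Option ℕ) (s' : State),
      (s'.reg r ≠ 0 ↔ b) → c ≤ 1 →
      (tr ≠ 10 ∧ tr ≠ 11 ∧ tr ≠ 12 ∧ tr ∉ toggle.writes) → Holds w s'.mem G →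
      s'.reg 3 = u.edge.fst ∧ s'.reg 4 = u.edge.snd ∧ s'.reg 5 = u.edge.weight →
      s'.reg tr = τ → (b → τ ≤ B ∧ τ ∈ F) → (∀ i t', G i t' ≠ none → t' ∈ F) →
      Runs w (.ite (.reg r) (toggleBoth c tr) .skip) s' (20110 * Nat.log 2 (F.card + 2)) fun s'' =>
        Holds w s''.mem (if b then flip2 G u.edge c τ else G) ∧
        (∀ i t', (if b then flip2 G u.edge c τ else G) i t' ≠ none → t' ∈ F) ∧
        (∀ f z, 8 ≤ f → f < 16 → s''.mem (fld f z) = s'.mem (fld f z)) ∧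
        ∀ r, r ∉ [10, 11, 12] ++ toggle.writes → s''.reg r = s'.reg r := by
    intro r c tr τ b _ G s' hr hc htr hG hregs hτ hb hGF
    refine (Runs.ite (K := 20100 * Nat.log 2 (F.card + 2)) (fun ht => ?_) fun ht => ?_).mono
      (by simp only [Expr.cost]; omega) fun _ h => h
    · have hb' := hr.1 ht
      obtain ⟨hb₁, hb₂⟩ := hb hb'
      simp only [if_pos hb']
      exact toggleBoth_spec hB hn hc htr hG hregs.1 hregs.2.1 hregs.2.2 hu.1 hτ hb₁ hGF hb₂
    · have hb' : ¬ b := fun h => hr.2 h ht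
      simp only [if_neg hb']
      exact Runs.straight rfl (by simp only [Program.bound]; omega)
        ⟨hG, hGF, fun _ _ _ _ => rfl, fun _ _ => rfl⟩
  have w₃ : ∀ r ∈ [2, 3, 4, 5, 7, 20, 21, 22], s₃.reg r = s₂.reg r := fun r hr =>
    v₃ r (by revert r; decide)
  have wb : ∀ s s' : State, (∀ r, r ∉ [10, 11, 12] ++ toggle.writes → s'.reg r = s.reg r) →
      ∀ r ∈ [2, 3, 4, 5, 7, 20, 21, 22], s'.reg r = s.reg r := fun s s' h r hr =>
    h r (by revert r; decide)
  have hk1 : u.kind ≠ 0 ↔ u.kind = 1 := by omega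
  have hx1 : x % 2 ≠ 0 ↔ a := by
    rw [hxa]; split_ifs with h <;> simp [h]
  have w₃' : s₃.reg 3 = u.edge.fst ∧ s₃.reg 4 = u.edge.snd ∧ s₃.reg 5 = u.edge.weight := by
    rw [w₃ 3 (by simp), w₃ 4 (by simp), w₃ 5 (by simp)]; exact ⟨g.2.1, g.2.2.1, g.2.2.2.1⟩
  refine (Runs.seq (step 7 0 2 t (u.kind = 1) G₁ s₃
    (by rw [w₃ 7 (by simp), g.2.2.2.2.1, hk1]) (by norm_num) (by decide) v₁ w₃'
    (by rw [w₃ 2 (by simp), g.1]) (fun _ => ⟨htB, htF⟩) hF₁)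
    (L := 50000 * Nat.log 2 (F.card + 2)) ?_).mono (by omega) fun _ h => h
  set G₂ := if u.kind = 1 then flip2 G₁ u.edge 0 t else G₁ with hG₂
  rintro s₄ ⟨i₁, i₂, i₃, i₄⟩
  have w₄ := wb _ _ i₄
  have w₄' : s₄.reg 3 = u.edge.fst ∧ s₄.reg 4 = u.edge.snd ∧ s₄.reg 5 = u.edge.weight := by
    rwa [w₄ 3 (by simp), w₄ 4 (by simp), w₄ 5 (by simp)]
  refine (Runs.seq (step 20 1 2 t a G₂ s₄
    (by rw [w₄ 20 (by simp), w₃ 20 (by simp), g.2.2.2.2.2.1, hx1]) (by norm_num) (by decide) i₁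
    w₄' (by rw [w₄ 2 (by simp), w₃ 2 (by simp), g.1]) (fun _ => ⟨htB, htF⟩) i₂)
    (L := 20110 * Nat.log 2 (F.card + 2)) ?_).mono (by omega) fun _ h => h
  set G₃ := if a then flip2 G₂ u.edge 1 t else G₂ with hG₃
  rintro s₅ ⟨j₁, j₂, j₃, j₄⟩
  have w₅ := wb _ _ j₄
  have w₅' : s₅.reg 3 = u.edge.fst ∧ s₅.reg 4 = u.edge.snd ∧ s₅.reg 5 = u.edge.weight := by
    rwa [w₅ 3 (by simp), w₅ 4 (by simp), w₅ 5 (by simp)]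
  refine (step 21 1 22 (y / 2) (q ≠ 0 ∧ x % 2 ≠ u.kind) G₃ s₅
    (by
      rw [w₅ 21 (by simp), w₄ 21 (by simp), w₃ 21 (by simp), g.2.2.2.2.2.2.1, hz]
      split_ifs with h <;> simp [h]) (by norm_num) (by decide) j₁
    w₅' (by rw [w₅ 22 (by simp), w₄ 22 (by simp), w₃ 22 (by simp), g.2.2.2.2.2.2.2])
    (fun hb => ?_) j₂).mono le_rfl ?_
  · rcases hqo with ⟨h, -⟩ | ⟨-, -, h⟩
    · exact absurd h hb.1
    · exact h
  · rintro s₆ ⟨l₁, l₂, l₃, l₄⟩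
    refine ⟨qo, hnext, ?_, fun f z hf hf' => by
      rw [l₃ f z hf hf', j₃ f z hf hf', i₃ f z hf hf', v₂ f z hf hf', hm₂]⟩
    convert l₁ using 1
    -- Register `21` holds the negation of the condition under which `change` leaves the next update
    -- alone.
    have hxk : (a ↔ u.kind = 1) ↔ ¬ x % 2 ≠ u.kind := by
      rw [← hx1]; omega
    unfold change
    rcases hqo with ⟨h, rfl⟩ | ⟨h, rfl, -⟩
    · exact (if_neg fun hb => hb.1 h).symm
    · simp only [hxk, h, ne_eq, not_false_eq_true, true_and, ite_not]
      rfl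

end

/-! ### Records of updates; creation and cancellation -/

section
variable {n : ℕ}

/-- The record of an update at time `t`. -/
structure Record (m : ℕ → ℕ) (t : ℕ) (u : Update n) : Prop where
  kind : m (fld 8 t) = u.kind
  fst : m (fld 9 t) = u.edge.fst
  snd : m (fld 10 t) = u.edge.snd
  weight : m (fld 11 t) = u.edge.weight
  label : m (fld 12 t) = u.edge.label

/-- The update in the registers `3` to `7`. -/
structure InRegs (s : State) (u : Update n) : Prop where
  kind : s.reg 7 = u.kind
  fst : s.reg 3 = u.edge.fst
  snd : s.reg 4 = u.edge.snd
  weight : s.reg 5 = u.edge.weight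
  label : s.reg 6 = u.edge.label

/-- The memory represents the updates listed by `H`. -/
structure Represents (w B : ℕ) (H : ℕ → Option (Update n)) (m : ℕ → ℕ) : Prop where
  holds : Holds w m (content H)
  record : ∀ t u, H t = some u → Record m t u
  time_le : ∀ t u, H t = some u → t ≤ B
  le : ∀ t u, H t = some u → u.Le B

/-- Load the update at the time in register `2`. -/
def loadRecord : Program :=
  .seq (.set 7 (cell 8 (.reg 2))) (.seq (.set 3 (cell 9 (.reg 2)))
  (.seq (.set 4 (cell 10 (.reg 2))) (.seq (.set 5 (cell 11 (.reg 2)))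
  (.set 6 (cell 12 (.reg 2))))))

/-- Store the update at the time in register `2`. -/
def storeRecord : Program :=
  .seq (.store (addr (.const 8) (.reg 2)) (.reg 7)) (.seq (.store (addr (.const 9) (.reg 2)) (.reg 3))
  (.seq (.store (addr (.const 10) (.reg 2)) (.reg 4))
  (.seq (.store (addr (.const 11) (.reg 2)) (.reg 5))
  (.store (addr (.const 12) (.reg 2)) (.reg 6)))))

theorem loadRecord_sem {w t : ℕ} {s : State} {u : Update n} (h : Record s.mem t u)
    (h2 : s.reg 2 = t) (ht : Small w t) :
    InRegs (loadRecord.sem w s) u ∧ (loadRecord.sem w s).reg 2 = t ∧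
      (loadRecord.sem w s).mem = s.mem := by
  have e : loadRecord.sem w s = ((((s.setReg 7 u.kind).setReg 3 u.edge.fst).setReg 4
      u.edge.snd).setReg 5 u.edge.weight).setReg 6 u.edge.label := by
    have key : ∀ (s' : State) (r f : ℕ), f < 16 → s'.mem = s.mem → s'.reg 2 = t →
        (Program.set r (cell f (.reg 2))).sem w s' = s'.setReg r (s.mem (fld f t)) := by
      intro s' r f hf hs hs'
      rw [sem_set_cell (k := t) hf (by rw [eval_reg, hs']) ht, hs]
    simp only [loadRecord, sem_seq]
    rw [key _ 7 8, key _ 3 9, key _ 4 10, key _ 5 11, key _ 6 12, h.kind, h.fst, h.snd, h.weight,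
      h.label] <;> first | norm_num; done | rfl | simpa using h2
  rw [e]
  exact ⟨⟨by simp, by simp, by simp, by simp, by simp⟩, by simpa using h2, rfl⟩

theorem storeRecord_sem {w t : ℕ} {s : State} {u : Update n} (h : InRegs s u) (h2 : s.reg 2 = t)
    (ht : Small w t) :
    Record (storeRecord.sem w s).mem t u ∧ (storeRecord.sem w s).reg = s.reg ∧
      ∀ f z, f < 16 → f < 8 ∨ z ≠ t → (storeRecord.sem w s).mem (fld f z) = s.mem (fld f z) := by
  have e : storeRecord.sem w s = ((((s.setMem (fld 8 t) u.kind).setMem (fld 9 t)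
      u.edge.fst).setMem (fld 10 t) u.edge.snd).setMem (fld 11 t) u.edge.weight).setMem (fld 12 t)
      u.edge.label := by
    have key : ∀ (s' : State) (f r x : ℕ), f < 16 → s'.reg = s.reg → s.reg r = x →
        (Program.store (addr (.const f) (.reg 2)) (.reg r)).sem w s' = s'.setMem (fld f t) x := by
      rintro s' f r x hf hs rfl
      rw [sem_store (k := t) hf (by rw [eval_reg, hs, h2]) ht, eval_reg, hs]
    simp only [storeRecord, sem_seq]
    rw [key _ 8 7 u.kind, key _ 9 3 u.edge.fst, key _ 10 4 u.edge.snd, key _ 11 5 u.edge.weight,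
      key _ 12 6 u.edge.label] <;>
      first | norm_num; done | rfl | exact h.kind | exact h.fst | exact h.snd | exact h.weight |
        exact h.label
  rw [e]
  refine ⟨⟨by simp [fld], by simp [fld], by simp [fld], by simp [fld], by simp [fld]⟩, rfl,
    fun f z hf hz => ?_⟩
  have hne : ∀ g, 8 ≤ g → g < 16 → fld f z ≠ fld g t := by
    intro g hg hg'
    rw [Ne, fld_inj hf hg']
    omega
  simp [hne]

/-- Prepare the arguments of `update`. -/
def treeArgs : Program :=
  .seq (.set 10 (.bin .add (.bin .mul (.const 3)
    (codeExpr (codeExpr (.reg 3) (.reg 4)) (codeExpr (.reg 5) (.reg 6)))) (.const 2)))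
  (.seq (.set 11 (.reg 2)) (.set 12 (.bin .add (.bin .mul (.const 2) (.reg 2)) (.reg 7))))

theorem Large.le_pow {B w x : ℕ} (hB : Large B w) (hx : x ≤ (B + 2) ^ 16) : x + 15 < 2 ^ w :=
  (hB.small hx).lt

theorem treeArgs_sem {w B t : ℕ} {s : State} {u : Update n} (hB : Large B w) (hn : n ≤ B)
    (h : InRegs s u) (hu : u.Le B) (h2 : s.reg 2 = t) (htB : t ≤ B) :
    treeArgs.sem w s = ((s.setReg 10 u.edge.tree).setReg 11 t).setReg 12 (2 * t + u.kind) := by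
  obtain ⟨b₁, b₂, b₃, b₄⟩ := tree_le hn hu
  have hk := u.kind_lt
  have hpow : ∀ k ≤ 16, (B + 2) ^ k ≤ (B + 2) ^ 16 := fun k hk =>
    Nat.pow_le_pow_right (by omega) hk
  have l₁ := hB.le_pow (b₁.trans (hpow 5 (by norm_num)))
  have l₂ := hB.le_pow (b₂.trans (hpow 5 (by norm_num)))
  have l₃ := hB.le_pow (b₃.trans (hpow 13 (by norm_num)))
  have l₄ := hB.le_pow b₄
  have l₅ := hB.le_pow (le_pow16 (B := B) (x := 4 * (B + 2)) le_rfl)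
  have e₁ : (codeExpr (.reg 3) (.reg 4)).eval w s = code u.edge.fst u.edge.snd := by
    rw [eval_codeExpr, eval_reg, eval_reg, h.fst, h.snd]
    rw [eval_reg, eval_reg, h.fst, h.snd]; omega
  have e₂ : (codeExpr (.reg 5) (.reg 6)).eval w s = code u.edge.weight u.edge.label := by
    rw [eval_codeExpr, eval_reg, eval_reg, h.weight, h.label]
    rw [eval_reg, eval_reg, h.weight, h.label]; omega
  have e₃ : (codeExpr (codeExpr (.reg 3) (.reg 4)) (codeExpr (.reg 5) (.reg 6))).eval w s =
      code (code u.edge.fst u.edge.snd) (code u.edge.weight u.edge.label) := by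
    rw [eval_codeExpr, e₁, e₂]
    rw [e₁, e₂]; omega
  have c₃ : (Expr.const 3).eval w s = 3 := eval_const (by omega)
  have c₂ : ∀ s, (Expr.const 2).eval w s = 2 := fun s => eval_const (by omega)
  have ht : u.edge.tree =
    3 * code (code u.edge.fst u.edge.snd) (code u.edge.weight u.edge.label) + 2 := rfl
  have e₄ : (Expr.bin .mul (.const 3) (codeExpr (codeExpr (.reg 3) (.reg 4))
      (codeExpr (.reg 5) (.reg 6)))).eval w s =
      3 * code (code u.edge.fst u.edge.snd) (code u.edge.weight u.edge.label) := by
    rw [eval_mul, c₃, e₃]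
    rw [c₃, e₃]; omega
  have e₅ : (Expr.bin .add (.bin .mul (.const 3)
      (codeExpr (codeExpr (.reg 3) (.reg 4)) (codeExpr (.reg 5) (.reg 6)))) (.const 2)).eval w s =
      u.edge.tree := by
    rw [eval_add, e₄, c₂, ht]
    rw [e₄, c₂]; omega
  set s₁ := (s.setReg 10 u.edge.tree).setReg 11 t with hs₁
  have r₂ : (Expr.reg 2).eval w s₁ = t := by simp [eval_reg, hs₁, h2]
  have r₇ : (Expr.reg 7).eval w s₁ = u.kind := by simp [eval_reg, hs₁, h.kind]
  have e₆ : (Expr.bin .mul (.const 2) (.reg 2)).eval w s₁ = 2 * t := by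
    rw [eval_mul, c₂, r₂]
    rw [c₂, r₂]; omega
  have e₇ : (Expr.bin .add (.bin .mul (.const 2) (.reg 2)) (.reg 7)).eval w s₁ =
      2 * t + u.kind := by
    rw [eval_add, e₆, r₇]
    rw [e₆, r₇]; omega
  rw [treeArgs, sem_seq, sem_set w 10, e₅, sem_seq, sem_set w 11, eval_reg]
  rw [show (s.setReg 10 u.edge.tree).reg 2 = t by simp [h2], ← hs₁, sem_set, e₇]

theorem treeArgs_update_spec {B w t : ℕ} {s : State} {H : ℕ → Option (Update n)} {u : Update n}
    {F : Finset ℕ} (hB : Large B w) (hn : n ≤ B) (h : Holds w s.mem (content H))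
    (hH : ∀ t u, H t = some u → t ≤ B) (htB : t ≤ B) (hu : u.Le B)
    (hF : ∀ t', H t' ≠ none → t' ∈ F) (htF : t ∈ F) (h2 : s.reg 2 = t) (hs : InRegs s u) :
    Runs w (.seq treeArgs update) s (101000 * Nat.log 2 (F.card + 2)) fun s' =>
      ∃ q, IsNext H u.edge t q ∧
      Holds w s'.mem (change (content H) u t (AliveAt H u.edge t) q) ∧
      ∀ f z, 8 ≤ f → f < 16 → s'.mem (fld f z) = s.mem (fld f z) := by
  have hlog : 1 ≤ Nat.log 2 (F.card + 2) := Nat.log_pos (by norm_num) (by omega)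
  have hb : treeArgs.bound ≤ 200 := by decide
  refine (Runs.straight_seq rfl (L := 100000 * Nat.log 2 (F.card + 2)) ?_).mono (by omega)
    fun _ h => h
  rw [treeArgs_sem hB hn hs hu h2 htB]
  exact update_spec hB hn h hH htB hu hF htF (by simpa using h2) (by simpa using hs.fst)
    (by simpa using hs.snd) (by simpa using hs.weight) (by simpa using hs.kind) (by simp) (by simp)
    (by simp)

/-- The program for the retroactive operations. -/
def operation : Program :=
  .seq (.ite (.bin .eq (.reg 1) (.const 2)) loadRecord
    (.seq (.set 7 (.bin .sub (.const 1) (.reg 1))) storeRecord))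
  (.seq treeArgs update)

theorem operation_bound (w : ℕ) (s : State) (Q : State → Prop) (L : ℕ) (hL : 1 ≤ L)
    (h : Runs w (.seq treeArgs update) ((Program.ite (.bin .eq (.reg 1) (.const 2)) loadRecord
      (.seq (.set 7 (.bin .sub (.const 1) (.reg 1))) storeRecord)).sem w s) (101000 * L) Q) :
    Runs w operation s (102000 * L) Q := by
  have hb : (Program.ite (.bin .eq (.reg 1) (.const 2)) loadRecord
      (.seq (.set 7 (.bin .sub (.const 1) (.reg 1))) storeRecord)).bound ≤ 200 := by decide
  exact (Runs.straight_seq rfl h).mono (by omega) fun _ h => h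

/-- Storing the record first is harmless, since it uses cells from 8 on and the trees use cells
below 8. The request code is 0 for an insertion and 1 for a deletion, so the kind is its difference
from 1. -/
theorem Represents.create {B w t : ℕ} {s : State} {H : ℕ → Option (Update n)} {u : Update n}
    {F : Finset ℕ} (h : Represents w B H s.mem) (hB : Large B w) (hn : n ≤ B) (htB : t ≤ B)
    (hu : u.Le B) (hF : ∀ t', H t' ≠ none → t' ∈ F) (htF : t ∈ F) (hHt : H t = none)
    (h1 : s.reg 1 = 1 - u.kind) (h2 : s.reg 2 = t) (h3 : s.reg 3 = u.edge.fst)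
    (h4 : s.reg 4 = u.edge.snd) (h5 : s.reg 5 = u.edge.weight) (h6 : s.reg 6 = u.edge.label) :
    Runs w operation s (102000 * Nat.log 2 (F.card + 2)) fun s' =>
      Represents w B (Function.update H t (some u)) s'.mem := by
  have hlog : 1 ≤ Nat.log 2 (F.card + 2) := Nat.log_pos (by norm_num) (by omega)
  have l₅ := hB.le_pow (le_pow16 (B := B) (x := 4 * (B + 2)) le_rfl)
  have hk := u.kind_lt
  refine operation_bound w s _ _ hlog ?_
  have e₁ : (Expr.bin .eq (.reg 1) (.const 2)).eval w s = 0 := by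
    rw [eval_eq (by omega), eval_reg, eval_const (by omega), h1, if_neg (by omega)]
  have e₂ : (Expr.bin .sub (.const 1) (.reg 1)).eval w s = u.kind := by
    rw [eval_sub (by rw [eval_const (by omega)]; omega), eval_reg, eval_const (by omega), h1]
    omega
  rw [Program.sem, if_pos e₁, sem_seq, sem_set, e₂]
  obtain ⟨u₁, u₂, u₃⟩ := storeRecord_sem (w := w) (t := t) (s := s.setReg 7 u.kind) (u := u)
    ⟨by simp, by simp [h3], by simp [h4], by simp [h5], by simp [h6]⟩ (by simp [h2])
    (hB.small (le_pow16 (by omega)))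
  set s₁ := storeRecord.sem w (s.setReg 7 u.kind)
  refine (treeArgs_update_spec (H := H) hB hn
    (h.holds.congr fun f z hf => u₃ f z (by omega) (.inl hf)) h.time_le htB hu hF htF
    (by rw [u₂]; simp [h2])
    ⟨by rw [u₂]; simp, by rw [u₂]; simp [h3], by rw [u₂]; simp [h4], by rw [u₂]; simp [h5],
      by rw [u₂]; simp [h6]⟩).mono le_rfl ?_
  rintro s' ⟨q, hq, v₁, v₂⟩
  have hc := (content_change (H' := Function.update H t (some u)) hHt (Function.update_self ..)
    (fun τ hτ => Function.update_of_ne hτ ..) hq).1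
  refine ⟨by rwa [hc], fun t' u' h' => ?_, fun t' u' h' => ?_, fun t' u' h' => ?_⟩ <;>
    by_cases ht : t' = t
  · subst ht
    rw [Function.update_self, Option.some.injEq] at h'
    subst h'
    exact ⟨(v₂ _ _ (by norm_num) (by norm_num)).trans u₁.kind,
      (v₂ _ _ (by norm_num) (by norm_num)).trans u₁.fst,
      (v₂ _ _ (by norm_num) (by norm_num)).trans u₁.snd,
      (v₂ _ _ (by norm_num) (by norm_num)).trans u₁.weight,
      (v₂ _ _ (by norm_num) (by norm_num)).trans u₁.label⟩
  · rw [Function.update_of_ne ht] at h'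
    have hr := h.record t' u' h'
    have key : ∀ f, 8 ≤ f → f < 16 → s'.mem (fld f t') = s.mem (fld f t') := fun f hf hf' =>
      (v₂ f t' hf hf').trans (u₃ f t' hf' (.inr ht))
    exact ⟨(key _ (by norm_num) (by norm_num)).trans hr.kind,
      (key _ (by norm_num) (by norm_num)).trans hr.fst,
      (key _ (by norm_num) (by norm_num)).trans hr.snd,
      (key _ (by norm_num) (by norm_num)).trans hr.weight,
      (key _ (by norm_num) (by norm_num)).trans hr.label⟩
  · exact ht ▸ htB
  · rw [Function.update_of_ne ht] at h'
    exact h.time_le t' u' h'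
  · subst ht
    rw [Function.update_self, Option.some.injEq] at h'
    exact h' ▸ hu
  · rw [Function.update_of_ne ht] at h'
    exact h.le t' u' h'

theorem IsNext.congr {H H' : ℕ → Option (Update n)} {e : Edge n} {t : ℕ} {q : Option ℕ}
    (h : IsNext H e t q) (hne : ∀ τ, τ ≠ t → H' τ = H τ) : IsNext H' e t q := by
  cases q with
  | none => exact fun τ hτ u hu => h τ hτ u (by rwa [← hne τ hτ.ne'])
  | some q =>
    obtain ⟨h₁, ⟨u, hu, he⟩, h₂⟩ := h
    exact ⟨h₁, ⟨u, by rwa [hne q h₁.ne'], he⟩,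
      fun τ hτ hτ' u hu => h₂ τ hτ hτ' u (by rwa [← hne τ hτ.ne'])⟩

/-- The second half of `content_change` is applied to the history without `u`: existence just before
`t` and the next update of the edge do not depend on `u`, so the same program as for creation works.
The record of `u` stays in memory, but nothing refers to it any more. -/
theorem Represents.cancel {B w t : ℕ} {s : State} {H : ℕ → Option (Update n)} {u : Update n}
    {F : Finset ℕ} (h : Represents w B H s.mem) (hB : Large B w) (hn : n ≤ B)
    (hF : ∀ t', H t' ≠ none → t' ∈ F) (hHt : H t = some u)
    (h1 : s.reg 1 = 2) (h2 : s.reg 2 = t) :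
    Runs w operation s (102000 * Nat.log 2 (F.card + 2)) fun s' =>
      Represents w B (Function.update H t none) s'.mem := by
  have hlog : 1 ≤ Nat.log 2 (F.card + 2) := Nat.log_pos (by norm_num) (by omega)
  have l₅ := hB.le_pow (le_pow16 (B := B) (x := 4 * (B + 2)) le_rfl)
  have htB := h.time_le t u hHt
  refine operation_bound w s _ _ hlog ?_
  have e₁ : (Expr.bin .eq (.reg 1) (.const 2)).eval w s = 1 := by
    rw [eval_eq (by omega), eval_reg, eval_const (by omega), h1, if_pos rfl]
  rw [Program.sem, if_neg (by rw [e₁]; norm_num)]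
  obtain ⟨u₁, u₂, u₃⟩ := loadRecord_sem (h.record t u hHt) h2 (hB.small (le_pow16 (by omega)))
  refine (treeArgs_update_spec (H := H) hB hn (by rw [u₃]; exact h.holds) h.time_le htB
    (h.le t u hHt) hF (hF t (by simp [hHt])) u₂ u₁).mono le_rfl ?_
  rintro s' ⟨q, hq, v₁, v₂⟩
  set H' := Function.update H t none with hH'
  have hne : ∀ τ, τ ≠ t → H' τ = H τ := fun τ hτ => Function.update_of_ne hτ ..
  have ha : AliveAt H' u.edge t ↔ AliveAt H u.edge t :=
    aliveAt_congr fun τ hτ u' _ => by rw [hne τ hτ.ne]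
  have hc := (content_change (H := H') (Function.update_self ..) hHt
    (fun τ hτ => (hne τ hτ).symm) (hq.congr hne)).2
  rw [ha] at hc
  have hsome : ∀ t' u', H' t' = some u' → H t' = some u' := by
    intro t' u' h'
    rwa [← hne t']
    rintro rfl
    simp [hH'] at h'
  refine ⟨by rwa [hc], fun t' u' h' => ?_, fun t' u' h' => h.time_le _ _ (hsome _ _ h'),
    fun t' u' h' => h.le _ _ (hsome _ _ h')⟩
  have hr := h.record t' u' (hsome _ _ h')
  have key : ∀ f, 8 ≤ f → f < 16 → s'.mem (fld f t') = s.mem (fld f t') := fun f hf hf' =>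
    (v₂ f t' hf hf').trans (by rw [u₃])
  exact ⟨(key _ (by norm_num) (by norm_num)).trans hr.kind,
    (key _ (by norm_num) (by norm_num)).trans hr.fst,
    (key _ (by norm_num) (by norm_num)).trans hr.snd,
    (key _ (by norm_num) (by norm_num)).trans hr.weight,
    (key _ (by norm_num) (by norm_num)).trans hr.label⟩

end

/-! ### Queries -/

/-- Compare the degree of the vertex in register `9`, the difference of the registers `27` and `26`,
with the maximum in register `8`, and go on to the next vertex. -/
def queryMax : Program :=
  .seq (.set 27 (.bin .sub (.reg 27) (.reg 26)))
  (.seq (.ite (.bin .lt (.reg 8) (.reg 27)) (.set 8 (.reg 27)) .skip)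
  (.set 9 (.bin .add (.reg 9) (.const 1))))

/-- Treat the vertex in register `9`. -/
def queryBody : Program :=
  .seq (.set 10 (.bin .mul (.const 3) (.reg 9))) (.seq sumBefore
  (.seq (.seq (.set 27 (.reg 26)) (.set 10 (.bin .add (.bin .mul (.const 3) (.reg 9)) (.const 1))))
  (.seq sumBefore queryMax)))

/-- The program for the queries. -/
def query : Program :=
  .seq (.seq (.set 8 (.const 0)) (.seq (.set 9 (.const 0)) (.set 11 (.reg 2))))
  (.seq (.while (.bin .lt (.reg 9) (.reg 0)) queryBody) (.set 0 (.reg 8)))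

section
variable {n : ℕ}

theorem queryMax_sem {w v x y z : ℕ} {s : State} (hv : v + 1 < 2 ^ w) (h9 : s.reg 9 = v)
    (h27 : s.reg 27 = x) (h26 : s.reg 26 = y) (h8 : s.reg 8 = z) (hx : x < 2 ^ w) :
    (queryMax.sem w s).reg 9 = v + 1 ∧ (queryMax.sem w s).reg 8 = z ⊔ (x - y) := by
  have e₁ : (Expr.bin .sub (.reg 27) (.reg 26)).eval w s = x - y := by
    rw [eval_sub (by rwa [eval_reg, h27]), eval_reg, eval_reg, h27, h26]
  set s₁ := s.setReg 27 (x - y) with hs₁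
  have e₂ : (Expr.bin .lt (.reg 8) (.reg 27)).eval w s₁ = if z < x - y then 1 else 0 := by
    rw [eval_lt (by omega)]
    simp [eval_reg, hs₁, h8]
  have e₃ : (Program.ite (.bin .lt (.reg 8) (.reg 27)) (.set 8 (.reg 27)) .skip).sem w s₁ =
      if z < x - y then s₁.setReg 8 (x - y) else s₁ := by
    rw [Program.sem, e₂]
    by_cases h : z < x - y
    · rw [if_pos h, if_pos h, if_neg one_ne_zero, sem_set, eval_reg]
      simp [hs₁]
    · rw [if_neg h, if_neg h, if_pos rfl, Program.sem]
  set s₂ := if z < x - y then s₁.setReg 8 (x - y) else s₁ with hs₂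
  have h₂ : s₂.reg 9 = v := by
    rw [hs₂]; split_ifs <;> simp [hs₁, h9]
  have e₄ : (Expr.bin .add (.reg 9) (.const 1)).eval w s₂ = v + 1 := by
    rw [eval_add, eval_reg, h₂, eval_const (by omega)]
    rw [eval_reg, h₂, eval_const (by omega)]; omega
  rw [queryMax, sem_seq, sem_set w 27, e₁, ← hs₁, sem_seq, e₃, sem_set w 9, e₄]
  refine ⟨by simp, ?_⟩
  simp only [State.setReg_reg, hs₂]
  norm_num
  split_ifs with h
  · simp; omega
  · simp [hs₁, h8]; omega

/-- The sum over one of the trees of a vertex is small. -/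
theorem Represents.sum_le {w B : ℕ} {H : ℕ → Option (Update n)} {m : ℕ → ℕ}
    (h : Represents w B H m) {F : Finset ℕ} (hF : ∀ t', H t' ≠ none → t' ∈ F) (v : Fin n) (M : ℕ) :
    ∑ t ∈ Finset.range M, (content H (3 * v) t).getD 0 ≤ F.card * B ∧
      ∑ t ∈ Finset.range M, (content H (3 * v + 1) t).getD 0 ≤ F.card * B := by
  have key : ∀ i, (∀ t u, H t = some u → (content H i t).getD 0 ≤ B) →
      ∑ t ∈ Finset.range M, (content H i t).getD 0 ≤ F.card * B := by
    intro i hi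
    calc ∑ t ∈ Finset.range M, (content H i t).getD 0
        ≤ ∑ t ∈ Finset.range M ∪ F, (content H i t).getD 0 :=
          Finset.sum_le_sum_of_subset Finset.subset_union_left
      _ = ∑ t ∈ F, (content H i t).getD 0 := by
          refine (Finset.sum_subset Finset.subset_union_right fun t _ ht => ?_).symm
          have : H t = none := by
            by_contra hne
            exact ht (hF t hne)
          rw [content_none this]
          rfl
      _ ≤ ∑ t ∈ F, B := by
          refine Finset.sum_le_sum fun t _ => ?_
          cases hu : H t with
          | none => rw [content_none hu]; exact Nat.zero_le _
          | some u => exact hi t u hu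
      _ = F.card * B := by simp
  constructor <;> refine key _ fun t u hu => ?_
  · rw [(content_add v hu).1]
    have := (h.le t u hu).1
    split_ifs <;> simp [this]
  · rw [(content_add v hu).2]
    have := (h.le t u hu).1
    split_ifs <;> simp [this]

/-- The degree that the sums yield. -/
noncomputable def sumDegree (H : ℕ → Option (Update n)) (M v : ℕ) : ℕ :=
  ∑ t ∈ Finset.range M, (content H (3 * v) t).getD 0 -
    ∑ t ∈ Finset.range M, (content H (3 * v + 1) t).getD 0

/-- The hypothesis on `M` quantifies over states because register `10` changes between the two sums,
while the registers with the time and the request code do not. -/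
theorem queryBody_spec {B w M v : ℕ} {s : State} {H : ℕ → Option (Update n)} {F : Finset ℕ}
    (h : Represents w B H s.mem) (hB : Large B w) (hn : n ≤ B) (hF : ∀ t', H t' ≠ none → t' ∈ F)
    (hFB : F.card ≤ B) (hv : v < n) (h9 : s.reg 9 = v)
    (hM : ∀ i ≤ 3 * B, ∀ s' : State, s'.reg 10 = i → s'.reg 11 = s.reg 11 → s'.reg 1 = s.reg 1 →
      ∀ t', content H i t' ≠ none →
      (code i t' < (codeExpr (.reg 10) (.reg 11)).eval w s' ∨ s'.reg 1 = 4 ↔ t' < M)) :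
    Runs w queryBody s (1100 * Nat.log 2 (F.card + 2)) fun s' =>
      s'.reg 9 = v + 1 ∧ s'.reg 8 = s.reg 8 ⊔ sumDegree H M v ∧ s'.reg 0 = s.reg 0 ∧
      s'.reg 1 = s.reg 1 ∧ s'.reg 11 = s.reg 11 ∧ s'.mem = s.mem := by
  have hlog : 1 ≤ Nat.log 2 (F.card + 2) := Nat.log_pos (by norm_num) (by omega)
  have l₅ := hB.le_pow (le_pow16 (B := B) (x := 4 * (B + 2)) le_rfl)
  -- Both sums are at most `F.card * B ≤ B * B`, so the sums modulo `2 ^ w` are exact and may be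
  -- subtracted as numbers.
  have hBB : B * B < 2 ^ w := by
    have h1 : (B + 2) ^ 2 ≤ (B + 2) ^ 40 := Nat.pow_le_pow_right (by omega) (by norm_num)
    have h2 : (B + 2) ^ 40 ≤ 2 ^ w := hB
    nlinarith
  have hcF : ∀ i t', content H i t' ≠ none → t' ∈ F := fun i t' h' =>
    hF t' fun hn => h' (content_none hn i)
  obtain ⟨hs₁, hs₂⟩ := h.sum_le hF ⟨v, hv⟩ M
  have hFBB : F.card * B ≤ B * B := Nat.mul_le_mul_right _ hFB
  simp only at hs₁ hs₂
  have c₃ : ∀ s, (Expr.const 3).eval w s = 3 := fun s => eval_const (by omega)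
  have c₁ : ∀ s, (Expr.const 1).eval w s = 1 := fun s => eval_const (by omega)
  have e₁ : ∀ s : State, s.reg 9 = v → (Expr.bin .mul (.const 3) (.reg 9)).eval w s = 3 * v := by
    intro s h9
    rw [eval_mul, c₃, eval_reg, h9]
    rw [c₃, eval_reg, h9]; omega
  have e₂ : ∀ s : State, s.reg 9 = v →
      (Expr.bin .add (.bin .mul (.const 3) (.reg 9)) (.const 1)).eval w s = 3 * v + 1 := by
    intro s h9
    rw [eval_add, e₁ s h9, c₁]
    rw [e₁ s h9, c₁]; omega
  suffices hmain : Runs w queryBody s (1100 * Nat.log 2 (F.card + 2)) fun s' =>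
      s'.reg 9 = v + 1 ∧ s'.reg 8 = s.reg 8 ⊔ sumDegree H M v by
    refine hmain.frame.mono le_rfl ?_
    rintro s' ⟨⟨h₁, h₂⟩, h₃, h₄⟩
    exact ⟨h₁, h₂, h₃ 0 (by decide), h₃ 1 (by decide), h₃ 11 (by decide), h₄ rfl⟩
  refine (Runs.straight_seq rfl (L := 1080 * Nat.log 2 (F.card + 2)) ?_).mono
    (by simp only [Program.bound, Expr.cost]; omega) fun _ h => h
  rw [sem_set, e₁ s h9]
  set s₁ := s.setReg 10 (3 * v) with hs₁
  refine (Runs.seq (sumBefore_spec (s := s₁) (M := M) h.holds rfl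
    (hB.small (le_pow16 (by simp [hs₁]; omega))) (hcF _)
    (hM _ (by simp [hs₁]; omega) _ rfl (by simp [hs₁]) (by simp [hs₁])))
    (L := 580 * Nat.log 2 (F.card + 2)) ?_).mono (by omega) fun _ h => h
  rintro s₂ ⟨u₁, u₂, u₃⟩
  rw [show s₁.reg 10 = 3 * v by simp [hs₁], Nat.mod_eq_of_lt (by omega)] at u₁
  have r₂ : ∀ r ∈ [0, 1, 8, 9, 11], s₂.reg r = s.reg r := by
    intro r hr
    rw [u₃ r (by revert r; decide), hs₁, State.setReg_reg, if_neg (by revert r; decide)]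
  refine (Runs.straight_seq rfl (L := 560 * Nat.log 2 (F.card + 2)) ?_).mono
    (by simp only [Program.bound, Expr.cost]; omega) fun _ h => h
  rw [sem_seq, sem_set w 27, eval_reg, u₁, sem_set w 10,
    e₂ _ (by simp [r₂ 9 (by simp), h9])]
  set s₃ := (s₂.setReg 27 (∑ t ∈ Finset.range M, (content H (3 * v) t).getD 0)).setReg 10
    (3 * v + 1) with hs₃
  have r₃ : ∀ r ∈ [0, 1, 8, 9, 11], s₃.reg r = s.reg r := by
    intro r hr
    rw [hs₃, State.setReg_reg, if_neg (by revert r; decide), State.setReg_reg,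
      if_neg (by revert r; decide), r₂ r hr]
  refine (Runs.seq (sumBefore_spec (s := s₃) (M := M) (G := content H)
    (by change Holds w s₂.mem _; rw [u₂]; exact h.holds) rfl
    (hB.small (le_pow16 (by simp [hs₃]; omega))) (hcF _)
    (hM _ (by simp [hs₃]; omega) _ rfl (r₃ 11 (by simp)) (r₃ 1 (by simp))))
    (L := 60 * Nat.log 2 (F.card + 2)) ?_).mono (by omega) fun _ h => h
  rintro s₄ ⟨v₁, v₂, v₃⟩
  rw [show s₃.reg 10 = 3 * v + 1 by simp [hs₃], Nat.mod_eq_of_lt (by omega)] at v₁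
  have hb : queryMax.bound ≤ 60 := by decide
  refine Runs.straight rfl (by omega) ?_
  exact queryMax_sem (by omega) (by rw [v₃ 9 (by decide), r₃ 9 (by simp), h9])
    (by rw [v₃ 27 (by decide)]; simp [hs₃]) v₁ (by rw [v₃ 8 (by decide), r₃ 8 (by simp)])
    (by omega)

theorem query_spec {B w t : ℕ} {s : State} {H : ℕ → Option (Update n)} {S : History n}
    {τ : WithTop ℕ} (h : Represents w B H s.mem) (hS : Lists H S) (hB : Large B w) (hn : n ≤ B)
    (hn0 : 0 < n) (hSB : S.card ≤ B) (h0 : s.reg 0 = n)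
    (hτ : (s.reg 1 = 3 ∧ s.reg 2 = t ∧ t ≤ B ∧ τ = t) ∨ (s.reg 1 = 4 ∧ τ = ⊤)) :
    Runs w query s (2000 * n * Nat.log 2 (S.card + 2)) fun s' =>
      s'.reg 0 = S.maxDegree τ ∧ s'.mem = s.mem := by
  have l₅ := hB.le_pow (le_pow16 (B := B) (x := 4 * (B + 2)) le_rfl)
  set F := S.image Prod.fst with hFdef
  have hFS : F.card ≤ S.card := Finset.card_image_le
  have hF : ∀ t', H t' ≠ none → t' ∈ F := by
    intro t' ht'
    obtain ⟨u, hu⟩ := Option.ne_none_iff_exists'.1 ht'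
    exact Finset.mem_image.2 ⟨(t', u), (hS t' u).1 hu, rfl⟩
  have hlogF : Nat.log 2 (F.card + 2) ≤ Nat.log 2 (S.card + 2) := Nat.log_mono_right (by omega)
  have hlog : 1 ≤ Nat.log 2 (F.card + 2) := Nat.log_pos (by norm_num) (by omega)
  -- The cutoff is `t` for a query at the time `t`, and one more than the last used time for the
  -- present.
  obtain ⟨M, hM₁, hM₂⟩ : ∃ M, (∀ e, S.Alive τ e ↔ AliveAt H e M) ∧
      ∀ i ≤ 3 * B, ∀ s' : State, s'.reg 10 = i → s'.reg 11 = s.reg 2 → s'.reg 1 = s.reg 1 →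
      ∀ t', content H i t' ≠ none →
      (code i t' < (codeExpr (.reg 10) (.reg 11)).eval w s' ∨ s'.reg 1 = 4 ↔ t' < M) := by
    rcases hτ with ⟨h1, h2, htB, rfl⟩ | ⟨h1, rfl⟩
    · refine ⟨t, fun e => hS.alive e t, ?_⟩
      intro i hi s' h10 h11 h1' t' _
      have hsm := (hB.small_code (i := i) (t := t) (le_pow16 (by omega)) (le_pow16 (by omega))).lt
      rw [eval_codeExpr, eval_reg, eval_reg, h10, h11, h2, h1', h1, code_lt_code]
      · simp
      · rw [eval_reg, eval_reg, h10, h11, h2]; omega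
    · have hlt : ∀ x ∈ S, x.1 < F.sup id + 1 := fun x hx =>
        Nat.lt_succ_of_le (Finset.le_sup (f := id) (Finset.mem_image_of_mem _ hx))
      refine ⟨F.sup id + 1, fun e => hS.alive_top e hlt, ?_⟩
      intro i hi s' h10 h11 h1' t' ht'
      have hmem : t' ∈ F := hF t' fun hn => ht' (content_none hn i)
      have : t' ≤ F.sup id := Finset.le_sup (f := id) hmem
      rw [h1', h1]
      simp only [or_true, true_iff]
      omega
  have hsup : S.maxDegree τ = (Finset.range n).sup (sumDegree H M) := by
    refine le_antisymm (Finset.sup_le fun v _ => ?_) (Finset.sup_le fun v hv => ?_)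
    · rw [hS.degree hM₁]
      exact Finset.le_sup (f := sumDegree H M) (Finset.mem_range.2 v.isLt)
    · refine le_trans (le_of_eq ?_)
        (Finset.le_sup (f := fun v => S.degree τ v) (Finset.mem_univ ⟨v, Finset.mem_range.1 hv⟩))
      rw [hS.degree hM₁]
      rfl
  have hcost : n * Nat.log 2 (F.card + 2) ≤ n * Nat.log 2 (S.card + 2) :=
    Nat.mul_le_mul_left _ hlogF
  have hcost₁ : n * 1 ≤ n * Nat.log 2 (F.card + 2) := Nat.mul_le_mul_left _ hlog
  set s₁ := ((s.setReg 8 0).setReg 9 0).setReg 11 (s.reg 2) with hs₁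
  have e₀ : ∀ s, (Expr.const 0).eval w s = 0 := fun s => eval_const (by omega)
  have eq₁ : (Program.seq (.set 8 (.const 0)) (.seq (.set 9 (.const 0)) (.set 11 (.reg 2)))).sem w s
      = s₁ := by
    rw [sem_seq, sem_set w 8, e₀, sem_seq, sem_set w 9, e₀, sem_set w 11, eval_reg]
    simp [hs₁]
  have et : ∀ s' : State, (Expr.bin .lt (.reg 9) (.reg 0)).eval w s' =
      if s'.reg 9 < s'.reg 0 then 1 else 0 := fun s' => eval_lt (by omega)
  have key := Runs.loop (w := w) (b := .bin .lt (.reg 9) (.reg 0)) (p := queryBody)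
    (K := 1100 * Nat.log 2 (F.card + 2)) (α := ℕ) (fun j => n - j)
    (fun j s' => j ≤ n ∧ s'.reg 9 = j ∧ s'.reg 8 = (Finset.range j).sup (sumDegree H M) ∧
      s'.reg 0 = n ∧ s'.reg 1 = s.reg 1 ∧ s'.reg 11 = s.reg 2 ∧ s'.mem = s.mem)
    ?_ 0 s₁ ⟨Nat.zero_le _, by simp [hs₁], by simp [hs₁], by simp [hs₁, h0], by simp [hs₁],
      by simp [hs₁], rfl⟩
  · refine (Runs.straight_seq rfl (L := (n * (4 + 1100 * Nat.log 2 (F.card + 2)) + 4) + 2) ?_).mono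
      ?_ fun _ h => h
    · rw [eq₁]
      refine Runs.seq key ?_
      rintro s' ⟨ht, j, hj, h9, h8, h0', -, -, hm⟩
      rw [et, h9, h0'] at ht
      have : j = n := by
        by_contra hne
        rw [if_pos (by omega)] at ht
        exact absurd ht (by norm_num)
      subst this
      refine Runs.straight rfl (by simp [Program.bound, Expr.cost]) ?_
      rw [sem_set, eval_reg, h8]
      exact ⟨by simp [hsup], by simpa using hm⟩
    · have e : n * (4 + 1100 * Nat.log 2 (F.card + 2)) =
          4 * n + 1100 * (n * Nat.log 2 (F.card + 2)) := by ring
      have e' : 2000 * n * Nat.log 2 (S.card + 2) = 2000 * (n * Nat.log 2 (S.card + 2)) := by ring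
      simp only [Program.bound, Expr.cost]
      omega
  · rintro j s' ⟨hj, h9, h8, h0', h1', h11, hm⟩ ht
    rw [et, h9, h0'] at ht
    have hjn : j < n := by
      by_contra hne
      exact ht (if_neg hne)
    refine (queryBody_spec (M := M) (F := F) (by rw [hm]; exact h) hB hn hF (by omega) hjn h9
      (by rw [h11, h1']; exact hM₂)).mono le_rfl ?_
    rintro s'' ⟨v₁, v₂, v₃, v₄, v₅, v₆⟩
    refine ⟨j + 1, by omega, hjn, v₁, ?_, v₃.trans h0', v₄.trans h1', v₅.trans h11, v₆.trans hm⟩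
    rw [v₂, h8, Finset.range_add_one, Finset.sup_insert, sup_comm]

end

/-! ### The data structure -/

/-- The program of the data structure. -/
def main : Program := .ite (.bin .lt (.reg 1) (.const 3)) operation query

section
variable {n : ℕ}

/-- The memory represents the set `S` of updates. -/
def Valid (w B : ℕ) (S : History n) (s : State) : Prop :=
  ∃ H, Lists H S ∧ Represents w B H s.mem

/-- In zero memory every root pointer is 0 and the sentinel is correct, so all trees are empty
without any initialisation. -/
theorem valid_init (w B : ℕ) : Valid w B (∅ : History n) State.init := by
  refine ⟨fun _ => none, by simp [Lists], ⟨⟨rfl, rfl, rfl⟩, fun i => ⟨.nil, trivial, rfl, trivial,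
    .nil, fun k => ?_⟩, fun i t v h => ?_⟩, ?_, ?_, ?_⟩ <;> simp [content, Tree.keys] at *

theorem main_operation {w L : ℕ} {s : State} {Q : State → Prop} (hw : 3 < 2 ^ w)
    (h1 : s.reg 1 < 3) (hL : 1 ≤ L) (h : Runs w operation s (102000 * L) Q) :
    Runs w main s (110000 * L) Q := by
  have e : (Expr.bin .lt (.reg 1) (.const 3)).eval w s = 1 := by
    rw [eval_lt (by omega), eval_reg, eval_const hw, if_pos h1]
  exact (Runs.ite (fun _ => h) fun h0 => by rw [e] at h0; exact absurd h0 one_ne_zero).mono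
    (by simp only [Expr.cost]; omega) fun _ h => h

theorem main_query {w L : ℕ} {s : State} {Q : State → Prop} (hw : 3 < 2 ^ w)
    (h1 : 3 ≤ s.reg 1) (hL : 1 ≤ L) (h : Runs w query s (2000 * L) Q) :
    Runs w main s (110000 * L) Q := by
  have e : (Expr.bin .lt (.reg 1) (.const 3)).eval w s = 0 := by
    rw [eval_lt (by omega), eval_reg, eval_const hw, if_neg (by omega)]
  exact (Runs.ite (fun h0 => absurd e h0) fun _ => h).mono
    (by simp only [Expr.cost]; omega) fun _ h => h

/-- The cost is logarithmic in the number of times in use during the operation, which after a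
cancellation exceeds the new size by one. This adds at most 1 to the logarithm; the square only
adapts the bound to the theorem. -/
theorem log_le_sq {a b : ℕ} (h : a ≤ b + 1) : Nat.log 2 (a + 2) ≤ 2 * Nat.log 2 (b + 2) ^ 2 := by
  have h1 : 1 ≤ Nat.log 2 (b + 2) := Nat.log_pos (by norm_num) (by omega)
  have h2 : Nat.log 2 (a + 2) ≤ Nat.log 2 ((b + 2) * 2) := Nat.log_mono_right (by omega)
  rw [Nat.log_mul_base (by norm_num) (by omega)] at h2
  nlinarith

/-- The program serves a retroactive operation. -/
theorem Valid.operation {w B : ℕ} {S : History n} {s : State} {r : Request n} (h : Valid w B S s)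
    (hB : Large B w) (hn : n ≤ B) (hr : r.isOperation) (hl : r.Legal S) (hb : r.Bounded B) :
    Runs w main (r.pass s) (220000 * Nat.log 2 ((r.apply S).card + 2) ^ 2)
      (Valid w B (r.apply S)) := by
  classical
  obtain ⟨H, hS, hR⟩ := h
  have l₅ := hB.le_pow (le_pow16 (B := B) (x := 4 * (B + 2)) le_rfl)
  have hmem : ∀ t', H t' ≠ none → t' ∈ S.image Prod.fst := by
    intro t' ht'
    obtain ⟨u, hu⟩ := Option.ne_none_iff_exists'.1 ht'
    exact Finset.mem_image.2 ⟨(t', u), (hS t' u).1 hu, rfl⟩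
  have hcard : (S.image Prod.fst).card ≤ S.card := Finset.card_image_le
  cases r with
  | query t => simp [Request.isOperation] at hr
  | create u t =>
    have hHt : H t = none := by
      by_contra hne
      obtain ⟨u', hu'⟩ := Option.ne_none_iff_exists'.1 hne
      exact hl ⟨u', (hS t u').1 hu'⟩
    set F := insert t (S.image Prod.fst) with hFdef
    have hF : F.card ≤ S.card + 1 := (Finset.card_insert_le _ _).trans (by omega)
    have happ : (Request.create u t).apply S = insert (t, u) S := by
      simp only [Request.apply]
    have hS' : S.card ≤ (insert (t, u) S).card := Finset.card_le_card (Finset.subset_insert _ _)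
    have hlog : 1 ≤ Nat.log 2 (F.card + 2) := Nat.log_pos (by norm_num) (by omega)
    rw [happ]
    have hle := log_le_sq (a := F.card) (b := (insert (t, u) S).card) (by omega)
    have hmem' : ((Request.create u t).pass s).mem = s.mem := by cases u <;> rfl
    have h1 : ((Request.create u t).pass s).reg 1 = 1 - u.kind := by
      cases u <;> simp [Request.pass, Update.kind]
    refine (main_operation (L := Nat.log 2 (F.card + 2)) (by omega) (by rw [h1]; omega) hlog
      (Represents.create (H := H) (t := t) (u := u) (by rwa [hmem']) hB hn hb.1 hb.2
      (fun t' ht' => Finset.mem_insert_of_mem (hmem t' ht')) (Finset.mem_insert_self _ _) hHt h1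
      ?_ ?_ ?_ ?_ ?_)).mono (by omega) ?_
    · cases u <;> simp [Request.pass]
    · cases u <;> simp [Request.pass, Update.edge]
    · cases u <;> simp [Request.pass, Update.edge]
    · cases u <;> simp [Request.pass, Update.edge]
    · cases u <;> simp [Request.pass, Update.edge]
    · intro s' hs'
      refine ⟨_, fun t' u' => ?_, hs'⟩
      by_cases ht : t' = t
      · subst ht
        have : (t', u') ∉ S := fun h => hl ⟨u', h⟩
        simp [this, eq_comm]
      · rw [Function.update_of_ne ht, hS]
        simp [ht]
  | cancel t =>
    obtain ⟨u, hu⟩ := hl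
    have hHt := (hS t u).2 hu
    set F := S.image Prod.fst with hFdef
    have happ : (Request.cancel t).apply S = S.filter fun x => x.1 ≠ t := by
      simp only [Request.apply]
    have hS' : S.card ≤ (S.filter fun x => x.1 ≠ t).card + 1 := by
      refine (Finset.card_le_card (t := insert (t, u) (S.filter fun x => x.1 ≠ t))
        fun x hx => ?_).trans (Finset.card_insert_le _ _)
      rw [Finset.mem_insert, Finset.mem_filter]
      by_cases hxt : x.1 = t
      · left
        obtain ⟨t', u'⟩ := x
        simp only at hxt
        subst hxt
        have := (hS t' u').2 hx
        rw [hHt, Option.some.injEq] at this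
        rw [this]
      · exact .inr ⟨hx, hxt⟩
    have hlog : 1 ≤ Nat.log 2 (F.card + 2) := Nat.log_pos (by norm_num) (by omega)
    rw [happ]
    have hle := log_le_sq (a := F.card) (b := (S.filter fun x => x.1 ≠ t).card) (by omega)
    have h1 : ((Request.cancel t : Request n).pass s).reg 1 = 2 := by simp [Request.pass]
    have h2 : ((Request.cancel t : Request n).pass s).reg 2 = t := by simp [Request.pass]
    refine (main_operation (L := Nat.log 2 (F.card + 2)) (by omega) (by rw [h1]; omega) hlog
      (Represents.cancel (H := H) (s := (Request.cancel t : Request n).pass s) hR hB hn hmem hHt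
      h1 h2)).mono (by omega) ?_
    intro s' hs'
    refine ⟨_, fun t' u' => ?_, hs'⟩
    by_cases ht : t' = t
    · subst ht
      simp
    · rw [Function.update_of_ne ht, hS]
      simp [ht]

/-- The program answers a query. -/
theorem Valid.query {w B : ℕ} {S : History n} {s : State} {τ : WithTop ℕ} (h : Valid w B S s)
    (hB : Large B w) (hn : n ≤ B) (hn0 : 0 < n) (hSB : S.card ≤ B)
    (hb : (Request.query τ : Request n).Bounded B) :
    Runs w main ((Request.query τ : Request n).pass s) (220000 * n * Nat.log 2 (S.card + 2))
      fun s' => s'.answer = S.maxDegree τ ∧ Valid w B S s' := by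
  obtain ⟨H, hS, hR⟩ := h
  have l₅ := hB.le_pow (le_pow16 (B := B) (x := 4 * (B + 2)) le_rfl)
  have hlog : 1 ≤ Nat.log 2 (S.card + 2) := Nat.log_pos (by norm_num) (by omega)
  have hmem : ((Request.query τ : Request n).pass s).mem = s.mem := by
    rcases τ with _ | t <;> rfl
  have key : Runs w RetroDegree.query ((Request.query τ : Request n).pass s)
      (2000 * n * Nat.log 2 (S.card + 2)) fun s' => s'.reg 0 = S.maxDegree τ ∧
      s'.mem = ((Request.query τ : Request n).pass s).mem := by
    rcases τ with _ | t
    · exact query_spec (t := 0) (by rwa [hmem]) hS hB hn hn0 hSB (by simp [Request.pass])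
        (.inr ⟨by simp [Request.pass], rfl⟩)
    · have htB : t ≤ B := by
        rcases hb with hb | hb
        · exact absurd hb (by rintro ⟨⟩)
        · exact WithTop.coe_le_coe.1 hb
      exact query_spec (t := t) (by rwa [hmem]) hS hB hn hn0 hSB (by simp [Request.pass])
        (.inl ⟨by simp [Request.pass], by simp [Request.pass], htB, rfl⟩)
  rw [mul_assoc] at key ⊢
  refine (main_query (L := n * Nat.log 2 (S.card + 2)) (by omega)
    (by rcases τ with _ | t <;> simp [Request.pass]) (Nat.mul_pos hn0 hlog) key).mono
    (by omega) ?_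
  rintro s' ⟨h₁, h₂⟩
  exact ⟨h₁, H, hS, by rwa [h₂, hmem]⟩

/-- The program serves a request. -/
theorem Valid.step {w B : ℕ} {S : History n} {s : State} {r : Request n} (h : Valid w B S s)
    (hB : Large B w) (hn : n ≤ B) (hn0 : 0 < n) (hSB : S.card ≤ B) (hl : r.Legal S)
    (hb : r.Bounded B) :
    ∃ k s', Exec w main (r.pass s) k s' ∧ Valid w B (r.apply S) s' ∧
      (∀ t, r = .query t → s'.answer = S.maxDegree t ∧
        k ≤ 220000 * n * Nat.log 2 (S.card + 2)) ∧
      (r.isOperation → k ≤ 220000 * Nat.log 2 ((r.apply S).card + 2) ^ 2) := by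
  by_cases hr : r.isOperation
  · obtain ⟨k, s', h₁, h₂, h₃⟩ := h.operation hB hn hr hl hb
    exact ⟨k, s', h₁, h₃, by rintro t rfl; simp [Request.isOperation] at hr, fun _ => h₂⟩
  · cases r with
    | create u t => simp [Request.isOperation] at hr
    | cancel t => simp [Request.isOperation] at hr
    | query t =>
      obtain ⟨k, s', h₁, h₂, h₃, h₄⟩ := h.query hB hn hn0 hSB hb
      exact ⟨k, s', h₁, h₄, by rintro _ ⟨⟩; exact ⟨h₃, h₂⟩, fun h => absurd h hr⟩

end

end RetroDegree

theorem mainTheorem3 :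
    ∃ (p : RetroDegree.Program) (c C : ℕ),
      ∀ (n B w : ℕ), 0 < n → n ≤ B → (B + 2) ^ c ≤ 2 ^ w →
      ∀ req : ℕ → RetroDegree.Request n,
        (∀ i, (req i).Legal (RetroDegree.historyBefore req i)) →
        (∀ i, (req i).Bounded B) →
        (∀ i, (RetroDegree.historyBefore req i).card ≤ B) →
        ∃ (s : ℕ → RetroDegree.State) (k : ℕ → ℕ),
          RetroDegree.IsRun p w req s k ∧
          (∀ i t, req i = .query t →
            (s (i + 1)).answer = (RetroDegree.historyBefore req i).maxDegree t ∧
            k i ≤ C * n * Nat.log 2 ((RetroDegree.historyBefore req i).card + 2)) ∧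
          (∀ N : ℕ,
            ∑ i ∈ (Finset.range N).filter (fun i => (req i).isOperation), k i ≤
              C * ∑ i ∈ (Finset.range N).filter (fun i => (req i).isOperation),
                Nat.log 2 ((RetroDegree.historyBefore req (i + 1)).card + 2) ^ 2) := by
  classical
  -- The exponent 40 is that of `Large`; the constant 220000 covers both operations and queries.
  refine ⟨RetroDegree.main, 40, 220000, fun n B w hn0 hn hB req hl hb hc => ?_⟩
  have step := fun i s (h : RetroDegree.Valid w B (RetroDegree.historyBefore req i) s) =>
    h.step hB hn hn0 (hc i) (hl i) (hb i)
  choose k next hexec hvalid hquery hop using step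
  -- The states are built by recursion together with their validity, as the next state is available
  -- only for a valid one.
  let run : ∀ i, {s // RetroDegree.Valid w B (RetroDegree.historyBefore req i) s} := fun i =>
    Nat.rec ⟨RetroDegree.State.init, RetroDegree.valid_init w B⟩
      (fun i s => ⟨next i s.1 s.2, hvalid i s.1 s.2⟩) i
  refine ⟨fun i => (run i).1, fun i => k i (run i).1 (run i).2, ⟨rfl, fun i => hexec i _ _⟩,
    fun i t h => hquery i _ _ t h, fun N => ?_⟩
  -- The amortized bound holds term by term, since each operation satisfies it by itself.
  rw [Finset.mul_sum]
  exact Finset.sum_le_sum fun i hi => hop i _ _ (Finset.mem_filter.1 hi).2
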